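/- Let $0\le\alpha<1$, $c>0$, $X=\mathbb R\times\mathbb R$ with Lebesgue measure, $\beta(\omega)=(1+|\omega|)^{-\alpha}$. On $L^2(\mathbb R)$ (inner product linear in the first variable) let $T_xf(t)=f(t-x)$, $M_\omega f(t)=e^{2\pi i\omega t}f(t)$, $D_af(t)=a^{-1/2}f(t/a)$, and for $\psi\in L^2(\mathbb R)$ put $\psi_{(x,\omega)}=T_xM_\omega D_{\beta(\omega)}\psi$. If the operator $A_\psi f=\int_X\langle f,\psi_z\rangle\psi_z\,dz$ (weak integral) is bounded and boundedly invertible on $L^2(\mathbb R)$, set $\mathcal R(x,y)=\langle A_\psi^{-1}\psi_x,\psi_y\rangle$ for $x,y\in X$. Put $p_\alpha(\omega)=\operatorname{sgn}(\omega)\big((1+(1-\alpha)|\omega|)^{1/(1-\alpha)}-1\big)$ and, for $\varepsilon>0$ and $j,k\in\mathbb Z$, $\omega_j=p_\alpha(\varepsilon j)$, $$U^\varepsilon_{j,k}=\varepsilon\beta(\omega_j)(k-1,k+1)\times\big(\omega_j-2\varepsilon c\,\beta(\omega_j)^{-1},\ \omega_j+2\varepsilon c\,\beta(\omega_j)^{-1}\big),\qquad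 \mathcal U^\varepsilon=\{U^\varepsilon_{j,k}\}_{j,k\in\mathbb Z}.$$ For $y\in X$ let $Q_y$ be the union of the members of $\mathcal U^\varepsilon$ containing $y$, and for measurable $\Gamma:X\times X\to\mathbb C$ with $|\Gamma|\equiv1$ let $$osc_{\mathcal U^\varepsilon,\Gamma}(x,y)=\sup_{z\in Q_y}|\mathcal R(x,y)-\Gamma(y,z)\mathcal R(x,z)|$$ (a supremum over the empty set being $0$). For $s\ge 0$ let $v_s(x,\omega)=(1+|\omega|)^s$ and $w_s(x,y)=\max\{v_s(x)/v_s(y),v_s(y)/v_s(x)\}$ for $x,y\in X$, and $$\gamma_1(\varepsilon)=\sup_{y\in X}\int_X osc_{\mathcal U^\varepsilon,\Gamma}(x,y)\,w_s(x,y)\,dx,\qquad \gamma_2(\varepsilon)=\sup_{x\in X}\int_X osc_{\mathcal U^\varepsilon,\Gamma}(x,y)\,w_s(x,y)\,dy,$$ $\gamma(\varepsilon)=\max\{\gamma_1(\varepsilon),\gamma_2(\varepsilon)\}$, $\rho=\sup_{y}\int_X|\mathcal R(x,y)|w_s(x,y)\,dx$ and $C_{w_s,\mathcal U^\varepsilon}=\sup_{j,k}\sup_{x,y\in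 U^\varepsilon_{j,k}}w_s(x,y)$. **Theorem.** There is a measurable $\Gamma:X\times X\to\mathbb C$ with $|\Gamma|\equiv1$ such that the following holds for all $s\ge0$, all real $r$ with $$r>\frac{2+2s+7\alpha-4\alpha^2}{2(1-\alpha)^2}+1$$ and all $0\neq\psi\in L^2(\mathbb R)$ such that $\hat\psi\in C^3(\mathbb R)$ and, for some constant $C$, $|\hat\psi^{(n)}(\xi)|\le C(1+|\xi|)^{-r}$ for $n=0,1,2,3$ and all $\xi\in\mathbb R$. The operator $A_\psi$ is bounded and boundedly invertible, $osc_{\mathcal U^\varepsilon,\Gamma}$ is measurable for every $\varepsilon>0$, and $\gamma(\varepsilon)\to0$ as $\varepsilon\to0^+$. Moreover, if $c>1/4$, the hypotheses of the discretization theorem for generalized coorbit spaces are met for small $\varepsilon$: $\rho<\infty$, and there are $\varepsilon_0>0$ and $K<\infty$ such that for all $0<\varepsilon<\varepsilon_0$ the family $\mathcal U^\varepsilon$ is a moderate admissible covering of $X$ (relatively compact sets with non-empty interior that cover $X$, each meeting at most $N$ of them, with measures bounded below by a positive constant and comparable, with a uniform constant, for sets that meet), $C_{w_s,\mathcal U^\varepsilon}\le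 K$, and $$\gamma(\varepsilon)\Big(\rho+\max\{\rho\,C_{w_s,\mathcal U^\varepsilon},\ \rho+\gamma(\varepsilon)\}\Big)<1 .$$ Finally, there is a compactly supported $0\ne\psi\in L^2(\mathbb R)$ that satisfies the above regularity and decay condition on $\hat\psi$ for every real $r$. -/

import Mathlib

open MeasureTheory Filter Topology Set
open scoped ENNReal FourierTransform

namespace AlphaMod

noncomputable section

/-- The Hilbert space `L²(ℝ)`. -/
abbrev L2 : Type := Lp ℂ 2 (volume : Measure ℝ)

/-! ### Translation, modulation, dilation -/

/-- `T_x f(t) = f(t - x)`. -/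
def translate (x : ℝ) (f : ℝ → ℂ) : ℝ → ℂ := fun t => f (t - x)

/-- `M_ω f(t) = e^{2πiωt} f(t)`. -/
def modulate (ω : ℝ) (f : ℝ → ℂ) : ℝ → ℂ :=
  fun t => Complex.exp (2 * Real.pi * Complex.I * ω * t) * f t

/-- `D_a f(t) = a^{-1/2} f(t / a)`, for `a > 0`. -/
def dilate (a : ℝ) (f : ℝ → ℂ) : ℝ → ℂ := fun t => ((1 / Real.sqrt a : ℝ) : ℂ) * f (t / a)

theorem memLp_translate (x : ℝ) {f : ℝ → ℂ} (hf : MemLp f 2 volume) :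
    MemLp (translate x f) 2 volume :=
  hf.comp_measurePreserving (measurePreserving_sub_right volume x)

theorem memLp_modulate (ω : ℝ) {f : ℝ → ℂ} (hf : MemLp f 2 volume) :
    MemLp (modulate ω f) 2 volume := by
  refine hf.congr_norm ?_ ?_
  · refine AEStronglyMeasurable.mul ?_ hf.1
    exact Continuous.aestronglyMeasurable (by fun_prop)
  · refine Eventually.of_forall fun t => ?_
    have h : (2 * Real.pi * Complex.I * ω * t : ℂ) = ((2 * Real.pi * ω * t : ℝ) : ℂ) * Complex.I := by
      push_cast; ring
    simp only [modulate, norm_mul, h, Complex.norm_exp_ofReal_mul_I, one_mul]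

theorem memLp_dilate {a : ℝ} (ha : 0 < a) {f : ℝ → ℂ} (hf : MemLp f 2 volume) :
    MemLp (dilate a f) 2 volume := by
  have ha' : a⁻¹ ≠ 0 := inv_ne_zero ha.ne'
  have hmap := Real.map_volume_mul_right ha'
  have h1 : MemLp f 2 (Measure.map (· * a⁻¹) volume) := by
    rw [hmap]
    exact hf.smul_measure ENNReal.ofReal_ne_top
  have h2 : MemLp (f ∘ (· * a⁻¹)) 2 volume :=
    (memLp_map_measure_iff h1.1 (by fun_prop)).1 h1
  exact h2.const_mul _

/-! ### The section and the system `π(σ(x, ω))ψ` -/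

/-- `β(ω) = (1 + |ω|)^{-α}`. -/
def beta (α ω : ℝ) : ℝ := (1 + |ω|) ^ (-α)

theorem beta_pos (α ω : ℝ) : 0 < beta α ω := Real.rpow_pos_of_pos (by positivity) _

/-- `π(σ(x, ω))ψ = T_x M_ω D_{β(ω)} ψ` as an element of `L²(ℝ)`; the homogeneous space is
`X = ℝ × ℝ` with the measure `dx dω`, and `z = (x, ω)`. -/
def atom (α : ℝ) (ψ : L2) (z : ℝ × ℝ) : L2 :=
  (memLp_translate z.1 (memLp_modulate z.2 (memLp_dilate (beta_pos α z.2) (Lp.memLp ψ)))).toLp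
    (translate z.1 (modulate z.2 (dilate (beta α z.2) ψ)))

/-- `A` is the (bounded and boundedly invertible) frame operator
`A_σ f = ∫_X ⟨f, π(σ(z))ψ⟩ π(σ(z))ψ dz`, the integral being understood weakly. Mathlib's
`inner ℂ g f` is linear in `f`, i.e. it is `⟨f, g⟩` for the inner product linear in the first
variable. The weak identity determines `A`; the existence of such an `A`, for `ψ ≠ 0`, is the
admissibility of `ψ`. -/
def IsFrameOperator (α : ℝ) (ψ : L2) (A : L2 ≃L[ℂ] L2) : Prop :=
  ∀ f h : L2,
    Integrable (fun z : ℝ × ℝ => inner ℂ (atom α ψ z) f * inner ℂ h (atom α ψ z)) ∧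
    inner ℂ h (A f) = ∫ z : ℝ × ℝ, inner ℂ (atom α ψ z) f * inner ℂ h (atom α ψ z)

/-- The reproducing kernel `R(x, y) = ⟨A⁻¹ π(σ(x))ψ, π(σ(y))ψ⟩`. -/
def kernelR (α : ℝ) (ψ : L2) (A : L2 ≃L[ℂ] L2) (x y : ℝ × ℝ) : ℂ :=
  inner ℂ (atom α ψ y) (A.symm (atom α ψ x))

/-- `ψ̂` has a `C^n` representative whose derivatives up to order `n` are bounded by
`C (1 + |ξ|)^{-r}`. -/
def HasFourierDecay (n : ℕ) (r : ℝ) (ψ : L2) : Prop :=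
  ∃ g : ℝ → ℂ, (𝓕 ψ : L2) =ᵐ[volume] g ∧ ContDiff ℝ n g ∧
    ∃ C : ℝ, ∀ l ≤ n, ∀ ξ : ℝ, ‖iteratedDeriv l g ξ‖ ≤ C * (1 + |ξ|) ^ (-r)

/-! ### Weights -/

/-- `v_s(x, ω) = (1 + |ω|)^s`. -/
def weightV (s : ℝ) (z : ℝ × ℝ) : ℝ := (1 + |z.2|) ^ s

/-- `w_s(x, y) = max {v_s(x) / v_s(y), v_s(y) / v_s(x)}`. -/
def weightW (s : ℝ) (x y : ℝ × ℝ) : ℝ :=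
  max (weightV s x / weightV s y) (weightV s y / weightV s x)

/-! ### Coverings -/

/-- Moderate admissible coverings of `X`, with respect to a measure `μ`. -/
structure IsModerateAdmissibleCovering {X ι : Type*} [TopologicalSpace X] [MeasurableSpace X]
    (μ : Measure X) (U : ι → Set X) : Prop where
  countable_index : Countable ι
  relatively_compact : ∀ i, IsCompact (closure (U i))
  interior_nonempty : ∀ i, (interior (U i)).Nonempty
  covers : ⋃ i, U i = univ
  finite_overlap : ∃ N : ℕ, ∀ j, {i | (U i ∩ U j).Nonempty}.encard ≤ N
  measure_lower : ∃ a : ℝ≥0∞, 0 < a ∧ ∀ i, a ≤ μ (U i)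
  measure_comparable : ∃ C : ℝ≥0∞, C ≠ ∞ ∧
    ∀ i j, (U i ∩ U j).Nonempty → μ (U i) ≤ C * μ (U j)

/-- `p_α(ω) = sgn(ω) ((1 + (1 - α)|ω|)^{1/(1-α)} - 1)`. -/
def pAlpha (α ω : ℝ) : ℝ := Real.sign ω * ((1 + (1 - α) * |ω|) ^ (1 / (1 - α)) - 1)

/-- `ω_j = p_α(εj)`. -/
def omegaPt (α ε : ℝ) (j : ℤ) : ℝ := pAlpha α (ε * j)

/-- `U_{j,k}^ε = εβ(ω_j)(k-1, k+1) × (ω_j - 2εcβ(ω_j)⁻¹, ω_j + 2εcβ(ω_j)⁻¹)`. -/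
def coverU (α c ε : ℝ) (i : ℤ × ℤ) : Set (ℝ × ℝ) :=
  Ioo (ε * beta α (omegaPt α ε i.1) * (i.2 - 1)) (ε * beta α (omegaPt α ε i.1) * (i.2 + 1)) ×ˢ
    Ioo (omegaPt α ε i.1 - 2 * ε * c * (beta α (omegaPt α ε i.1))⁻¹)
      (omegaPt α ε i.1 + 2 * ε * c * (beta α (omegaPt α ε i.1))⁻¹)

/-- `Q_y`, the union of all members of the family `U` that contain `y`. -/
def nbhdQ {X ι : Type*} (U : ι → Set X) (y : X) : Set X := ⋃ i ∈ {i | y ∈ U i}, U i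

/-- `C_{w,U} = sup_i sup_{x,y ∈ U_i} w(x, y)`, in `[0, ∞]`. -/
def weightConst {X ι : Type*} (w : X → X → ℝ) (U : ι → Set X) : ℝ≥0∞ :=
  ⨆ i, ⨆ x ∈ U i, ⨆ y ∈ U i, ENNReal.ofReal (w x y)

/-! ### The local oscillation kernel and its weighted integrals -/

/-- `osc_{U,Γ}(x, y) = sup_{z ∈ Q_y} |R(x, y) - Γ(y, z) R(x, z)|`, in `[0, ∞]`. -/
def osc {X ι : Type*} (R : X → X → ℂ) (U : ι → Set X) (Γ : X → X → ℂ) (x y : X) : ℝ≥0∞ :=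
  ⨆ z ∈ nbhdQ U y, ‖R x y - Γ y z * R x z‖ₑ

/-- `sup_y ∫ K(x, y) w(x, y) dx`. -/
def supIntFst {X : Type*} [MeasureSpace X] (K : X → X → ℝ≥0∞) (w : X → X → ℝ) : ℝ≥0∞ :=
  ⨆ y, ∫⁻ x, K x y * ENNReal.ofReal (w x y)

/-- `sup_x ∫ K(x, y) w(x, y) dy`. -/
def supIntSnd {X : Type*} [MeasureSpace X] (K : X → X → ℝ≥0∞) (w : X → X → ℝ) : ℝ≥0∞ :=
  ⨆ x, ∫⁻ y, K x y * ENNReal.ofReal (w x y)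

/-- `osc_{U^ε,Γ}` for the covering `U^ε`. -/
def oscEps (α c : ℝ) (ψ : L2) (A : L2 ≃L[ℂ] L2) (Γ : ℝ × ℝ → ℝ × ℝ → ℂ) (ε : ℝ) :
    ℝ × ℝ → ℝ × ℝ → ℝ≥0∞ :=
  osc (kernelR α ψ A) (coverU α c ε) Γ

/-- `γ₁(ε)`. -/
def gammaOne (α c s : ℝ) (ψ : L2) (A : L2 ≃L[ℂ] L2) (Γ : ℝ × ℝ → ℝ × ℝ → ℂ) (ε : ℝ) : ℝ≥0∞ :=
  supIntFst (oscEps α c ψ A Γ ε) (weightW s)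

/-- `γ₂(ε)`. -/
def gammaTwo (α c s : ℝ) (ψ : L2) (A : L2 ≃L[ℂ] L2) (Γ : ℝ × ℝ → ℝ × ℝ → ℂ) (ε : ℝ) : ℝ≥0∞ :=
  supIntSnd (oscEps α c ψ A Γ ε) (weightW s)

/-- `γ(ε) = max {γ₁(ε), γ₂(ε)}`. -/
def gammaMax (α c s : ℝ) (ψ : L2) (A : L2 ≃L[ℂ] L2) (Γ : ℝ × ℝ → ℝ × ℝ → ℂ) (ε : ℝ) : ℝ≥0∞ :=
  max (gammaOne α c s ψ A Γ ε) (gammaTwo α c s ψ A Γ ε)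

/-- `ρ = sup_y ∫ |R(x, y)| w_s(x, y) dx`; the supremum over all `y` dominates the essential
supremum. -/
def rho (α s : ℝ) (ψ : L2) (A : L2 ≃L[ℂ] L2) : ℝ≥0∞ :=
  supIntFst (fun x y => ‖kernelR α ψ A x y‖ₑ) (weightW s)

end

end AlphaMod

namespace AlphaMod

noncomputable section

/-! Write `φ` for the Fourier transform of `ψ`. The atom at `(x, ω)` has transform `e^{-2πixξ} √β(ω)
φ(β(ω)(ξ-ω))`. For fixed `ω`, Parseval in `x` and then Fubini show that the frame operator is the
Fourier multiplier with symbol `m(ξ) = ∫ β(ω) |φ(β(ω)(ξ-ω))|² dω`. Because `β` is slowly varying,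
`m` is bounded above and away from zero (`norm_symbolInt_le`, `exists_symbol_lower_bound`), and each
derivative of `m` or of `1/m` gains a factor `β(ξ)`.

Hence `R(x, y)` is the Fourier transform, at `x₁ - y₁`, of `1/m` times two dilated copies of `φ`
centred at `x₂` and `y₂`. Each derivative of this product costs at most `β(x₂) + β(y₂) + β(ξ)`, so
two integrations by parts give `majorant`, on any time scale `l` (`Jet.enorm_fourier_le_majorant`).

For the oscillation the phase is `Γ(y, z) = e^{2πi(y₁-z₁)y₂}`. With it, the difference of the atoms
at `y` and `z` is again an atom at `y`, with `φ` replaced by `φ(v) - √k e^{-2πiδv} φ(k(v-μ))`, where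
`k - 1`, `δ`, `μ` are `O(ε)` for `z ∈ Q_y`. This function and two of its derivatives are
`O(ε)(1+|v|)^{-(r-1)}` (`DecayJet.oscJet_bd`): the mean value theorem uses the third derivative of
`φ`, and the factor `|v|` uses one power of decay. So the oscillation obeys the kernel's bound times
`O(ε)` (`DecayJet.exists_kernel`).

It remains to bound the weighted integrals of the majorant uniformly (`majorant_integral_lt_top`).
All weights and values of `β` are transported to the common frequency `ξ` at the cost of powers of
`scaledDist`; the hypothesis on `r` leaves enough decay to integrate. The covering properties follow
because `ω_j` samples the curve `p_α`, whose speed is `1/β(p_α)`. -/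

/-- On `L¹ ∩ L²` the `L²` inverse Fourier transform is given by the Fourier integral. -/
theorem fourierInv_toLp_ae_eq {f : ℝ → ℂ} (h1 : Integrable f) (h2 : MemLp f 2 volume) :
    (𝓕⁻ (h2.toLp f : L2) : L2) =ᵐ[volume] 𝓕⁻ f := by
  refine ae_eq_of_integral_contDiff_smul_eq
    ((Lp.memLp _).locallyIntegrable (by norm_num)) ?_ fun g hg hgc => ?_
  · have : Continuous (𝓕⁻ f) :=
      VectorFourier.fourierIntegral_continuous Real.continuous_fourierChar
        (by simp only [LinearMap.neg_apply, innerₗ_apply_apply]; fun_prop) h1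
    exact this.locallyIntegrable
  · have hg₁ : HasCompactSupport (Complex.ofRealCLM ∘ g) := hgc.comp_left rfl
    have hg₂ : ContDiff ℝ (⊤ : ℕ∞) (Complex.ofRealCLM ∘ g) := by fun_prop
    set G := hg₁.toSchwartzMap hg₂ with hG
    have hGx : ∀ x, G x = (g x : ℂ) := fun x => rfl
    calc ∫ x, g x • (𝓕⁻ (h2.toLp f : L2) : L2) x
        = ((𝓕⁻ (h2.toLp f : L2) : L2) : TemperedDistribution ℝ ℂ) G := by
          simp [Lp.toTemperedDistribution_apply, hGx]
      _ = ∫ x, (𝓕⁻ G) x • (h2.toLp f : L2) x := by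
          rw [← Lp.fourierInv_toTemperedDistribution_eq, TemperedDistribution.fourierInv_apply,
            Lp.toTemperedDistribution_apply]
      _ = ∫ x, (𝓕⁻ (G : ℝ → ℂ)) x • f x := by
          refine integral_congr_ae ?_
          filter_upwards [h2.coeFn_toLp] with x hx
          rw [hx, SchwartzMap.fourierInv_coe]
      _ = ∫ x, G x • 𝓕⁻ f x := by
          have := VectorFourier.integral_fourierIntegral_smul_eq_flip (μ := volume) (ν := volume)
            (L := -innerₗ ℝ) (f := (G : ℝ → ℂ)) (g := f) Real.continuous_fourierChar
            (by simp only [LinearMap.neg_apply, innerₗ_apply_apply]; fun_prop) G.integrable h1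
          have hflip : (-innerₗ ℝ : ℝ →ₗ[ℝ] ℝ →ₗ[ℝ] ℝ).flip = -innerₗ ℝ := by
            ext; simp
          rw [hflip] at this
          exact this
      _ = _ := by simp [hGx]

/-! ### Fourier transforms of the atoms -/

/-- The Fourier transform of the atom, as a function. -/
def atomHat (α : ℝ) (φ : ℝ → ℂ) (z : ℝ × ℝ) (ξ : ℝ) : ℂ :=
  Complex.exp (((-2 * Real.pi * z.1 * ξ : ℝ) : ℂ) * Complex.I) *
    ((Real.sqrt (beta α z.2) : ℂ) * φ (beta α z.2 * (ξ - z.2)))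

theorem norm_atomHat (α : ℝ) (φ : ℝ → ℂ) (z : ℝ × ℝ) (ξ : ℝ) :
    ‖atomHat α φ z ξ‖ = Real.sqrt (beta α z.2) * ‖φ (beta α z.2 * (ξ - z.2))‖ := by
  rw [atomHat, norm_mul, Complex.norm_exp_ofReal_mul_I, one_mul, norm_mul, Complex.norm_real,
    Real.norm_of_nonneg (Real.sqrt_nonneg _)]

theorem continuous_atomHat (α : ℝ) {φ : ℝ → ℂ} (hφ : Continuous φ) (z : ℝ × ℝ) :
    Continuous (atomHat α φ z) := by
  unfold atomHat; fun_prop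

theorem integrable_atomHat (α : ℝ) {φ : ℝ → ℂ} (hφ : Continuous φ) (hi : Integrable φ)
    (z : ℝ × ℝ) : Integrable (atomHat α φ z) := by
  have h : Integrable fun ξ => φ (beta α z.2 * (ξ - z.2)) :=
    (hi.comp_mul_left' (beta_pos α z.2).ne').comp_sub_right z.2
  refine (h.norm.const_mul (Real.sqrt (beta α z.2))).mono'
    (continuous_atomHat α hφ z).aestronglyMeasurable (Eventually.of_forall fun ξ => ?_)
  rw [norm_atomHat]

theorem memLp_atomHat (α : ℝ) {φ : ℝ → ℂ} (hφ : Continuous φ) (hi : MemLp φ 2 volume)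
    (z : ℝ × ℝ) : MemLp (atomHat α φ z) 2 volume := by
  rw [memLp_two_iff_integrable_sq_norm (continuous_atomHat α hφ z).aestronglyMeasurable]
  have hi' := (memLp_two_iff_integrable_sq_norm hφ.aestronglyMeasurable).1 hi
  have h : Integrable fun ξ => ‖φ (beta α z.2 * (ξ - z.2))‖ ^ 2 :=
    (hi'.comp_mul_left' (beta_pos α z.2).ne').comp_sub_right z.2
  refine (h.const_mul (beta α z.2)).congr (Eventually.of_forall fun ξ => ?_)
  simp only [norm_atomHat, mul_pow, Real.sq_sqrt (beta_pos α z.2).le]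

theorem fourierInv_atomHat (α : ℝ) (φ : ℝ → ℂ) (z : ℝ × ℝ) (t : ℝ) :
    𝓕⁻ (atomHat α φ z) t = translate z.1 (modulate z.2 (dilate (beta α z.2) (𝓕⁻ φ))) t := by
  have hb := beta_pos α z.2
  have hs : Real.sqrt (beta α z.2) ≠ 0 := (Real.sqrt_pos.2 hb).ne'
  set b := beta α z.2 with hbdef
  simp only [translate, modulate, dilate, Real.fourierInv_eq', atomHat]
  -- The substitution `ξ ↦ b(ξ - ω)`, split into a dilation (`h1`) and a translation (`h2`).
  have h1 := Measure.integral_comp_mul_left (fun ξ : ℝ =>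
    Complex.exp (((2 * Real.pi * (t - z.1) * (ξ / b + z.2) : ℝ) : ℂ) * Complex.I) *
      ((Real.sqrt b : ℂ) * φ ξ)) b
  have h2 := integral_sub_right_eq_self (μ := (volume : Measure ℝ)) (fun ξ : ℝ =>
    Complex.exp (((2 * Real.pi * (t - z.1) * ((b * ξ) / b + z.2) : ℝ) : ℂ) * Complex.I) *
      ((Real.sqrt b : ℂ) * φ (b * ξ))) z.2
  rw [h1] at h2
  calc _ = _ := ?_
    _ = _ := h2
    _ = _ := ?_
  · congr 1; ext ξ
    have e0 : b * (ξ - z.2) / b = ξ - z.2 := by field_simp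
    rw [← hbdef, smul_eq_mul, ← mul_assoc, ← Complex.exp_add, e0]
    congr 2
    simp only [RCLike.inner_apply, conj_trivial]
    push_cast
    ring
  · rw [← integral_smul, ← integral_const_mul, ← integral_const_mul]
    congr 1; ext ξ
    simp only [RCLike.inner_apply, conj_trivial, smul_eq_mul, Complex.real_smul]
    have e : Complex.exp (((2 * Real.pi * (t - z.1) * (ξ / b + z.2) : ℝ) : ℂ) * Complex.I) =
      Complex.exp (2 * Real.pi * Complex.I * z.2 * ((t - z.1 : ℝ) : ℂ)) *
      Complex.exp (((2 * Real.pi * ((t - z.1) / b * ξ) : ℝ) : ℂ) * Complex.I) := by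
      rw [← Complex.exp_add]; congr 1; push_cast; field_simp; ring
    have e2 : ((|b⁻¹| : ℝ) : ℂ) * (Real.sqrt b : ℂ) = ((1 / Real.sqrt b : ℝ) : ℂ) := by
      rw [abs_of_pos (inv_pos.2 hb)]
      norm_cast
      field_simp
      rw [Real.sq_sqrt hb.le]
    rw [e, ← e2]; ring

theorem fourierInv_eq_of_ae {φ : ℝ → ℂ} {ψ : L2} (hψ : (𝓕 ψ : L2) =ᵐ[volume] φ)
    (h1 : Integrable φ) (h2 : MemLp φ 2 volume) : ψ =ᵐ[volume] 𝓕⁻ φ := by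
  have : (𝓕 ψ : L2) = h2.toLp φ := by
    ext1; exact hψ.trans h2.coeFn_toLp.symm
  have h3 : ψ = 𝓕⁻ (h2.toLp φ : L2) := by rw [← this, FourierTransform.fourierInv_fourier_eq]
  rw [h3]
  exact fourierInv_toLp_ae_eq h1 h2

theorem fourier_atom (α : ℝ) {φ : ℝ → ℂ} {ψ : L2} (hψ : (𝓕 ψ : L2) =ᵐ[volume] φ)
    (hφ : Continuous φ) (h1 : Integrable φ) (h2 : MemLp φ 2 volume) (z : ℝ × ℝ) :
    𝓕 (atom α ψ z) = (memLp_atomHat α hφ h2 z).toLp (atomHat α φ z) := by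
  have h3 := fourierInv_eq_of_ae hψ h1 h2
  have hb := beta_pos α z.2
  suffices atom α ψ z = 𝓕⁻ ((memLp_atomHat α hφ h2 z).toLp (atomHat α φ z) : L2) by
    rw [this, FourierTransform.fourier_fourierInv_eq]
  ext1
  refine (MemLp.coeFn_toLp _).trans ?_
  refine EventuallyEq.trans ?_
    (fourierInv_toLp_ae_eq (integrable_atomHat α hφ h1 z) (memLp_atomHat α hφ h2 z)).symm
  -- `ψ` agrees with `𝓕⁻ φ` only almost everywhere, so the affine change of variable must pull null
  -- sets back to null sets.
  have hq : Measure.QuasiMeasurePreserving (fun t : ℝ => (t - z.1) / beta α z.2) volume volume := by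
    refine ⟨by fun_prop, ?_⟩
    have : (fun t : ℝ => (t - z.1) / beta α z.2) =
      (fun t : ℝ => t * (beta α z.2)⁻¹) ∘ fun t => t - z.1 := by ext; simp [div_eq_mul_inv]
    rw [this, ← Measure.map_map (by fun_prop) (by fun_prop),
      (measurePreserving_sub_right volume z.1).map_eq,
      Real.map_volume_mul_right (inv_ne_zero hb.ne')]
    exact Measure.smul_absolutelyContinuous
  filter_upwards [hq.ae_eq h3] with t ht
  rw [fourierInv_atomHat]
  simp only [translate, modulate, dilate]
  rw [show ψ ((t - z.1) / beta α z.2) = 𝓕⁻ φ ((t - z.1) / beta α z.2) from ht]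

/-! ### Moderateness of `β` and of the weights -/

theorem continuous_beta (α : ℝ) : Continuous (beta α) := by
  unfold beta
  exact Continuous.rpow_const (by fun_prop) fun x => Or.inl (by positivity)

@[fun_prop]
theorem measurable_beta (α : ℝ) : Measurable (beta α) := (continuous_beta α).measurable

theorem beta_le_one {α : ℝ} (hα0 : 0 ≤ α) (ω : ℝ) : beta α ω ≤ 1 :=
  Real.rpow_le_one_of_one_le_of_nonpos (by linarith [abs_nonneg ω]) (by linarith)

theorem beta_inv (α ω : ℝ) : (beta α ω)⁻¹ = (1 + |ω|) ^ α := by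
  rw [beta, Real.rpow_neg (by positivity), inv_inv]

/-- The distance of `ξ` from `ω` on the scale of the covering at `ω`, plus one. -/
def scaledDist (α ω ξ : ℝ) : ℝ := 1 + beta α ω * |ξ - ω|

theorem one_le_scaledDist (α ω ξ : ℝ) : 1 ≤ scaledDist α ω ξ := by
  have := beta_pos α ω
  unfold scaledDist
  have : 0 ≤ beta α ω * |ξ - ω| := by positivity
  linarith

theorem scaledDist_pos (α ω ξ : ℝ) : 0 < scaledDist α ω ξ :=
  one_pos.trans_le (one_le_scaledDist α ω ξ)

theorem continuous_scaledDist (α : ℝ) : Continuous fun p : ℝ × ℝ => scaledDist α p.1 p.2 := by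
  have := continuous_beta α
  unfold scaledDist; fun_prop

theorem scaledDist_eq_abs (α ω ξ : ℝ) : scaledDist α ω ξ = 1 + |beta α ω * (ξ - ω)| := by
  rw [abs_mul, abs_of_pos (beta_pos α ω), scaledDist]

section

variable {α : ℝ} (hα0 : 0 ≤ α) (hα1 : α < 1)

theorem abs_sub_eq_scaledDist_mul (ω ξ : ℝ) :
    |ξ - ω| = (scaledDist α ω ξ - 1) * (1 + |ω|) ^ α := by
  rw [← beta_inv, scaledDist]
  field_simp [(beta_pos α ω).ne']
  ring

theorem one_add_abs_rpow_le (hα1 : α < 1) (ω : ℝ) : (1 + |ω|) ^ α ≤ 1 + |ω| := by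
  conv_rhs => rw [← Real.rpow_one (1 + |ω|)]
  exact Real.rpow_le_rpow_of_exponent_le (by linarith [abs_nonneg ω]) hα1.le

-- One unit of the scale at `ω` is `(1+|ω|)^α`, which is at most `1+|ω|`.
include hα1 in
theorem one_add_abs_le_mul_scaledDist (ω ξ : ℝ) :
    1 + |ξ| ≤ (1 + |ω|) * scaledDist α ω ξ := by
  have h1 : |ξ| ≤ |ω| + |ξ - ω| := by
    have := abs_add_le ω (ξ - ω); simpa using this
  have h2 := abs_sub_eq_scaledDist_mul (α := α) ω ξ
  have h3 : (scaledDist α ω ξ - 1) * (1 + |ω|) ^ α ≤ (scaledDist α ω ξ - 1) * (1 + |ω|) :=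
    mul_le_mul_of_nonneg_left (one_add_abs_rpow_le hα1 ω)
      (by linarith [one_le_scaledDist α ω ξ])
  nlinarith

-- With `W = 1+|ω|`, `X = 1+|ξ|`, `U = scaledDist α ω ξ`, only `X ≤ W` needs work. There `W ≤ X +
-- (U-1)W^α` and `X ≤ W^α X^{1-α}`; dividing by `W^α` gives `W^{1-α} ≤ X^{1-α} + U - 1 ≤ X^{1-α} U`.
include hα0 hα1 in
theorem one_add_abs_le_mul_scaledDist_rpow (ω ξ : ℝ) :
    1 + |ω| ≤ (1 + |ξ|) * scaledDist α ω ξ ^ (1 / (1 - α)) := by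
  have hU := one_le_scaledDist α ω ξ
  have h1α : 0 < 1 - α := by linarith
  have hX : 0 < 1 + |ξ| := by positivity
  have hW : 0 < 1 + |ω| := by positivity
  rcases le_total (1 + |ω|) (1 + |ξ|) with h | h
  · have : 1 ≤ scaledDist α ω ξ ^ (1 / (1 - α)) := Real.one_le_rpow hU (by positivity)
    nlinarith
  · have h1 : |ω| ≤ |ξ| + |ξ - ω| := by
      have := abs_add_le ξ (ω - ξ); rw [abs_sub_comm]; simpa using this
    rw [abs_sub_eq_scaledDist_mul (α := α) ω ξ] at h1
    have hWα : 0 < (1 + |ω|) ^ α := by positivity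
    have e1 : (1 + |ω|) ^ α * (1 + |ω|) ^ (1 - α) = 1 + |ω| := by
      rw [← Real.rpow_add hW]; simp
    have e2 : (1 + |ξ|) ^ α * (1 + |ξ|) ^ (1 - α) = 1 + |ξ| := by
      rw [← Real.rpow_add hX]; simp
    have h2 : 1 + |ξ| ≤ (1 + |ω|) ^ α * (1 + |ξ|) ^ (1 - α) := by
      refine e2.symm.le.trans ?_
      exact mul_le_mul_of_nonneg_right (Real.rpow_le_rpow hX.le h hα0) (by positivity)
    have hX1 : 1 ≤ (1 + |ξ|) ^ (1 - α) := Real.one_le_rpow (by linarith [abs_nonneg ξ]) h1α.le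
    have h3 : (1 + |ω|) ^ (1 - α) ≤ (1 + |ξ|) ^ (1 - α) * scaledDist α ω ξ := by
      have : (1 + |ω|) ^ α * (1 + |ω|) ^ (1 - α) ≤
          (1 + |ω|) ^ α * ((1 + |ξ|) ^ (1 - α) + (scaledDist α ω ξ - 1)) := by
        rw [e1]; linarith
      have := le_of_mul_le_mul_left this hWα
      nlinarith
    have h4 := Real.rpow_le_rpow (by positivity) h3 (z := 1 / (1 - α)) (by positivity)
    rw [Real.mul_rpow (by positivity) (by positivity), ← Real.rpow_mul hW.le,
      ← Real.rpow_mul hX.le, mul_one_div_cancel h1α.ne', Real.rpow_one, Real.rpow_one] at h4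
    exact h4

-- This bound and the next exchange `β` at the centre of an atom for `β` at the integration
-- frequency. The prices differ: `α` in this direction, `α/(1-α)` in the other.
include hα0 hα1 in
theorem beta_le_mul_scaledDist (ω ξ : ℝ) :
    beta α ω ≤ beta α ξ * scaledDist α ω ξ ^ α := by
  have hU := scaledDist_pos α ω ξ
  have h := Real.rpow_le_rpow (by positivity) (one_add_abs_le_mul_scaledDist hα1 ω ξ) hα0
  rw [Real.mul_rpow (by positivity) hU.le, ← beta_inv, ← beta_inv] at h
  have hb := beta_pos α ω
  have hx := beta_pos α ξ
  calc beta α ω = beta α ω * beta α ξ * (beta α ξ)⁻¹ := by field_simp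
    _ ≤ beta α ω * beta α ξ * ((beta α ω)⁻¹ * scaledDist α ω ξ ^ α) := by gcongr
    _ = _ := by field_simp

include hα0 hα1 in
theorem beta_le_mul_scaledDist_rpow (ω ξ : ℝ) :
    beta α ξ ≤ beta α ω * scaledDist α ω ξ ^ (α / (1 - α)) := by
  have hU := scaledDist_pos α ω ξ
  have h := Real.rpow_le_rpow (by positivity) (one_add_abs_le_mul_scaledDist_rpow hα0 hα1 ω ξ) hα0
  rw [Real.mul_rpow (by positivity) (by positivity), ← beta_inv, ← beta_inv,
    ← Real.rpow_mul hU.le, one_div_mul_eq_div] at h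
  have hb := beta_pos α ω
  have hx := beta_pos α ξ
  calc beta α ξ = beta α ξ * beta α ω * (beta α ω)⁻¹ := by field_simp
    _ ≤ beta α ξ * beta α ω * ((beta α ξ)⁻¹ * scaledDist α ω ξ ^ (α / (1 - α))) := by gcongr
    _ = _ := by field_simp

-- Moves the scale from `ω` to `ξ`. For fixed `ξ` the left side depends on `ω` through an affine
-- function, so it can be integrated in `ω`.
include hα0 hα1 in
theorem scaledDist_swap_rpow_le (ω ξ : ℝ) :
    (1 + beta α ξ * |ξ - ω|) ^ (1 - α) ≤ scaledDist α ω ξ := by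
  have hU := scaledDist_pos α ω ξ
  have hU1 := one_le_scaledDist α ω ξ
  have h1α : 0 < 1 - α := by linarith
  have hx := beta_pos α ξ
  have h1 : 1 + beta α ξ * |ξ - ω| ≤ scaledDist α ω ξ ^ (1 / (1 - α)) := by
    have h2 : beta α ξ * |ξ - ω| ≤ beta α ω * scaledDist α ω ξ ^ (α / (1 - α)) * |ξ - ω| :=
      mul_le_mul_of_nonneg_right (beta_le_mul_scaledDist_rpow hα0 hα1 ω ξ) (abs_nonneg _)
    have h3 : 1 ≤ scaledDist α ω ξ ^ (α / (1 - α)) := Real.one_le_rpow hU1 (by positivity)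
    have h4 : scaledDist α ω ξ ^ (1 / (1 - α)) =
        scaledDist α ω ξ ^ (α / (1 - α)) * scaledDist α ω ξ := by
      conv_rhs => rw [← Real.rpow_one (scaledDist α ω ξ), ← Real.rpow_mul hU.le,
        ← Real.rpow_add hU]
      congr 1; field_simp; ring
    have h5 : beta α ω * |ξ - ω| = scaledDist α ω ξ - 1 := by rw [scaledDist]; ring
    rw [h4]
    nlinarith
  have h2 := Real.rpow_le_rpow (by positivity) h1 h1α.le
  rwa [← Real.rpow_mul hU.le, one_div_mul_cancel h1α.ne', Real.rpow_one] at h2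

-- The ratio is split at `ξ`: passing from `x.2` to `ξ` costs the power `1/(1-α)`, passing from `ξ`
-- to `y.2` only the power one, which is weakened for symmetry.
include hα0 hα1 in
theorem weightV_div_le {s : ℝ} (hs : 0 ≤ s) (x y : ℝ × ℝ) (ξ : ℝ) :
    weightV s x / weightV s y ≤
      (scaledDist α x.2 ξ * scaledDist α y.2 ξ) ^ (s / (1 - α)) := by
  have hU := scaledDist_pos α x.2 ξ
  have hV := scaledDist_pos α y.2 ξ
  have hV1 := one_le_scaledDist α y.2 ξ
  have h1α : 0 < 1 - α := by linarith
  have hy : 0 < 1 + |y.2| := by positivity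
  unfold weightV
  rw [← Real.div_rpow (by positivity) (by positivity), show s / (1 - α) = 1 / (1 - α) * s by ring, Real.rpow_mul
    (by positivity)]
  refine Real.rpow_le_rpow (by positivity) ?_ hs
  rw [div_le_iff₀ hy, Real.mul_rpow hU.le hV.le]
  have h1 := one_add_abs_le_mul_scaledDist_rpow hα0 hα1 x.2 ξ
  have h2 := one_add_abs_le_mul_scaledDist hα1 y.2 ξ
  have h3 : scaledDist α y.2 ξ ≤ scaledDist α y.2 ξ ^ (1 / (1 - α)) := by
    conv_lhs => rw [← Real.rpow_one (scaledDist α y.2 ξ)]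
    exact Real.rpow_le_rpow_of_exponent_le hV1 (by rw [le_div_iff₀ h1α]; linarith)
  calc 1 + |x.2| ≤ (1 + |ξ|) * scaledDist α x.2 ξ ^ (1 / (1 - α)) := h1
    _ ≤ ((1 + |y.2|) * scaledDist α y.2 ξ ^ (1 / (1 - α))) *
        scaledDist α x.2 ξ ^ (1 / (1 - α)) := by
      gcongr; exact h2.trans (by gcongr)
    _ = _ := by ring

include hα0 hα1 in
theorem weightW_le {s : ℝ} (hs : 0 ≤ s) (x y : ℝ × ℝ) (ξ : ℝ) :
    weightW s x y ≤ (scaledDist α x.2 ξ * scaledDist α y.2 ξ) ^ (s / (1 - α)) :=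
  max_le (weightV_div_le hα0 hα1 hs x y ξ)
    (mul_comm (scaledDist α y.2 ξ) (scaledDist α x.2 ξ) ▸ weightV_div_le hα0 hα1 hs y x ξ)

end

theorem weightW_comm (s : ℝ) (x y : ℝ × ℝ) : weightW s x y = weightW s y x := max_comm _ _

theorem weightW_nonneg (s : ℝ) (x y : ℝ × ℝ) : 0 ≤ weightW s x y :=
  le_max_of_le_left (by unfold weightV; positivity)

/-! ### Integrals of powers of the scaled distance -/

/-- `∫ (1 + |t|)^{-q} dt`. -/
def bracketInt (q : ℝ) : ℝ≥0∞ := ∫⁻ t : ℝ, ENNReal.ofReal ((1 + |t|) ^ (-q))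

theorem integrable_bracket {q : ℝ} (hq : 1 < q) : Integrable fun t : ℝ => (1 + |t|) ^ (-q) := by
  simpa using integrable_one_add_norm (E := ℝ) (μ := volume) (r := q) (by simpa using hq)

theorem bracketInt_lt_top {q : ℝ} (hq : 1 < q) : bracketInt q < ∞ := by
  have := (integrable_bracket hq).hasFiniteIntegral
  rwa [hasFiniteIntegral_iff_ofReal (Eventually.of_forall fun t => by positivity)] at this

theorem lintegral_scale {f : ℝ → ℝ≥0∞} (hf : Measurable f) {b : ℝ} (hb : 0 < b) (x₀ : ℝ) :
    ∫⁻ x, f (b * (x - x₀)) = ENNReal.ofReal b⁻¹ * ∫⁻ x, f x := by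
  have h1 : ∫⁻ x, f (b * (x - x₀)) = ∫⁻ x, f (b * x) :=
    lintegral_sub_right_eq_self (fun x => f (b * x)) x₀
  have h2 : ∫⁻ x, f (b * x) = ∫⁻ x, f x ∂(Measure.map (b * ·) volume) :=
    (lintegral_map hf (by fun_prop)).symm
  rw [h1, h2, Real.map_volume_mul_left hb.ne', lintegral_smul_measure,
    abs_of_pos (inv_pos.2 hb), smul_eq_mul]

theorem lintegral_scaledDist_right (α q η : ℝ) :
    ∫⁻ ξ, ENNReal.ofReal (scaledDist α η ξ ^ (-q)) =
      ENNReal.ofReal (beta α η)⁻¹ * bracketInt q := by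
  rw [bracketInt, ← lintegral_scale (by fun_prop) (beta_pos α η) η]
  simp only [scaledDist_eq_abs]

/-- The factor `β(ξ)` is the one that the substitution `ω ↦ β(ξ)(ω - ξ)` absorbs, which makes the
bound uniform in `ξ`. -/
theorem lintegral_scaledDist_left {α : ℝ} (hα0 : 0 ≤ α) (hα1 : α < 1) {q : ℝ} (hq : 0 ≤ q)
    (ξ : ℝ) :
    ∫⁻ ω, ENNReal.ofReal (beta α ξ * scaledDist α ω ξ ^ (-q)) ≤ bracketInt ((1 - α) * q) := by
  have hx := beta_pos α ξ
  calc ∫⁻ ω, ENNReal.ofReal (beta α ξ * scaledDist α ω ξ ^ (-q))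
      ≤ ∫⁻ ω, ENNReal.ofReal (beta α ξ) *
          ENNReal.ofReal ((1 + |beta α ξ * (ω - ξ)|) ^ (-((1 - α) * q))) := by
        refine lintegral_mono fun ω => ?_
        rw [← ENNReal.ofReal_mul hx.le]
        refine ENNReal.ofReal_le_ofReal (mul_le_mul_of_nonneg_left ?_ hx.le)
        rw [abs_mul, abs_of_pos hx, abs_sub_comm, ← mul_neg, Real.rpow_mul (by positivity)]
        exact Real.rpow_le_rpow_of_nonpos (by positivity)
          (scaledDist_swap_rpow_le hα0 hα1 ω ξ) (by linarith)
    _ = ENNReal.ofReal (beta α ξ) * (ENNReal.ofReal (beta α ξ)⁻¹ * bracketInt ((1 - α) * q)) := by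
        rw [lintegral_const_mul _ (by fun_prop), bracketInt, ← lintegral_scale (by fun_prop) hx ξ]
    _ = bracketInt ((1 - α) * q) := by
        rw [← mul_assoc, ← ENNReal.ofReal_mul hx.le, mul_inv_cancel₀ hx.ne', ENNReal.ofReal_one,
          one_mul]

/-! ### A kernel with uniformly bounded weighted integrals -/

/-- The frequency part of the majorant of the kernel and of its oscillation. -/
def freqMajorant (α p l ω η ξ : ℝ) : ℝ :=
  Real.sqrt (beta α ω) * Real.sqrt (beta α η) *
    (1 + (beta α ω + beta α η + beta α ξ) / l) ^ 2 *
    (scaledDist α ω ξ ^ (-p) * scaledDist α η ξ ^ (-p))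

/-- A majorant of the kernel and of its oscillation, with decay on the scale `l` in time. -/
def majorant (α p l : ℝ) (x y : ℝ × ℝ) : ℝ≥0∞ :=
  (∫⁻ ξ, ENNReal.ofReal (freqMajorant α p l x.2 y.2 ξ)) *
    ENNReal.ofReal (1 / (1 + ((x.1 - y.1) / l) ^ 2))

theorem freqMajorant_nonneg (α p l ω η ξ : ℝ) : 0 ≤ freqMajorant α p l ω η ξ := by
  have := scaledDist_pos α ω ξ
  have := scaledDist_pos α η ξ
  unfold freqMajorant; positivity

theorem freqMajorant_comm (α p l ω η ξ : ℝ) :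
    freqMajorant α p l ω η ξ = freqMajorant α p l η ω ξ := by
  unfold freqMajorant
  rw [add_comm (beta α ω)]
  ring

theorem majorant_comm (α p l : ℝ) (x y : ℝ × ℝ) : majorant α p l x y = majorant α p l y x := by
  unfold majorant
  simp only [freqMajorant_comm α p l x.2 y.2]
  rw [← neg_sub y.1 x.1, neg_div, neg_sq]

/-- Everything is referred to `ξ`, and exactly one factor `β(ξ)` survives, from `√β(x₂) √β(y₂)`; it
is what the integration in `x₂` needs. The time scale is `β(y₂)` because `y` is the frozen variable.
-/
theorem weightW_mul_freqMajorant_le {α : ℝ} (hα0 : 0 ≤ α) (hα1 : α < 1) {s : ℝ} (hs : 0 ≤ s)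
    (p : ℝ) (x y : ℝ × ℝ) (ξ : ℝ) :
    freqMajorant α p (beta α y.2) x.2 y.2 ξ * weightW s x y ≤
      16 * (scaledDist α y.2 ξ ^ (-(p - s / (1 - α) - 2 * (α / (1 - α)) - α / 2)) *
        (beta α ξ * scaledDist α x.2 ξ ^ (-(p - s / (1 - α) - 2 * α - α / 2)))) := by
  have h1α : 0 < 1 - α := by linarith
  have ha := beta_pos α x.2
  have hb := beta_pos α y.2
  have hx := beta_pos α ξ
  have hU := scaledDist_pos α x.2 ξ
  have hV := scaledDist_pos α y.2 ξ
  have hU1 := one_le_scaledDist α x.2 ξ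
  have hV1 := one_le_scaledDist α y.2 ξ
  have hw := weightW_le hα0 hα1 hs x y ξ
  have h1 := beta_le_mul_scaledDist hα0 hα1 x.2 ξ
  have h2 := beta_le_mul_scaledDist hα0 hα1 y.2 ξ
  have h3 := beta_le_mul_scaledDist_rpow hα0 hα1 y.2 ξ
  unfold freqMajorant
  set a := beta α x.2
  set b := beta α y.2
  set U := scaledDist α x.2 ξ
  set V := scaledDist α y.2 ξ
  set B := beta α ξ
  have hsq : Real.sqrt a * Real.sqrt b ≤ B * (U ^ (α / 2) * V ^ (α / 2)) := by
    have e1 : Real.sqrt (B * U ^ α) = Real.sqrt B * U ^ (α / 2) := by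
      rw [Real.sqrt_mul hx.le, Real.sqrt_eq_rpow (U ^ α), ← Real.rpow_mul hU.le]; congr 2; ring
    have e2 : Real.sqrt (B * V ^ α) = Real.sqrt B * V ^ (α / 2) := by
      rw [Real.sqrt_mul hx.le, Real.sqrt_eq_rpow (V ^ α), ← Real.rpow_mul hV.le]; congr 2; ring
    calc Real.sqrt a * Real.sqrt b ≤ Real.sqrt (B * U ^ α) * Real.sqrt (B * V ^ α) := by gcongr
      _ = (Real.sqrt B * Real.sqrt B) * (U ^ (α / 2) * V ^ (α / 2)) := by rw [e1, e2]; ring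
      _ = _ := by rw [Real.mul_self_sqrt hx.le]
  -- The four summands `1`, `a/b`, `b/b`, `B/b` are each at most `U^α V^{α/(1-α)}`; to compare `a`
  -- with `b` one passes through `B`.
  have hM : 1 + (a + b + B) / b ≤ 4 * (U ^ α * V ^ (α / (1 - α))) := by
    have hUα : 1 ≤ U ^ α := Real.one_le_rpow hU1 hα0
    have hVα : 1 ≤ V ^ (α / (1 - α)) := Real.one_le_rpow hV1 (by positivity)
    have hB : B / b ≤ V ^ (α / (1 - α)) := by rw [div_le_iff₀ hb]; linarith
    have hab : a / b ≤ U ^ α * V ^ (α / (1 - α)) := by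
      rw [div_le_iff₀ hb]
      calc a ≤ B * U ^ α := h1
        _ ≤ b * V ^ (α / (1 - α)) * U ^ α := by gcongr
        _ = _ := by ring
    have e : (a + b + B) / b = a / b + 1 + B / b := by field_simp
    rw [e]
    nlinarith [one_le_mul_of_one_le_of_one_le hUα hVα]
  have hM0 : 0 ≤ 1 + (a + b + B) / b := by positivity
  calc Real.sqrt a * Real.sqrt b * (1 + (a + b + B) / b) ^ 2 * (U ^ (-p) * V ^ (-p)) *
        weightW s x y
      ≤ B * (U ^ (α / 2) * V ^ (α / 2)) * (4 * (U ^ α * V ^ (α / (1 - α)))) ^ 2 *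
        (U ^ (-p) * V ^ (-p)) * (U * V) ^ (s / (1 - α)) := by
        have := weightW_nonneg s x y
        gcongr
    _ = 16 * ((V ^ (-p) * V ^ (s / (1 - α)) * (V ^ (α / (1 - α)) * V ^ (α / (1 - α))) *
          V ^ (α / 2)) *
          (B * (U ^ (-p) * U ^ (s / (1 - α)) * (U ^ α * U ^ α) * U ^ (α / 2)))) := by
        rw [Real.mul_rpow hU.le hV.le]; ring
    _ = _ := by
        simp only [← Real.rpow_add hU, ← Real.rpow_add hV]
        congr 3
        · ring_nf
        · congr 2; ring_nf

/-- The time integral contributes `β(y₂)`, the integral over `ξ` contributes `β(y₂)⁻¹`, and the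
integral over `x₂` is bounded uniformly in `ξ`; the product does not depend on `y`. -/
theorem majorant_integral_lt_top {α : ℝ} (hα0 : 0 ≤ α) (hα1 : α < 1) {s : ℝ} (hs : 0 ≤ s)
    {p : ℝ} (hp : (2 + 2 * s + 7 * α - 4 * α ^ 2) / (2 * (1 - α) ^ 2) < p) :
    ∃ C : ℝ≥0∞, C < ∞ ∧ ∀ y : ℝ × ℝ,
      ∫⁻ x, majorant α p (beta α y.2) x y * ENNReal.ofReal (weightW s x y) ≤ C := by
  have h1α : 0 < 1 - α := by linarith
  have hd : 0 < 2 * (1 - α) ^ 2 := by positivity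
  rw [div_lt_iff₀ hd] at hp
  set q := p - s / (1 - α) - 2 * α - α / 2 with hq
  set q' := p - s / (1 - α) - 2 * (α / (1 - α)) - α / 2 with hq'
  -- The two integrability requirements, on `(1-α)q` for the integral in `x₂` and on `q'` for the
  -- integral in `ξ`, both follow from the threshold on `p`; multiplying by `1-α`, respectively
  -- `(1-α)²`, clears denominators.
  have hq1 : 1 < (1 - α) * q := by
    have e : (1 - α) * q = (1 - α) * p - s - (1 - α) * (2 * α + α / 2) := by
      rw [hq]; field_simp; ring
    rw [e, ← sub_pos]
    refine pos_of_mul_pos_left (b := 1 - α) ?_ h1α.le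
    nlinarith [mul_nonneg hα0 hs, mul_nonneg hα0 (mul_nonneg hα0 h1α.le), mul_nonneg hα0 h1α.le]
  have hq'1 : 1 < q' := by
    have e : (1 - α) ^ 2 * q' = (1 - α) ^ 2 * p - (1 - α) * s - 2 * (1 - α) * α
        - (1 - α) ^ 2 * (α / 2) := by
      rw [hq']; field_simp
    rw [← sub_pos]
    refine pos_of_mul_pos_left (b := (1 - α) ^ 2) ?_ (by positivity)
    nlinarith [mul_nonneg hα0 hs, mul_nonneg hα0 (mul_nonneg hα0 h1α.le), mul_nonneg hα0 h1α.le]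
  have hq0 : 0 ≤ q := by
    by_contra h
    nlinarith
  set J : ℝ≥0∞ := ∫⁻ t : ℝ, ENNReal.ofReal (1 / (1 + t ^ 2)) with hJ
  have hJtop : J < ∞ := by
    have := integrable_inv_one_add_sq.hasFiniteIntegral
    rw [hasFiniteIntegral_iff_ofReal (Eventually.of_forall fun t => by positivity)] at this
    simpa [hJ] using this
  refine ⟨J * (16 * (bracketInt q' * bracketInt ((1 - α) * q))), ?_, fun y => ?_⟩
  · exact ENNReal.mul_lt_top hJtop (ENNReal.mul_lt_top (by simp) (ENNReal.mul_lt_top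
      (bracketInt_lt_top hq'1) (bracketInt_lt_top hq1)))
  have hb := beta_pos α y.2
  have hcont := continuous_scaledDist α
  have hm : Measurable fun z : ℝ × ℝ => ENNReal.ofReal (scaledDist α y.2 z.2 ^ (-q')) *
      ENNReal.ofReal (beta α z.2 * scaledDist α z.1 z.2 ^ (-q)) := by
    have h1 : Measurable fun z : ℝ × ℝ => scaledDist α y.2 z.2 :=
      (hcont.comp (by fun_prop : Continuous fun z : ℝ × ℝ => (y.2, z.2))).measurable
    have h2 := hcont.measurable
    fun_prop
  set g : ℝ → ℝ≥0∞ := fun ω => ∫⁻ ξ, ENNReal.ofReal (scaledDist α y.2 ξ ^ (-q')) *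
      ENNReal.ofReal (beta α ξ * scaledDist α ω ξ ^ (-q)) with hg
  have hgm : Measurable g := hm.lintegral_prod_right'
  have hbound : ∀ x : ℝ × ℝ, majorant α p (beta α y.2) x y * ENNReal.ofReal (weightW s x y) ≤
      ENNReal.ofReal (1 / (1 + ((x.1 - y.1) / beta α y.2) ^ 2)) * (16 * g x.2) := by
    intro x
    have hint : ∫⁻ ξ, ENNReal.ofReal (freqMajorant α p (beta α y.2) x.2 y.2 ξ) *
        ENNReal.ofReal (weightW s x y) ≤ 16 * g x.2 := by
      have e16 : (16 : ℝ≥0∞) = ENNReal.ofReal 16 := by norm_num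
      rw [hg, e16, ← lintegral_const_mul' _ _ ENNReal.ofReal_ne_top]
      refine lintegral_mono fun ξ => ?_
      have hV := scaledDist_pos α y.2 ξ
      rw [← ENNReal.ofReal_mul (freqMajorant_nonneg _ _ _ _ _ _), ← ENNReal.ofReal_mul
        (by positivity), ← ENNReal.ofReal_mul (by norm_num)]
      exact ENNReal.ofReal_le_ofReal (weightW_mul_freqMajorant_le hα0 hα1 hs p x y ξ)
    rw [lintegral_mul_const' _ _ ENNReal.ofReal_ne_top] at hint
    calc _ = ENNReal.ofReal (1 / (1 + ((x.1 - y.1) / beta α y.2) ^ 2)) *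
          ((∫⁻ ξ, ENNReal.ofReal (freqMajorant α p (beta α y.2) x.2 y.2 ξ)) *
        ENNReal.ofReal (weightW s x y)) := by unfold majorant; ring
      _ ≤ _ := by gcongr
  refine (lintegral_mono hbound).trans ?_
  rw [Measure.volume_eq_prod, lintegral_prod_mul
    (f := fun t => ENNReal.ofReal (1 / (1 + ((t - y.1) / beta α y.2) ^ 2)))
    (g := fun ω => 16 * g ω) (by fun_prop) (by fun_prop)]
  have h1 : ∫⁻ t, ENNReal.ofReal (1 / (1 + ((t - y.1) / beta α y.2) ^ 2)) =
      ENNReal.ofReal (beta α y.2) * J := by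
    have := lintegral_scale (f := fun t => ENNReal.ofReal (1 / (1 + t ^ 2))) (by fun_prop)
      (inv_pos.2 hb) y.1
    simpa [hJ, div_eq_inv_mul] using this
  have h2 : ∫⁻ ω, g ω ≤ ENNReal.ofReal (beta α y.2)⁻¹ * (bracketInt q' *
      bracketInt ((1 - α) * q)) := by
    rw [hg, lintegral_lintegral_swap hm.aemeasurable]
    calc _ = ∫⁻ ξ, ENNReal.ofReal (scaledDist α y.2 ξ ^ (-q')) *
          ∫⁻ ω, ENNReal.ofReal (beta α ξ * scaledDist α ω ξ ^ (-q)) := by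
          refine lintegral_congr fun ξ => ?_
          rw [lintegral_const_mul' _ _ ENNReal.ofReal_ne_top]
      _ ≤ ∫⁻ ξ, ENNReal.ofReal (scaledDist α y.2 ξ ^ (-q')) * bracketInt ((1 - α) * q) := by
          gcongr with ξ
          exact lintegral_scaledDist_left hα0 hα1 hq0 ξ
      _ = _ := by
          rw [lintegral_mul_const' _ _ (bracketInt_lt_top hq1).ne, lintegral_scaledDist_right,
            mul_assoc]
  rw [h1, lintegral_const_mul _ hgm]
  calc ENNReal.ofReal (beta α y.2) * J * (16 * ∫⁻ ω, g ω)
      ≤ ENNReal.ofReal (beta α y.2) * J * (16 * (ENNReal.ofReal (beta α y.2)⁻¹ * (bracketInt q' *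
      bracketInt ((1 - α) * q)))) := by gcongr
    _ = (ENNReal.ofReal (beta α y.2) * ENNReal.ofReal (beta α y.2)⁻¹) *
      (J * (16 * (bracketInt q' * bracketInt ((1 - α) * q)))) := by ring
    _ = _ := by
      rw [← ENNReal.ofReal_mul hb.le, mul_inv_cancel₀ hb.ne', ENNReal.ofReal_one, one_mul]

/-! ### Functions with two derivatives, and scaled bounds for them -/

/-- A function `ℝ → ℂ` with its first two derivatives. -/
structure Jet where
  /-- the function -/
  f : ℝ → ℂ
  /-- its first derivative -/
  d1 : ℝ → ℂ
  /-- its second derivative -/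
  d2 : ℝ → ℂ
  h1 : ∀ x, HasDerivAt f (d1 x) x
  h2 : ∀ x, HasDerivAt d1 (d2 x) x

namespace Jet

/-- `|f^{(n)}(x)| ≤ l ^ n B` for `n = 0, 1, 2`. -/
structure Bd (J : Jet) (l B x : ℝ) : Prop where
  b0 : ‖J.f x‖ ≤ B
  b1 : ‖J.d1 x‖ ≤ l * B
  b2 : ‖J.d2 x‖ ≤ l ^ 2 * B

theorem Bd.nonneg {J : Jet} {l B x : ℝ} (h : J.Bd l B x) : 0 ≤ B := (norm_nonneg _).trans h.b0

theorem Bd.mono {J : Jet} {l l' B B' x : ℝ} (h : J.Bd l B x) (hl0 : 0 ≤ l) (hl : l ≤ l')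
    (hB : B ≤ B') : J.Bd l' B' x where
  b0 := h.b0.trans hB
  b1 := h.b1.trans (mul_le_mul hl hB h.nonneg (hl0.trans hl))
  b2 := h.b2.trans (mul_le_mul (by gcongr) hB h.nonneg (by positivity))

theorem continuous_f (J : Jet) : Continuous J.f :=
  continuous_iff_continuousAt.2 fun x => (J.h1 x).continuousAt

theorem deriv_f (J : Jet) : deriv J.f = J.d1 := funext fun x => (J.h1 x).deriv

theorem deriv_d1 (J : Jet) : deriv J.d1 = J.d2 := funext fun x => (J.h2 x).deriv

theorem measurable_d1 (J : Jet) : Measurable J.d1 := J.deriv_f ▸ measurable_deriv _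

theorem measurable_d2 (J : Jet) : Measurable J.d2 := J.deriv_d1 ▸ measurable_deriv _

/-- The product of two jets. -/
def mul (J K : Jet) : Jet where
  f x := J.f x * K.f x
  d1 x := J.d1 x * K.f x + J.f x * K.d1 x
  d2 x := J.d2 x * K.f x + 2 * (J.d1 x * K.d1 x) + J.f x * K.d2 x
  h1 x := (J.h1 x).mul (K.h1 x)
  h2 x := (((J.h2 x).mul (K.h1 x)).add ((J.h1 x).mul (K.h2 x))).congr_deriv (by ring)

/-- Leibniz: the second derivative has coefficients `1 + 2 + 1 = 4`, the largest of the three sums.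
-/
theorem Bd.mul {J K : Jet} {l B B' x : ℝ} (hl : 0 ≤ l) (hJ : J.Bd l B x) (hK : K.Bd l B' x) :
    (J.mul K).Bd l (4 * (B * B')) x := by
  have hB := hJ.nonneg
  have hB' := hK.nonneg
  have hBB : 0 ≤ B * B' := by positivity
  refine ⟨?_, ?_, ?_⟩
  · calc ‖J.f x * K.f x‖ ≤ B * B' := by
          rw [norm_mul]; exact mul_le_mul hJ.b0 hK.b0 (norm_nonneg _) hB
      _ ≤ _ := by linarith
  · calc ‖J.d1 x * K.f x + J.f x * K.d1 x‖ ≤ l * B * B' + B * (l * B') := by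
          refine (norm_add_le _ _).trans ?_
          rw [norm_mul, norm_mul]
          exact add_le_add (mul_le_mul hJ.b1 hK.b0 (norm_nonneg _) (by positivity))
            (mul_le_mul hJ.b0 hK.b1 (norm_nonneg _) (by positivity))
      _ ≤ _ := by nlinarith [mul_nonneg hl hBB]
  · calc ‖J.d2 x * K.f x + 2 * (J.d1 x * K.d1 x) + J.f x * K.d2 x‖
        ≤ l ^ 2 * B * B' + 2 * (l * B * (l * B')) + B * (l ^ 2 * B') := by
          refine (norm_add_le _ _).trans (add_le_add ((norm_add_le _ _).trans ?_) ?_)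
          · simp only [norm_mul, Complex.norm_ofNat]
            exact add_le_add (mul_le_mul hJ.b2 hK.b0 (norm_nonneg _) (by positivity))
              (by gcongr; exacts [hJ.b1, hK.b1])
          · rw [norm_mul]
            exact mul_le_mul hJ.b0 hK.b2 (norm_nonneg _) (by positivity)
      _ = _ := by ring

/-- The complex conjugate of a jet. -/
def conj (J : Jet) : Jet where
  f x := starRingEnd ℂ (J.f x)
  d1 x := starRingEnd ℂ (J.d1 x)
  d2 x := starRingEnd ℂ (J.d2 x)
  h1 x := (J.h1 x).star
  h2 x := (J.h2 x).star

theorem Bd.conj {J : Jet} {l B x : ℝ} (hJ : J.Bd l B x) : J.conj.Bd l B x := by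
  refine ⟨?_, ?_, ?_⟩
  · simpa [Jet.conj] using hJ.b0
  · simpa [Jet.conj] using hJ.b1
  · simpa [Jet.conj] using hJ.b2

/-- The difference of two jets. -/
def sub (J K : Jet) : Jet where
  f x := J.f x - K.f x
  d1 x := J.d1 x - K.d1 x
  d2 x := J.d2 x - K.d2 x
  h1 x := (J.h1 x).sub (K.h1 x)
  h2 x := (J.h2 x).sub (K.h2 x)

theorem Bd.sub {J K : Jet} {l B B' x : ℝ} (hJ : J.Bd l B x) (hK : K.Bd l B' x) :
    (J.sub K).Bd l (B + B') x := by
  refine ⟨(norm_sub_le _ _).trans ?_, (norm_sub_le _ _).trans ?_, (norm_sub_le _ _).trans ?_⟩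
  · exact add_le_add hJ.b0 hK.b0
  · rw [mul_add]; exact add_le_add hJ.b1 hK.b1
  · rw [mul_add]; exact add_le_add hJ.b2 hK.b2

/-- `c f(k (x - μ))`. -/
def affine (J : Jet) (c : ℂ) (k μ : ℝ) : Jet where
  f x := c * J.f (k * (x - μ))
  d1 x := c * (k * J.d1 (k * (x - μ)))
  d2 x := c * (k ^ 2 * J.d2 (k * (x - μ)))
  h1 x := by
    have h : HasDerivAt (fun x : ℝ => k * (x - μ)) k x := by
      simpa using ((hasDerivAt_id x).sub_const μ).const_mul k
    simpa using ((J.h1 (k * (x - μ))).scomp x h).const_mul c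
  h2 x := by
    have h : HasDerivAt (fun x : ℝ => k * (x - μ)) k x := by
      simpa using ((hasDerivAt_id x).sub_const μ).const_mul k
    refine ((((J.h2 (k * (x - μ))).scomp x h).const_mul (k : ℂ)).const_mul c).congr_deriv ?_
    simp only [Complex.real_smul]; ring

theorem Bd.affine {J : Jet} (c : ℂ) {k μ B x : ℝ} (hk : 0 ≤ k) (hJ : J.Bd 1 B (k * (x - μ))) :
    (J.affine c k μ).Bd k (‖c‖ * B) x := by
  have h1 := hJ.b1
  have h2 := hJ.b2
  rw [one_mul] at h1
  rw [one_pow, one_mul] at h2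
  have hc := norm_nonneg c
  refine ⟨?_, ?_, ?_⟩
  · simp only [Jet.affine, norm_mul]
    gcongr; exact hJ.b0
  · simp only [Jet.affine, norm_mul, Complex.norm_real, Real.norm_of_nonneg hk]
    calc _ = k * (‖c‖ * ‖J.d1 (k * (x - μ))‖) := by ring
      _ ≤ _ := by gcongr
  · simp only [Jet.affine, norm_mul, norm_pow, Complex.norm_real, Real.norm_of_nonneg hk]
    calc _ = k ^ 2 * (‖c‖ * ‖J.d2 (k * (x - μ))‖) := by ring
      _ ≤ _ := by gcongr

/-- The reciprocal of a jet without zeros. -/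
def inv (J : Jet) (h : ∀ x, J.f x ≠ 0) : Jet where
  f x := (J.f x)⁻¹
  d1 x := -J.d1 x / J.f x ^ 2
  d2 x := -J.d2 x / J.f x ^ 2 + 2 * J.d1 x ^ 2 / J.f x ^ 3
  h1 x := (J.h1 x).inv (h x)
  h2 x := by
    refine ((J.h2 x).neg.div ((J.h1 x).pow 2) (pow_ne_zero 2 (h x))).congr_deriv ?_
    have := h x
    simp only [Pi.neg_apply, Pi.pow_apply, Nat.cast_ofNat, Nat.add_one_sub_one, pow_one]
    field_simp
    ring

/-- The scale `l` is preserved, so the reciprocal of the symbol inherits its gain of `β(ξ)` per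
derivative. The constant adds up the terms that occur in the three derivatives. -/
theorem Bd.inv {J : Jet} (h : ∀ x, J.f x ≠ 0) {l B c x : ℝ} (hl : 0 ≤ l) (hc : 0 < c)
    (hcx : c ≤ ‖J.f x‖) (hJ : J.Bd l B x) :
    (J.inv h).Bd l (1 / c + B / c ^ 2 + 2 * B ^ 2 / c ^ 3) x := by
  have hB := hJ.nonneg
  have e1 : 0 ≤ 1 / c := by positivity
  have e2 : 0 ≤ B / c ^ 2 := by positivity
  have e3 : 0 ≤ 2 * B ^ 2 / c ^ 3 := by positivity
  refine ⟨?_, ?_, ?_⟩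
  · calc ‖(J.f x)⁻¹‖ ≤ 1 / c := by rw [norm_inv, one_div]; gcongr
      _ ≤ _ := by linarith
  · calc ‖-J.d1 x / J.f x ^ 2‖ ≤ l * B / c ^ 2 := by
          rw [norm_div, norm_neg, norm_pow]; gcongr; exact hJ.b1
      _ = l * (B / c ^ 2) := by ring
      _ ≤ _ := by gcongr; linarith
  · calc ‖-J.d2 x / J.f x ^ 2 + 2 * J.d1 x ^ 2 / J.f x ^ 3‖
        ≤ l ^ 2 * B / c ^ 2 + 2 * (l * B) ^ 2 / c ^ 3 := by
          refine (norm_add_le _ _).trans (add_le_add ?_ ?_)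
          · rw [norm_div, norm_neg, norm_pow]; gcongr; exact hJ.b2
          · rw [norm_div, norm_mul, norm_pow, norm_pow, Complex.norm_ofNat]; gcongr; exact hJ.b1
      _ = l ^ 2 * (B / c ^ 2 + 2 * B ^ 2 / c ^ 3) := by ring
      _ ≤ _ := by gcongr; linarith

/-- Decay of the Fourier transform on the time scale `l`. -/
theorem norm_fourier_le (J : Jet) (h0 : Integrable J.f) (h1 : Integrable J.d1)
    (h2 : Integrable J.d2) {l : ℝ} (hl : 0 < l) (t : ℝ) :
    ‖𝓕 J.f t‖ * (1 + (t / l) ^ 2) ≤ ∫ ξ, (‖J.f ξ‖ + ‖J.d2 ξ‖ / l ^ 2) := by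
  have e1 : 𝓕 J.d1 = fun x : ℝ => (2 * Real.pi * Complex.I * x) • 𝓕 J.f x := by
    rw [← J.deriv_f]
    exact Real.fourier_deriv h0 (fun x => (J.h1 x).differentiableAt) (by rwa [J.deriv_f])
  have e2 : 𝓕 J.d2 = fun x : ℝ => (2 * Real.pi * Complex.I * x) • 𝓕 J.d1 x := by
    rw [← J.deriv_d1]
    exact Real.fourier_deriv h1 (fun x => (J.h2 x).differentiableAt) (by rwa [J.deriv_d1])
  have hb (g : ℝ → ℂ) : ‖𝓕 g t‖ ≤ ∫ ξ, ‖g ξ‖ :=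
    VectorFourier.norm_fourierIntegral_le_integral_norm _ _ _ _ _
  have n2 : ‖𝓕 J.d2 t‖ = (2 * Real.pi * t) ^ 2 * ‖𝓕 J.f t‖ := by
    rw [e2]
    simp only [e1, smul_eq_mul, norm_mul, Complex.norm_ofNat, Complex.norm_real, Complex.norm_I,
      Real.norm_eq_abs, abs_of_pos Real.pi_pos]
    rw [mul_pow, ← sq_abs t]; ring
  -- The factor `(2π)²` produced by two derivatives is discarded.
  have hpi : 1 ≤ (2 * Real.pi) ^ 2 := by nlinarith [Real.pi_gt_three]
  have h3 : t ^ 2 * ‖𝓕 J.f t‖ ≤ ∫ ξ, ‖J.d2 ξ‖ := by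
    calc t ^ 2 * ‖𝓕 J.f t‖ ≤ (2 * Real.pi) ^ 2 * (t ^ 2 * ‖𝓕 J.f t‖) :=
          le_mul_of_one_le_left (by positivity) hpi
      _ = ‖𝓕 J.d2 t‖ := by rw [n2]; ring
      _ ≤ _ := hb _
  rw [integral_add h0.norm (h2.norm.div_const _), integral_div]
  calc ‖𝓕 J.f t‖ * (1 + (t / l) ^ 2) = ‖𝓕 J.f t‖ + t ^ 2 * ‖𝓕 J.f t‖ / l ^ 2 := by
        rw [div_pow]; ring
    _ ≤ _ := by gcongr; exact hb _

theorem integrable_of_bd (J : Jet) {L : ℝ} {l B : ℝ → ℝ} (hB : Integrable B)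
    (hl : ∀ x, 0 ≤ l x) (hL : ∀ x, l x ≤ L) (h : ∀ x, J.Bd (l x) (B x) x) :
    Integrable J.f ∧ Integrable J.d1 ∧ Integrable J.d2 := by
  have h' : ∀ x, J.Bd L (B x) x := fun x => (h x).mono (hl x) (hL x) le_rfl
  exact ⟨hB.mono' J.continuous_f.aestronglyMeasurable (Eventually.of_forall fun x => (h' x).b0),
    (hB.const_mul L).mono' J.measurable_d1.aestronglyMeasurable
      (Eventually.of_forall fun x => (h' x).b1),
    (hB.const_mul (L ^ 2)).mono' J.measurable_d2.aestronglyMeasurable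
      (Eventually.of_forall fun x => (h' x).b2)⟩

end Jet

theorem integrable_scaledDist_rpow (α η : ℝ) {p : ℝ} (hp : 1 < p) :
    Integrable fun ξ => scaledDist α η ξ ^ (-p) := by
  have h := ((integrable_bracket hp).comp_mul_left' (beta_pos α η).ne').comp_sub_right η
  simpa only [← scaledDist_eq_abs] using h

/-- The Fourier transform of a jet with frequency concentration near `x.2` and `y.2`
is dominated by the majorant. -/
theorem Jet.enorm_fourier_le_majorant {α : ℝ} (hα0 : 0 ≤ α) {p : ℝ} (hp : 1 < p) (J : Jet)
    {C : ℝ} (x y : ℝ × ℝ) (h : ∀ ξ, J.Bd (beta α x.2 + beta α y.2 + beta α ξ)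
      (C * (Real.sqrt (beta α x.2) * Real.sqrt (beta α y.2) *
        (scaledDist α x.2 ξ ^ (-p) * scaledDist α y.2 ξ ^ (-p)))) ξ) {l : ℝ} (hl : 0 < l) :
    ‖𝓕 J.f (x.1 - y.1)‖ₑ ≤ ENNReal.ofReal C * majorant α p l x y := by
  have hbx := beta_pos α x.2
  have hby := beta_pos α y.2
  set B : ℝ → ℝ := fun ξ => C * (Real.sqrt (beta α x.2) * Real.sqrt (beta α y.2) *
        (scaledDist α x.2 ξ ^ (-p) * scaledDist α y.2 ξ ^ (-p))) with hBdef
  have hm : ∀ ω, Measurable fun ξ => scaledDist α ω ξ := fun ω =>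
    ((continuous_scaledDist α).comp (by fun_prop : Continuous fun ξ : ℝ => (ω, ξ))).measurable
  have hBi : Integrable B := by
    refine Integrable.const_mul (Integrable.const_mul ?_ _) _
    refine (integrable_scaledDist_rpow α y.2 hp).mono' ?_ (Eventually.of_forall fun ξ => ?_)
    · have := hm x.2
      have := hm y.2
      exact Measurable.aestronglyMeasurable (by fun_prop)
    · have h1 := one_le_scaledDist α x.2 ξ
      have h2 := scaledDist_pos α y.2 ξ
      have h3 : scaledDist α x.2 ξ ^ (-p) ≤ 1 :=
        Real.rpow_le_one_of_one_le_of_nonpos h1 (by linarith)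
      have h4 := scaledDist_pos α x.2 ξ
      rw [Real.norm_of_nonneg (by positivity)]
      exact mul_le_of_le_one_left (by positivity) h3
  have hl0 : ∀ ξ, 0 ≤ beta α x.2 + beta α y.2 + beta α ξ := fun ξ => by
    have := beta_pos α ξ; positivity
  -- Three values of `β`, each at most `1`.
  obtain ⟨i0, i1, i2⟩ := J.integrable_of_bd (L := 3) hBi hl0 (fun ξ => by
    linarith [beta_le_one hα0 x.2, beta_le_one hα0 y.2, beta_le_one hα0 ξ]) h
  have key := J.norm_fourier_le i0 i1 i2 hl (x.1 - y.1)
  have hpos : 0 < 1 + ((x.1 - y.1) / l) ^ 2 := by positivity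
  rw [← le_div_iff₀ hpos] at key
  have hptw : ∀ ξ, ‖J.f ξ‖ + ‖J.d2 ξ‖ / l ^ 2 ≤ C * freqMajorant α p l x.2 y.2 ξ := by
    intro ξ
    have hb := h ξ
    have hB0 := hb.nonneg
    set L := beta α x.2 + beta α y.2 + beta α ξ with hLdef
    have hL0 : 0 ≤ L := hl0 ξ
    have h2 : ‖J.d2 ξ‖ / l ^ 2 ≤ L ^ 2 * B ξ / l ^ 2 := by gcongr; exact hb.b2
    have h0 : ‖J.f ξ‖ ≤ B ξ := hb.b0
    calc ‖J.f ξ‖ + ‖J.d2 ξ‖ / l ^ 2 ≤ B ξ * (1 + (L / l) ^ 2) := by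
          rw [div_pow]
          calc _ ≤ B ξ + L ^ 2 * B ξ / l ^ 2 := add_le_add h0 h2
            _ = _ := by ring
      _ ≤ B ξ * (1 + L / l) ^ 2 := by
          have : 0 ≤ L / l := by positivity
          exact mul_le_mul_of_nonneg_left (by nlinarith) hB0
      _ = _ := by rw [hBdef]; unfold freqMajorant; ring
  have hC : 0 ≤ C := by
    have hb := (h 0).nonneg
    have h1 := scaledDist_pos α x.2 0
    have h2 := scaledDist_pos α y.2 0
    exact nonneg_of_mul_nonneg_left hb (by positivity)
  rw [← ofReal_norm]
  calc ENNReal.ofReal ‖𝓕 J.f (x.1 - y.1)‖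
      ≤ ENNReal.ofReal ((∫ ξ, (‖J.f ξ‖ + ‖J.d2 ξ‖ / l ^ 2)) / (1 + ((x.1 - y.1) / l) ^ 2)) :=
        ENNReal.ofReal_le_ofReal key
    _ = (∫⁻ ξ, ENNReal.ofReal (‖J.f ξ‖ + ‖J.d2 ξ‖ / l ^ 2)) *
        ENNReal.ofReal (1 / (1 + ((x.1 - y.1) / l) ^ 2)) := by
        rw [div_eq_mul_one_div, ENNReal.ofReal_mul (integral_nonneg fun ξ => by positivity),
          ofReal_integral_eq_lintegral_ofReal (f := fun ξ => ‖J.f ξ‖ + ‖J.d2 ξ‖ / l ^ 2)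
            (i0.norm.add (i2.norm.div_const _))
            (Eventually.of_forall fun ξ => by positivity)]
    _ ≤ (∫⁻ ξ, ENNReal.ofReal C * ENNReal.ofReal (freqMajorant α p l x.2 y.2 ξ)) *
        ENNReal.ofReal (1 / (1 + ((x.1 - y.1) / l) ^ 2)) := by
        gcongr with ξ
        rw [← ENNReal.ofReal_mul hC]
        exact ENNReal.ofReal_le_ofReal (hptw ξ)
    _ = _ := by
        rw [lintegral_const_mul' _ _ ENNReal.ofReal_ne_top, majorant, mul_assoc]

/-! ### Decaying windows and their perturbations -/

/-- A jet with a third derivative, all of whose derivatives are bounded by `C (1 + |x|)^{-r}`. -/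
structure DecayJet (r C : ℝ) extends Jet where
  /-- the third derivative -/
  d3 : ℝ → ℂ
  h3 : ∀ x, HasDerivAt d2 (d3 x) x
  b0 : ∀ x, ‖f x‖ ≤ C * (1 + |x|) ^ (-r)
  b1 : ∀ x, ‖d1 x‖ ≤ C * (1 + |x|) ^ (-r)
  b2 : ∀ x, ‖d2 x‖ ≤ C * (1 + |x|) ^ (-r)
  b3 : ∀ x, ‖d3 x‖ ≤ C * (1 + |x|) ^ (-r)

theorem HasFourierDecay.exists_decayJet {r : ℝ} {ψ : L2} (h : HasFourierDecay 3 r ψ) :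
    ∃ (C : ℝ) (D : DecayJet r C), (𝓕 ψ : L2) =ᵐ[volume] D.f := by
  obtain ⟨g, hg, hd, C, hC⟩ := h
  have hder : ∀ l : ℕ, l < 3 → ∀ x,
      HasDerivAt (iteratedDeriv l g) (iteratedDeriv (l + 1) g x) x := by
    intro l hl x
    rw [iteratedDeriv_succ]
    exact (hd.differentiable_iteratedDeriv l (by exact_mod_cast hl) x).hasDerivAt
  refine ⟨C, ⟨⟨iteratedDeriv 0 g, iteratedDeriv 1 g, iteratedDeriv 2 g, hder 0 (by norm_num),
    hder 1 (by norm_num)⟩, iteratedDeriv 3 g, hder 2 (by norm_num), hC 0 (by norm_num),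
    hC 1 (by norm_num), hC 2 (by norm_num), hC 3 (by norm_num)⟩, ?_⟩
  simpa using hg

namespace DecayJet

variable {r C : ℝ} (D : DecayJet r C)

include D in
theorem const_nonneg : 0 ≤ C := by
  have := (norm_nonneg _).trans (D.b0 0)
  simpa using this

theorem bd (x : ℝ) : D.toJet.Bd 1 (C * (1 + |x|) ^ (-r)) x :=
  ⟨D.b0 x, by simpa using D.b1 x, by simpa using D.b2 x⟩

theorem integrable (hr : 1 < r) : Integrable D.f :=
  ((integrable_bracket hr).const_mul C).mono' D.continuous_f.aestronglyMeasurable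
    (Eventually.of_forall D.b0)

theorem norm_le (hr : 0 ≤ r) (x : ℝ) : ‖D.f x‖ ≤ C :=
  (D.b0 x).trans (mul_le_of_le_one_right D.const_nonneg
    (Real.rpow_le_one_of_one_le_of_nonpos (by linarith [abs_nonneg x]) (by linarith)))

theorem memLp (hr : 1 < r) : MemLp D.f 2 volume := by
  rw [memLp_two_iff_integrable_sq_norm D.continuous_f.aestronglyMeasurable]
  refine ((D.integrable hr).norm.const_mul C).mono'
    (D.continuous_f.norm.pow 2).aestronglyMeasurable (Eventually.of_forall fun x => ?_)
  rw [Real.norm_of_nonneg (by positivity), sq]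
  exact mul_le_mul_of_nonneg_right (D.norm_le (by linarith) x) (norm_nonneg _)

theorem bracket_rpow_le {r v w : ℝ} (hr : 0 ≤ r) (h : |w - v| ≤ (1 + |v|) / 2) :
    (1 + |w|) ^ (-r) ≤ 2 ^ r * (1 + |v|) ^ (-r) := by
  have h1 : (1 + |v|) / 2 ≤ 1 + |w| := by
    have := abs_sub_abs_le_abs_sub v w
    rw [abs_sub_comm] at this
    linarith
  calc (1 + |w|) ^ (-r) ≤ ((1 + |v|) / 2) ^ (-r) :=
        Real.rpow_le_rpow_of_nonpos (by positivity) h1 (by linarith)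
    _ = _ := by
        rw [Real.div_rpow (by positivity) (by norm_num), Real.rpow_neg (by norm_num : (0:ℝ) ≤ 2)]
        field_simp

/-- The mean value inequality on the ball about `v` of radius `|w - v|`, throughout which the decay
bound loses at most `2^r`. -/
theorem norm_sub_le_of_deriv {C r : ℝ} (hC : 0 ≤ C) (hr : 0 ≤ r) {g g' : ℝ → ℂ}
    (h : ∀ x, HasDerivAt g (g' x) x) (hb : ∀ x, ‖g' x‖ ≤ C * (1 + |x|) ^ (-r)) {v w : ℝ}
    (hvw : |w - v| ≤ (1 + |v|) / 2) :
    ‖g v - g w‖ ≤ C * (2 ^ r * (1 + |v|) ^ (-r)) * |w - v| := by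
  have hconv := convex_closedBall v |w - v|
  have := hconv.norm_image_sub_le_of_norm_hasDerivWithin_le
    (f := g) (f' := g') (C := C * (2 ^ r * (1 + |v|) ^ (-r)))
    (fun x _ => (h x).hasDerivWithinAt)
    (fun x hx => (hb x).trans (mul_le_mul_of_nonneg_left
      (bracket_rpow_le hr ((Metric.mem_closedBall.1 hx).trans hvw)) hC))
    (x := w) (y := v) (Metric.mem_closedBall.2 le_rfl) (Metric.mem_closedBall_self (abs_nonneg _))
  rwa [Real.norm_eq_abs, abs_sub_comm v w] at this

/-- The jet `1 - √k e^{-2πiδv}`. -/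
def phaseJet (k δ : ℝ) : Jet where
  f v := 1 - Real.sqrt k * Complex.exp (((-2 * Real.pi * δ * v : ℝ) : ℂ) * Complex.I)
  d1 v := -(Real.sqrt k * (Complex.exp (((-2 * Real.pi * δ * v : ℝ) : ℂ) * Complex.I) *
    (((-2 * Real.pi * δ : ℝ) : ℂ) * Complex.I)))
  d2 v := -(Real.sqrt k * (Complex.exp (((-2 * Real.pi * δ * v : ℝ) : ℂ) * Complex.I) *
    (((-2 * Real.pi * δ : ℝ) : ℂ) * Complex.I) * (((-2 * Real.pi * δ : ℝ) : ℂ) * Complex.I)))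
  h1 v := by
    have h : HasDerivAt (fun v : ℝ => ((-2 * Real.pi * δ * v : ℝ) : ℂ) * Complex.I)
        (((-2 * Real.pi * δ : ℝ) : ℂ) * Complex.I) v := by
      have := ((hasDerivAt_id v).const_mul (-2 * Real.pi * δ)).ofReal_comp.mul_const Complex.I
      simpa using this
    exact ((h.cexp).const_mul _).const_sub 1
  h2 v := by
    have h : HasDerivAt (fun v : ℝ => ((-2 * Real.pi * δ * v : ℝ) : ℂ) * Complex.I)
        (((-2 * Real.pi * δ : ℝ) : ℂ) * Complex.I) v := by
      have := ((hasDerivAt_id v).const_mul (-2 * Real.pi * δ)).ofReal_comp.mul_const Complex.I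
      simpa using this
    exact (((h.cexp).mul_const _).const_mul _).neg

/-- The size is `|1-√k| + √k |1 - e^{-2πiδv}|`. The second term is only small relative to `|v|`,
hence the factor `1+|v|`. With `√k ≤ 5/4` and `2π|δ| ≤ 8e`, the constant `32` is generous. -/
theorem phaseJet_bd {e k δ : ℝ} (he : e ≤ 1 / 4) (hk : |k - 1| ≤ e) (hδ : |δ| ≤ e) (v : ℝ) :
    (phaseJet k δ).Bd 1 (32 * e * (1 + |v|)) v := by
  have he0 : 0 ≤ e := (abs_nonneg _).trans hδ
  have hk' := abs_le.1 hk
  have hk0 : 0 ≤ k := by linarith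
  have hs0 := Real.sqrt_nonneg k
  have hs1 : |1 - Real.sqrt k| ≤ e := by
    have h1 : (Real.sqrt k - 1) * (Real.sqrt k + 1) = k - 1 := by
      ring_nf; rw [Real.sq_sqrt hk0]
    calc |1 - Real.sqrt k| = |Real.sqrt k - 1| := abs_sub_comm _ _
      _ ≤ |Real.sqrt k - 1| * |Real.sqrt k + 1| :=
        le_mul_of_one_le_right (abs_nonneg _) (by rw [abs_of_nonneg (by linarith)]; linarith)
      _ = |k - 1| := by rw [← abs_mul, h1]
      _ ≤ e := hk
  have hs2 : Real.sqrt k ≤ 5 / 4 := by linarith [(abs_le.1 hs1).1]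
  have hpi := Real.pi_lt_four
  have hpi0 := Real.pi_pos
  have hc : |-2 * Real.pi * δ| ≤ 8 * e := by
    rw [abs_mul, abs_mul, abs_neg, abs_two, abs_of_pos hpi0]
    have := abs_nonneg δ
    nlinarith
  have hv := abs_nonneg v
  refine ⟨?_, ?_, ?_⟩
  · have h1 : ‖1 - Complex.exp (((-2 * Real.pi * δ * v : ℝ) : ℂ) * Complex.I)‖ ≤ 8 * e * |v| := by
      rw [norm_sub_rev, mul_comm _ Complex.I]
      refine Real.norm_exp_I_mul_ofReal_sub_one_le.trans ?_
      rw [Real.norm_eq_abs, abs_mul]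
      gcongr
    have e1 : (phaseJet k δ).f v = ((1 - Real.sqrt k : ℝ) : ℂ) + Real.sqrt k *
        (1 - Complex.exp (((-2 * Real.pi * δ * v : ℝ) : ℂ) * Complex.I)) := by
      simp only [phaseJet]; push_cast; ring
    rw [e1]
    calc _ ≤ e + 5 / 4 * (8 * e * |v|) := by
          refine (norm_add_le _ _).trans (add_le_add ?_ ?_)
          · rwa [Complex.norm_real, Real.norm_eq_abs]
          · rw [norm_mul, Complex.norm_real, Real.norm_of_nonneg hs0]; gcongr
      _ ≤ _ := by nlinarith [mul_nonneg he0 hv]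
  · simp only [phaseJet]
    generalize -2 * Real.pi * δ = c at hc ⊢
    simp only [norm_neg, norm_mul, Complex.norm_exp_ofReal_mul_I, Complex.norm_I,
      Complex.norm_real, Real.norm_of_nonneg hs0, one_mul, mul_one, Real.norm_eq_abs]
    calc Real.sqrt k * |c| ≤ 5 / 4 * (8 * e) := by gcongr
      _ ≤ _ := by nlinarith [mul_nonneg he0 hv]
  · simp only [phaseJet]
    generalize -2 * Real.pi * δ = c at hc ⊢
    simp only [norm_neg, norm_mul, Complex.norm_exp_ofReal_mul_I, Complex.norm_I,
      Complex.norm_real, Real.norm_of_nonneg hs0, one_mul, mul_one, one_pow, Real.norm_eq_abs]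
    have hc' : |c| ≤ 2 := by linarith
    calc Real.sqrt k * (|c| * |c|) ≤ 5 / 4 * ((8 * e) * 2) := by gcongr
      _ ≤ _ := by nlinarith [mul_nonneg he0 hv]

/-- The jet of `φ(v) - √k e^{-2πiδv} φ(k (v - μ))`. -/
def oscJet (k δ μ : ℝ) : Jet :=
  (D.toJet.sub (D.toJet.affine 1 k μ)).sub
    (((phaseJet k δ).mul (D.toJet.affine (-1) k μ)))

theorem oscJet_f (k δ μ v : ℝ) : (D.oscJet k δ μ).f v = D.f v -
    Real.sqrt k * Complex.exp (((-2 * Real.pi * δ * v : ℝ) : ℂ) * Complex.I) *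
      D.f (k * (v - μ)) := by
  simp only [oscJet, Jet.sub, Jet.mul, Jet.affine, phaseJet]; ring

/-- The difference telescopes into the displacement `φ(v) - φ(k(v-μ))` and the amplitude and phase
error `(1 - √k e^{-2πiδv}) φ(k(v-μ))`. The argument moves by `O(e)(1+|v|)` and the phase error has
the same size, so both parts are of order `e` at the cost of one power of decay. Controlling the
displacement of the second derivative requires the third. -/
theorem oscJet_bd (hr : 0 ≤ r) {e k δ μ : ℝ} (he : e ≤ 1 / 4) (hk : |k - 1| ≤ e) (hδ : |δ| ≤ e)
    (hμ : |μ| ≤ e) (v : ℝ) :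
    (D.oscJet k δ μ).Bd 1 (300 * C * 2 ^ r * e * (1 + |v|) ^ (-(r - 1))) v := by
  have hC := D.const_nonneg
  have he0 : 0 ≤ e := (abs_nonneg _).trans hδ
  have hk' := abs_le.1 hk
  have hv := abs_nonneg v
  have hk0 : 0 ≤ k := by linarith
  set w := k * (v - μ) with hw
  have hwv : |w - v| ≤ 5 / 4 * e * (1 + |v|) := by
    have e1 : w - v = (k - 1) * v - k * μ := by rw [hw]; ring
    rw [e1]
    calc |(k - 1) * v - k * μ| ≤ |(k - 1) * v| + |k * μ| := abs_sub _ _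
      _ ≤ e * |v| + 5 / 4 * e := by
          rw [abs_mul, abs_mul, abs_of_nonneg hk0]
          gcongr
          linarith
      _ ≤ _ := by nlinarith [mul_nonneg he0 hv]
  have hwv2 : |w - v| ≤ (1 + |v|) / 2 := hwv.trans (by nlinarith)
  have hE := bracket_rpow_le hr hwv2
  have hP : 0 ≤ 2 ^ r * (1 + |v|) ^ (-r) := by positivity
  set P := 2 ^ r * (1 + |v|) ^ (-r) with hPdef
  have hCP : 0 ≤ C * P := by positivity
  have hw0 : ∀ g : ℝ → ℂ, (∀ x, ‖g x‖ ≤ C * (1 + |x|) ^ (-r)) → ‖g w‖ ≤ C * P := fun g hg =>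
    (hg w).trans (by gcongr)
  have hdiff : ∀ g g' : ℝ → ℂ, (∀ x, HasDerivAt g (g' x) x) →
      (∀ x, ‖g' x‖ ≤ C * (1 + |x|) ^ (-r)) →
      ‖g v - g w‖ ≤ 5 / 4 * e * (1 + |v|) * (C * P) := fun g g' h h' =>
    (norm_sub_le_of_deriv hC hr h h' hwv2).trans (by
      rw [mul_comm]; gcongr)
  have hQ : 0 ≤ e * (1 + |v|) * (C * P) := by positivity
  have heC : e * (C * P) ≤ e * (1 + |v|) * (C * P) := by
    exact mul_le_mul_of_nonneg_right (by nlinarith) hCP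
  have A1 : (D.toJet.sub (D.toJet.affine 1 k μ)).Bd 1 (5 * (e * (1 + |v|) * (C * P))) v := by
    refine ⟨?_, ?_, ?_⟩
    · have := hdiff D.f D.d1 D.h1 D.b1
      simp only [Jet.sub, Jet.affine, one_mul]
      exact this.trans (by linarith)
    · have h1 := hdiff D.d1 D.d2 D.h2 D.b2
      have h2 := hw0 D.d1 D.b1
      simp only [Jet.sub, Jet.affine, one_mul]
      have e1 : D.d1 v - k * D.d1 w = (D.d1 v - D.d1 w) - ((k - 1 : ℝ) : ℂ) * D.d1 w := by
        push_cast; ring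
      rw [← hw, e1]
      refine (norm_sub_le _ _).trans ?_
      rw [norm_mul, Complex.norm_real, Real.norm_eq_abs]
      have h3 : |k - 1| * ‖D.d1 w‖ ≤ e * (C * P) := by gcongr
      linarith
    · have h1 := hdiff D.d2 D.d3 D.h3 D.b3
      have h2 := hw0 D.d2 D.b2
      simp only [Jet.sub, Jet.affine, one_mul, one_pow]
      have e1 : D.d2 v - k ^ 2 * D.d2 w =
          (D.d2 v - D.d2 w) - ((k ^ 2 - 1 : ℝ) : ℂ) * D.d2 w := by
        push_cast; ring
      rw [← hw, e1]
      refine (norm_sub_le _ _).trans ?_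
      rw [norm_mul, Complex.norm_real, Real.norm_eq_abs]
      have h4 : |k ^ 2 - 1| ≤ 3 * e := by
        rw [show k ^ 2 - 1 = (k - 1) * (k + 1) by ring, abs_mul,
          abs_of_nonneg (by linarith : 0 ≤ k + 1)]
        nlinarith [abs_nonneg (k - 1)]
      have h3 : |k ^ 2 - 1| * ‖D.d2 w‖ ≤ 3 * e * (C * P) := by gcongr
      linarith
  have A2 : (D.toJet.affine (-1) k μ).Bd 1 (2 * (C * P)) v := by
    refine ⟨?_, ?_, ?_⟩
    · simp only [Jet.affine, norm_mul, norm_neg, norm_one, one_mul]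
      exact (hw0 D.f D.b0).trans (by linarith)
    · simp only [Jet.affine, norm_mul, norm_neg, norm_one, one_mul, Complex.norm_real,
        Real.norm_of_nonneg hk0]
      have := hw0 D.d1 D.b1
      exact mul_le_mul (by linarith) this (norm_nonneg _) (by norm_num)
    · simp only [Jet.affine, norm_mul, norm_neg, norm_one, one_mul, Complex.norm_real, norm_pow,
        Real.norm_of_nonneg hk0, one_pow]
      have := hw0 D.d2 D.b2
      exact mul_le_mul (by nlinarith) this (norm_nonneg _) (by norm_num)
  -- The constants add up to `5 + 4 · 32 · 2 = 261`, below `300`.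
  refine (A1.sub ((phaseJet_bd he hk hδ v).mul zero_le_one A2)).mono zero_le_one le_rfl ?_
  have e2 : (1 + |v|) ^ (-(r - 1)) = (1 + |v|) * (1 + |v|) ^ (-r) := by
    rw [show -(r - 1) = 1 + -r by ring, Real.rpow_add (by positivity), Real.rpow_one]
  have e3 : 300 * C * 2 ^ r * e * (1 + |v|) ^ (-(r - 1)) = 300 * (e * (1 + |v|) * (C * P)) := by
    rw [e2, hPdef]; ring
  rw [e3]
  linarith

end DecayJet

/-! ### The symbol of the frame operator -/

/-- `∫ β(ω)^k F(β(ω)(ξ - ω)) dω`. -/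
def symbolInt (α : ℝ) (k : ℕ) (F : ℝ → ℂ) (ξ : ℝ) : ℂ :=
  ∫ ω, (beta α ω : ℂ) ^ k * F (beta α ω * (ξ - ω))

section

variable {α : ℝ} (hα0 : 0 ≤ α) (hα1 : α < 1)

include hα0 hα1 in
theorem integrable_scaledDist_left {p : ℝ} (hp : 1 < (1 - α) * p) (ξ : ℝ) :
    Integrable fun ω => scaledDist α ω ξ ^ (-p) := by
  have hx := beta_pos α ξ
  have hp0 : 0 ≤ p := by
    by_contra h; nlinarith
  have hm : Measurable fun ω => scaledDist α ω ξ :=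
    ((continuous_scaledDist α).comp (by fun_prop : Continuous fun ω : ℝ => (ω, ξ))).measurable
  have h : Integrable fun ω => beta α ξ * scaledDist α ω ξ ^ (-p) := by
    refine ⟨Measurable.aestronglyMeasurable (by fun_prop), ?_⟩
    rw [hasFiniteIntegral_iff_ofReal (Eventually.of_forall fun ω => by
      have := scaledDist_pos α ω ξ; positivity)]
    exact (lintegral_scaledDist_left hα0 hα1 hp0 ξ).trans_lt (bracketInt_lt_top hp)
  simpa [hx.ne'] using h.const_mul (beta α ξ)⁻¹

include hα0 in
theorem norm_symbol_integrand_le {C p : ℝ} {F : ℝ → ℂ}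
    (hF : ∀ x, ‖F x‖ ≤ C * (1 + |x|) ^ (-p)) (k : ℕ) (ξ ω : ℝ) :
    ‖(beta α ω : ℂ) ^ k * F (beta α ω * (ξ - ω))‖ ≤ C * scaledDist α ω ξ ^ (-p) := by
  have hb := beta_pos α ω
  rw [norm_mul, norm_pow, Complex.norm_real, Real.norm_of_nonneg hb.le, scaledDist_eq_abs]
  exact (mul_le_of_le_one_left (norm_nonneg _) (pow_le_one₀ hb.le (beta_le_one hα0 ω))).trans
    (hF _)

include hα0 hα1 in
theorem integrable_symbol_integrand {C p : ℝ} (hp : 1 < (1 - α) * p) {F : ℝ → ℂ}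
    (hFm : Measurable F) (hF : ∀ x, ‖F x‖ ≤ C * (1 + |x|) ^ (-p)) (k : ℕ) (ξ : ℝ) :
    Integrable fun ω => (beta α ω : ℂ) ^ k * F (beta α ω * (ξ - ω)) :=
  ((integrable_scaledDist_left hα0 hα1 hp ξ).const_mul C).mono'
    (Measurable.aestronglyMeasurable (by fun_prop))
    (Eventually.of_forall fun ω => norm_symbol_integrand_le hα0 hF k ξ ω)

-- Of the factors `β(ω)^{k+1}`, exchanged for `β(ξ)^{k+1}`, one pays for the integration in `ω` and
-- `k` remain as gain. The exchange costs `α(k+1) ≤ 3α` powers of decay, whence `p - 3α`.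
include hα0 hα1 in
theorem norm_symbolInt_le {C p : ℝ} (hC : 0 ≤ C) (hp : 1 < (1 - α) * (p - 3 * α)) {F : ℝ → ℂ}
    (hF : ∀ x, ‖F x‖ ≤ C * (1 + |x|) ^ (-p)) {k : ℕ} (hk : k ≤ 2)
    (ξ : ℝ) : ‖symbolInt α (k + 1) F ξ‖ ≤
      beta α ξ ^ k * (C * (bracketInt ((1 - α) * (p - 3 * α))).toReal) := by
  have hx := beta_pos α ξ
  have hp0 : 0 ≤ p - 3 * α := by
    by_contra h; nlinarith
  set q := p - 3 * α with hq
  have hi := (integrable_scaledDist_left hα0 hα1 hp ξ).const_mul (beta α ξ)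
  have h1 : ∫ ω, beta α ξ * scaledDist α ω ξ ^ (-q) ≤ (bracketInt ((1 - α) * q)).toReal := by
    rw [integral_eq_lintegral_of_nonneg_ae (Eventually.of_forall fun ω => by
      have := scaledDist_pos α ω ξ; positivity) hi.aestronglyMeasurable]
    exact ENNReal.toReal_mono (bracketInt_lt_top hp).ne
      (lintegral_scaledDist_left hα0 hα1 hp0 ξ)
  have h2 : ∀ ω, ‖(beta α ω : ℂ) ^ (k + 1) * F (beta α ω * (ξ - ω))‖ ≤
      beta α ξ ^ k * C * (beta α ξ * scaledDist α ω ξ ^ (-q)) := by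
    intro ω
    have hb := beta_pos α ω
    have hU := scaledDist_pos α ω ξ
    have hU1 := one_le_scaledDist α ω ξ
    rw [norm_mul, norm_pow, Complex.norm_real, Real.norm_of_nonneg hb.le]
    have h3 : beta α ω ^ (k + 1) ≤ beta α ξ ^ (k + 1) * scaledDist α ω ξ ^ (3 * α) := by
      calc beta α ω ^ (k + 1) ≤ (beta α ξ * scaledDist α ω ξ ^ α) ^ (k + 1) := by
            gcongr; exact beta_le_mul_scaledDist hα0 hα1 ω ξ
        _ = beta α ξ ^ (k + 1) * scaledDist α ω ξ ^ (α * (k + 1 : ℕ)) := by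
            rw [mul_pow, Real.rpow_mul hU.le, Real.rpow_natCast]
        _ ≤ _ := by
            have : ((k + 1 : ℕ) : ℝ) ≤ 3 := by exact_mod_cast (by omega : k + 1 ≤ 3)
            exact mul_le_mul_of_nonneg_left (Real.rpow_le_rpow_of_exponent_le hU1 (by nlinarith))
              (by positivity)
    calc beta α ω ^ (k + 1) * ‖F (beta α ω * (ξ - ω))‖
        ≤ (beta α ξ ^ (k + 1) * scaledDist α ω ξ ^ (3 * α)) * (C * scaledDist α ω ξ ^ (-p)) := by
          gcongr
          rw [scaledDist_eq_abs]; exact hF _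
      _ = beta α ξ ^ k * C * (beta α ξ * (scaledDist α ω ξ ^ (3 * α) *
          scaledDist α ω ξ ^ (-p))) := by ring
      _ = _ := by
          rw [← Real.rpow_add hU]; congr 3; rw [hq]; ring
  calc ‖symbolInt α (k + 1) F ξ‖ ≤ ∫ ω, beta α ξ ^ k * C * (beta α ξ * scaledDist α ω ξ ^ (-q)) :=
        norm_integral_le_of_norm_le (hi.const_mul _) (Eventually.of_forall h2)
    _ = beta α ξ ^ k * C * ∫ ω, (beta α ξ * scaledDist α ω ξ ^ (-q)) := integral_const_mul _ _
    _ ≤ beta α ξ ^ k * C * (bracketInt ((1 - α) * q)).toReal := by gcongr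
    _ = _ := by ring

-- Differentiation under the integral: each derivative in `ξ` brings out one `β(ω)`. As `β ≤ 1`,
-- moving `ξ` by less than `1/2` changes the decay bound by at most `2^p`, which gives a local
-- majorant.
include hα0 hα1 in
theorem hasDerivAt_symbolInt {C p : ℝ} (hC : 0 ≤ C) (hp : 1 < (1 - α) * p) {F F' : ℝ → ℂ}
    (hF : ∀ x, ‖F x‖ ≤ C * (1 + |x|) ^ (-p)) (hF' : ∀ x, ‖F' x‖ ≤ C * (1 + |x|) ^ (-p))
    (hd : ∀ x, HasDerivAt F (F' x) x) (k : ℕ) (ξ : ℝ) :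
    HasDerivAt (symbolInt α k F) (symbolInt α (k + 1) F' ξ) ξ := by
  have hp0 : 0 ≤ p := by
    by_contra h; nlinarith
  have hFm : Measurable F :=
    (continuous_iff_continuousAt.2 fun x => (hd x).continuousAt).measurable
  have hFm' : Measurable F' := by
    have : F' = deriv F := funext fun x => (hd x).deriv.symm
    rw [this]; exact measurable_deriv _
  refine (hasDerivAt_integral_of_dominated_loc_of_deriv_le
    (bound := fun ω => C * (2 ^ p * scaledDist α ω ξ ^ (-p)))
    (F' := fun x ω => (beta α ω : ℂ) ^ (k + 1) * F' (beta α ω * (x - ω)))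
    (Metric.ball_mem_nhds ξ (by norm_num : (0 : ℝ) < 1 / 2)) ?_ ?_ ?_ ?_ ?_ ?_).2
  · exact Eventually.of_forall fun x => Measurable.aestronglyMeasurable (by fun_prop)
  · exact integrable_symbol_integrand hα0 hα1 hp hFm hF k ξ
  · exact Measurable.aestronglyMeasurable (by fun_prop)
  · refine Eventually.of_forall fun ω x hx => ?_
    refine (norm_symbol_integrand_le hα0 hF' (k + 1) x ω).trans ?_
    gcongr
    rw [scaledDist_eq_abs, scaledDist_eq_abs]
    refine DecayJet.bracket_rpow_le hp0 ?_
    have hx' : |x - ξ| < 1 / 2 := hx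
    rw [← mul_sub, sub_sub_sub_cancel_right, abs_mul, abs_of_pos (beta_pos α ω)]
    have h1 := beta_le_one hα0 ω
    have h2 := abs_nonneg (beta α ω * (ξ - ω))
    nlinarith [abs_nonneg (x - ξ)]
  · exact ((integrable_scaledDist_left hα0 hα1 hp ξ).const_mul _).const_mul _
  · refine Eventually.of_forall fun ω x _ => ?_
    have h : HasDerivAt (fun x : ℝ => beta α ω * (x - ω)) (beta α ω) x := by
      simpa using ((hasDerivAt_id x).sub_const ω).const_mul (beta α ω)
    refine (((hd (beta α ω * (x - ω))).scomp x h).const_mul ((beta α ω : ℂ) ^ k)).congr_deriv ?_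
    simp only [Complex.real_smul]; ring

include hα0 hα1 in
/-- `β` is slowly varying on the scale of the covering. -/
theorem abs_beta_sub_le {τ : ℝ} (hτ : τ ≤ 1 / 2) {ω ω₀ : ℝ}
    (h : |ω - ω₀| ≤ τ * (beta α ω₀)⁻¹) : |beta α ω - beta α ω₀| ≤ 2 * τ * beta α ω₀ := by
  have hb := beta_pos α ω₀
  have hτ0 : 0 ≤ τ := by
    have := (abs_nonneg _).trans h
    exact nonneg_of_mul_nonneg_left this (inv_pos.2 hb)
  have hW₀ : 0 < 1 + |ω₀| := by positivity
  have hW : 0 < 1 + |ω| := by positivity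
  have h' : |ω - ω₀| ≤ τ * (1 + |ω₀|) := h.trans (by
    rw [beta_inv]; gcongr; exact one_add_abs_rpow_le hα1 ω₀)
  have h1 : |ω| - |ω₀| ≤ τ * (1 + |ω₀|) := (abs_sub_abs_le_abs_sub _ _).trans h'
  have h2 : |ω₀| - |ω| ≤ τ * (1 + |ω₀|) := (abs_sub_abs_le_abs_sub _ _).trans
    (abs_sub_comm ω ω₀ ▸ h')
  -- `β(ω)/β(ω₀) = q^α`, and an exponent in `[0, 1)` only brings `q ∈ [1-τ, 1+2τ]` closer to `1`.
  set q := (1 + |ω₀|) / (1 + |ω|) with hq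
  have hq0 : 0 < q := by positivity
  have e : beta α ω = beta α ω₀ * q ^ α := by
    rw [beta, beta, hq, Real.div_rpow hW₀.le hW.le, Real.rpow_neg hW.le, Real.rpow_neg hW₀.le]
    field_simp
  have hq1 : q ≤ 1 + 2 * τ := by
    rw [hq, div_le_iff₀ hW]
    nlinarith
  have hq2 : 1 - τ ≤ q := by
    rw [hq, le_div_iff₀ hW]
    nlinarith
  have hlow : 1 - 2 * τ ≤ q ^ α := by
    rcases le_total q 1 with hle | hle
    · calc 1 - 2 * τ ≤ q := by linarith
        _ = q ^ (1 : ℝ) := (Real.rpow_one q).symm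
        _ ≤ q ^ α := Real.rpow_le_rpow_of_exponent_ge hq0 hle hα1.le
    · linarith [Real.one_le_rpow hle hα0]
  have hhigh : q ^ α ≤ 1 + 2 * τ := by
    rcases le_total q 1 with hle | hle
    · linarith [Real.rpow_le_one hq0.le hle hα0]
    · calc q ^ α ≤ q ^ (1 : ℝ) := Real.rpow_le_rpow_of_exponent_le hle hα1.le
        _ = q := Real.rpow_one q
        _ ≤ _ := hq1
  rw [e, abs_le]
  constructor <;> nlinarith

-- Intermediate values: `β(ω)|ξ-ω|` grows like `|ω|^{1-α}` on both sides. At distance `T ≥ 1+|ξ|`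
-- one has `1+|ω| ≤ 2T`, hence `β(ω)T ≥ T^{1-α}/2`, which exceeds `|p|` by the choice of `T`.
include hα0 hα1 in
theorem exists_beta_mul_eq (ξ p : ℝ) : ∃ ω, beta α ω * (ξ - ω) = p := by
  have h1α : 0 < 1 - α := by linarith
  have hc : Continuous fun ω => beta α ω * (ξ - ω) := by
    have := continuous_beta α; fun_prop
  obtain ⟨T, hT0, hT⟩ : ∃ T : ℝ, 0 ≤ T ∧ ∀ ω, |ξ - ω| = T → |p| ≤ beta α ω * T := by
    set T := max (1 + |ξ|) ((2 * |p|) ^ (1 / (1 - α))) with hTdef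
    have hT1 : 1 + |ξ| ≤ T := le_max_left _ _
    have hT2 : (2 * |p|) ^ (1 / (1 - α)) ≤ T := le_max_right _ _
    have hTpos : 0 < T := lt_of_lt_of_le (by positivity) hT1
    refine ⟨T, hTpos.le, fun ω hω => ?_⟩
    have h3 : 2 * |p| ≤ T ^ (1 - α) := by
      have := Real.rpow_le_rpow (by positivity) hT2 h1α.le
      rwa [← Real.rpow_mul (by positivity), one_div_mul_cancel h1α.ne', Real.rpow_one] at this
    have h4 : 1 + |ω| ≤ 2 * T := by
      have := abs_sub_abs_le_abs_sub ω ξ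
      rw [abs_sub_comm] at this
      linarith
    have h5 : (2 * T) ^ (-α) ≤ beta α ω :=
      Real.rpow_le_rpow_of_nonpos (by positivity) h4 (by linarith)
    have h6 : (2 : ℝ)⁻¹ ≤ 2 ^ (-α) := by
      rw [← Real.rpow_neg_one]
      exact Real.rpow_le_rpow_of_exponent_le (by norm_num) (by linarith)
    calc |p| ≤ 2⁻¹ * T ^ (1 - α) := by linarith
      _ ≤ 2 ^ (-α) * T ^ (1 - α) := by gcongr
      _ = (2 * T) ^ (-α) * T := by
          rw [Real.mul_rpow (by norm_num) hTpos.le, show 1 - α = -α + 1 by ring,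
            Real.rpow_add hTpos, Real.rpow_one, mul_assoc]
      _ ≤ _ := by gcongr
  refine mem_range_of_exists_le_of_exists_ge hc ⟨ξ + T, ?_⟩ ⟨ξ - T, ?_⟩
  · have := hT (ξ + T) (by simp [abs_of_nonneg hT0])
    have h2 := neg_abs_le p
    simp only [sub_add_cancel_left, mul_neg]
    linarith
  · have := hT (ξ - T) (by simp [abs_of_nonneg hT0])
    have h2 := le_abs_self p
    simp only [sub_sub_cancel]
    linarith

include hα0 hα1 in
/-- The symbol of the frame operator is bounded below. -/
theorem exists_symbol_lower_bound {g : ℝ → ℝ} (hg : Continuous g) (hg0 : ∀ x, 0 ≤ g x)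
    (hne : ∃ x, g x ≠ 0)
    (hi : ∀ ξ, Integrable fun ω => beta α ω * g (beta α ω * (ξ - ω))) :
    ∃ c, 0 < c ∧ ∀ ξ, c ≤ ∫ ω, beta α ω * g (beta α ω * (ξ - ω)) := by
  obtain ⟨p, hp⟩ := hne
  have hp : 0 < g p := lt_of_le_of_ne (hg0 p) (Ne.symm hp)
  obtain ⟨h, hh, hgh⟩ := Metric.eventually_nhds_iff.1
    ((hg.tendsto p).eventually (lt_mem_nhds (half_lt_self hp)))
  set δ := g p / 2 with hδ
  have hδ0 : 0 < δ := by positivity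
  -- Chosen so that `β` varies by at most a factor `2` over the interval below and the argument of
  -- `g` moves by at most `2τ(1+|p|) ≤ h/2`.
  set τ := min (1 / 4) (h / (4 * (1 + |p|))) with hτ
  have hτ0 : 0 < τ := by positivity
  have hτ1 : τ ≤ 1 / 4 := min_le_left _ _
  have hτ2 : τ * (4 * (1 + |p|)) ≤ h := by
    rw [← le_div_iff₀ (by positivity)]; exact min_le_right _ _
  refine ⟨δ * τ, by positivity, fun ξ => ?_⟩
  -- For every `ξ` some `ω₀` places the argument of `g` at `p`. It stays near `p` on an interval of
  -- length `2τ/β(ω₀)`, where the integrand is at least `δβ(ω₀)/2`; the product `δτ` is free of `ξ`.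
  obtain ⟨ω₀, hω₀⟩ := exists_beta_mul_eq hα0 hα1 ξ p
  have hb := beta_pos α ω₀
  set b := beta α ω₀ with hbdef
  have hlow : ∀ ω ∈ Icc (ω₀ - τ * b⁻¹) (ω₀ + τ * b⁻¹),
      b / 2 * δ ≤ beta α ω * g (beta α ω * (ξ - ω)) := by
    intro ω hω
    have hd : |ω - ω₀| ≤ τ * b⁻¹ := by rw [abs_le]; constructor <;> linarith [hω.1, hω.2]
    have hbb := abs_beta_sub_le hα0 hα1 (by linarith) hd
    rw [← hbdef] at hbb
    have hb1 := (abs_le.1 hbb).1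
    have hb2 := (abs_le.1 hbb).2
    have hbω : b / 2 ≤ beta α ω := by nlinarith
    have hbω2 : beta α ω ≤ 2 * b := by nlinarith
    have hdist : |beta α ω * (ξ - ω) - p| < h := by
      have e : beta α ω * (ξ - ω) - p = -(beta α ω * (ω - ω₀)) + (beta α ω - b) * (ξ - ω₀) := by
        rw [← hω₀]; ring
      have e2 : |ξ - ω₀| = |p| / b := by
        rw [← hω₀, abs_mul, abs_of_pos hb]; field_simp
      calc |beta α ω * (ξ - ω) - p| ≤ |beta α ω * (ω - ω₀)| + |(beta α ω - b) * (ξ - ω₀)| := by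
            rw [e]; exact (abs_add_le _ _).trans (by rw [abs_neg])
        _ ≤ 2 * b * (τ * b⁻¹) + 2 * τ * b * (|p| / b) := by
            rw [abs_mul, abs_mul, abs_of_pos (beta_pos α ω), e2]; gcongr
        _ = 2 * τ * (1 + |p|) := by field_simp
        _ < h := by nlinarith [abs_nonneg p, mul_pos hτ0 (by positivity : 0 < 1 + |p|)]
    have hgω : δ ≤ g (beta α ω * (ξ - ω)) := (hgh (by rwa [Real.dist_eq])).le
    have := beta_pos α ω
    gcongr
  calc δ * τ = ∫ ω in Icc (ω₀ - τ * b⁻¹) (ω₀ + τ * b⁻¹), b / 2 * δ := by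
        rw [setIntegral_const, Real.volume_real_Icc_of_le (by
          have : 0 < τ * b⁻¹ := by positivity
          linarith), smul_eq_mul]
        field_simp; ring
    _ ≤ ∫ ω in Icc (ω₀ - τ * b⁻¹) (ω₀ + τ * b⁻¹), beta α ω * g (beta α ω * (ξ - ω)) :=
        setIntegral_mono_on (integrableOn_const (by simp)) (hi ξ).integrableOn
          measurableSet_Icc hlow
    _ ≤ _ := setIntegral_le_integral (hi ξ) (Eventually.of_forall fun ω =>
        mul_nonneg (beta_pos α ω).le (hg0 _))

end

namespace DecayJet

variable {r C : ℝ} (D : DecayJet r C)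

/-- The jet of `|φ|²`. -/
def sqJet : Jet := D.toJet.mul D.toJet.conj

theorem sqJet_bd (hr : 0 ≤ r) (x : ℝ) : D.sqJet.Bd 1 (4 * C ^ 2 * (1 + |x|) ^ (-r)) x := by
  have hC := D.const_nonneg
  refine ((D.bd x).mul zero_le_one (D.bd x).conj).mono zero_le_one le_rfl ?_
  have h1 : (1 + |x|) ^ (-r) ≤ 1 :=
    Real.rpow_le_one_of_one_le_of_nonpos (by linarith [abs_nonneg x]) (by linarith)
  have h2 : 0 ≤ (1 + |x|) ^ (-r) := by positivity
  calc 4 * (C * (1 + |x|) ^ (-r) * (C * (1 + |x|) ^ (-r)))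
      = 4 * C ^ 2 * (1 + |x|) ^ (-r) * (1 + |x|) ^ (-r) := by ring
    _ ≤ _ := mul_le_of_le_one_right (by positivity) h1

/-- The symbol of the frame operator, with its derivatives. -/
def symbolJet {α : ℝ} (hα0 : 0 ≤ α) (hα1 : α < 1) (hr : 1 < (1 - α) * r) : Jet where
  f := symbolInt α 1 D.sqJet.f
  d1 := symbolInt α 2 D.sqJet.d1
  d2 := symbolInt α 3 D.sqJet.d2
  h1 x := by
    have hr0 : 0 ≤ r := by
      by_contra h; nlinarith
    exact hasDerivAt_symbolInt hα0 hα1 (C := 4 * C ^ 2) (by positivity) hr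
      (fun x => (D.sqJet_bd hr0 x).b0) (fun x => by simpa using (D.sqJet_bd hr0 x).b1)
      D.sqJet.h1 1 x
  h2 x := by
    have hr0 : 0 ≤ r := by
      by_contra h; nlinarith
    exact hasDerivAt_symbolInt hα0 hα1 (C := 4 * C ^ 2) (by positivity) hr
      (fun x => by simpa using (D.sqJet_bd hr0 x).b1)
      (fun x => by simpa using (D.sqJet_bd hr0 x).b2) D.sqJet.h2 2 x

/-- The symbol of the frame operator. -/
def symbol (α : ℝ) (ξ : ℝ) : ℝ := ∫ ω, beta α ω * ‖D.f (beta α ω * (ξ - ω))‖ ^ 2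

theorem symbolJet_f {α : ℝ} (hα0 : 0 ≤ α) (hα1 : α < 1) (hr : 1 < (1 - α) * r) (ξ : ℝ) :
    (D.symbolJet hα0 hα1 hr).f ξ = (D.symbol α ξ : ℂ) := by
  simp only [symbolJet, symbolInt, symbol, sqJet, Jet.mul, Jet.conj]
  rw [← integral_complex_ofReal]
  congr 1; ext ω
  rw [Complex.mul_conj, Complex.normSq_eq_norm_sq]
  push_cast; ring

section

variable {α : ℝ} (hα0 : 0 ≤ α) (hα1 : α < 1) (hr : 1 < (1 - α) * r)

include hα0 hα1 hr in
theorem integrable_symbol (ξ : ℝ) :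
    Integrable fun ω => beta α ω * ‖D.f (beta α ω * (ξ - ω))‖ ^ 2 := by
  have hr0 : 0 ≤ r := by
    by_contra h; nlinarith
  have h := (integrable_symbol_integrand hα0 hα1 hr D.sqJet.continuous_f.measurable
    (fun x => (D.sqJet_bd hr0 x).b0) 1 ξ).norm
  refine h.congr (Eventually.of_forall fun ω => ?_)
  simp only [sqJet, Jet.mul, Jet.conj]
  rw [norm_mul, norm_mul, RCLike.norm_conj, pow_one, Complex.norm_real,
    Real.norm_of_nonneg (beta_pos α ω).le]
  ring

include hα0 hα1 hr in
theorem exists_symbol_lower (hne : ∃ x, D.f x ≠ 0) : ∃ c, 0 < c ∧ ∀ ξ, c ≤ D.symbol α ξ :=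
  exists_symbol_lower_bound hα0 hα1 (g := fun x => ‖D.f x‖ ^ 2) (D.continuous_f.norm.pow 2)
    (fun x => by positivity) (by simpa using hne) (D.integrable_symbol hα0 hα1 hr)

theorem symbolJet_bd (hr3 : 1 < (1 - α) * (r - 3 * α)) (ξ : ℝ) :
    (D.symbolJet hα0 hα1 hr).Bd (beta α ξ)
      (4 * C ^ 2 * (bracketInt ((1 - α) * (r - 3 * α))).toReal) ξ := by
  have hr0 : 0 ≤ r := by
    by_contra h; nlinarith
  have hC : 0 ≤ 4 * C ^ 2 := by positivity
  refine ⟨?_, ?_, ?_⟩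
  · simpa [symbolJet] using norm_symbolInt_le hα0 hα1 hC hr3 (fun x => (D.sqJet_bd hr0 x).b0)
      (k := 0) (by norm_num) ξ
  · simpa [symbolJet] using norm_symbolInt_le hα0 hα1 hC hr3
      (fun x => by simpa using (D.sqJet_bd hr0 x).b1) (k := 1) (by norm_num) ξ
  · simpa [symbolJet] using norm_symbolInt_le hα0 hα1 hC hr3
      (fun x => by simpa using (D.sqJet_bd hr0 x).b2) (k := 2) (by norm_num) ξ

end

end DecayJet

/-! ### Multiplication operators -/

theorem memLp_mul_bounded {m : ℝ → ℂ} (hm : Measurable m) {M : ℝ} (hM : ∀ x, ‖m x‖ ≤ M) (f : L2) :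
    MemLp (fun x => m x * f x) 2 volume :=
  (Lp.memLp f).of_le_mul (c := M) (hm.aestronglyMeasurable.mul (Lp.aestronglyMeasurable f))
    (Eventually.of_forall fun x => by
      rw [norm_mul]; exact mul_le_mul_of_nonneg_right (hM x) (norm_nonneg _))

/-- Multiplication by a bounded measurable function on `L²(ℝ)`. -/
def mulOp (m : ℝ → ℂ) (hm : Measurable m) (M : ℝ) (hM : ∀ x, ‖m x‖ ≤ M) : L2 →L[ℂ] L2 :=
  LinearMap.mkContinuous
    { toFun := fun f => (memLp_mul_bounded hm hM f).toLp _
      map_add' := fun f g => by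
        rw [← MemLp.toLp_add, MemLp.toLp_eq_toLp_iff]
        filter_upwards [Lp.coeFn_add f g] with x hx
        rw [hx, Pi.add_apply, Pi.add_apply, mul_add]
      map_smul' := fun a f => by
        rw [RingHom.id_apply, ← MemLp.toLp_const_smul, MemLp.toLp_eq_toLp_iff]
        filter_upwards [Lp.coeFn_smul a f] with x hx
        rw [hx, Pi.smul_apply, Pi.smul_apply, smul_eq_mul, smul_eq_mul]; ring } M fun f => by
    refine Lp.norm_le_mul_norm_of_ae_le_mul ?_
    filter_upwards [MemLp.coeFn_toLp (memLp_mul_bounded hm hM f)] with x hx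
    simp only [LinearMap.coe_mk, AddHom.coe_mk, hx, norm_mul]
    exact mul_le_mul_of_nonneg_right (hM x) (norm_nonneg _)

theorem coeFn_mulOp (m : ℝ → ℂ) (hm : Measurable m) (M : ℝ) (hM : ∀ x, ‖m x‖ ≤ M) (f : L2) :
    mulOp m hm M hM f =ᵐ[volume] fun x => m x * f x :=
  MemLp.coeFn_toLp (memLp_mul_bounded hm hM f)

/-- Multiplication by a function that is bounded above and below is invertible on `L²(ℝ)`. -/
def mulEquiv (m : ℝ → ℂ) (hm : Measurable m) (M c : ℝ) (hM : ∀ x, ‖m x‖ ≤ M) (hc : 0 < c)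
    (hcm : ∀ x, c ≤ ‖m x‖) : L2 ≃L[ℂ] L2 :=
  ContinuousLinearEquiv.equivOfInverse (mulOp m hm M hM)
    (mulOp (fun x => (m x)⁻¹) hm.inv c⁻¹ fun x => by
      rw [norm_inv]; exact inv_anti₀ hc (hcm x))
    (fun f => by
      ext1
      filter_upwards [coeFn_mulOp (fun x => (m x)⁻¹) hm.inv c⁻¹ (fun x => by
        rw [norm_inv]; exact inv_anti₀ hc (hcm x)) (mulOp m hm M hM f), coeFn_mulOp m hm M hM f]
        with x h1 h2
      have : m x ≠ 0 := norm_pos_iff.1 (hc.trans_le (hcm x))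
      rw [h1, h2]; field_simp)
    (fun f => by
      ext1
      filter_upwards [coeFn_mulOp (fun x => (m x)⁻¹) hm.inv c⁻¹ (fun x => by
        rw [norm_inv]; exact inv_anti₀ hc (hcm x)) f, coeFn_mulOp m hm M hM (mulOp
          (fun x => (m x)⁻¹) hm.inv c⁻¹ (fun x => by
        rw [norm_inv]; exact inv_anti₀ hc (hcm x)) f)]
        with x h1 h2
      have : m x ≠ 0 := norm_pos_iff.1 (hc.trans_le (hcm x))
      rw [h2, h1]; field_simp)

theorem coeFn_mulEquiv (m : ℝ → ℂ) (hm : Measurable m) (M c : ℝ) (hM : ∀ x, ‖m x‖ ≤ M)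
    (hc : 0 < c) (hcm : ∀ x, c ≤ ‖m x‖) (f : L2) :
    mulEquiv m hm M c hM hc hcm f =ᵐ[volume] fun x => m x * f x := coeFn_mulOp m hm M hM f

theorem coeFn_mulEquiv_symm (m : ℝ → ℂ) (hm : Measurable m) (M c : ℝ) (hM : ∀ x, ‖m x‖ ≤ M)
    (hc : 0 < c) (hcm : ∀ x, c ≤ ‖m x‖) (f : L2) :
    (mulEquiv m hm M c hM hc hcm).symm f =ᵐ[volume] fun x => (m x)⁻¹ * f x :=
  coeFn_mulOp (fun x => (m x)⁻¹) hm.inv c⁻¹ (fun x => by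
    rw [norm_inv]; exact inv_anti₀ hc (hcm x)) f

/-- The Fourier multiplier with a symbol that is bounded above and below. -/
def multiplierEquiv (m : ℝ → ℂ) (hm : Measurable m) (M c : ℝ) (hM : ∀ x, ‖m x‖ ≤ M)
    (hc : 0 < c) (hcm : ∀ x, c ≤ ‖m x‖) : L2 ≃L[ℂ] L2 :=
  ((Lp.fourierTransformₗᵢ ℝ ℂ).toContinuousLinearEquiv.trans
    (mulEquiv m hm M c hM hc hcm)).trans (Lp.fourierTransformₗᵢ ℝ ℂ).symm.toContinuousLinearEquiv

section

variable (m : ℝ → ℂ) (hm : Measurable m) (M c : ℝ) (hM : ∀ x, ‖m x‖ ≤ M)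
    (hc : 0 < c) (hcm : ∀ x, c ≤ ‖m x‖)

theorem fourier_multiplierEquiv (f : L2) :
    𝓕 (multiplierEquiv m hm M c hM hc hcm f) = mulEquiv m hm M c hM hc hcm (𝓕 f) :=
  (Lp.fourierTransformₗᵢ ℝ ℂ).apply_symm_apply _

theorem fourier_multiplierEquiv_symm (f : L2) :
    𝓕 ((multiplierEquiv m hm M c hM hc hcm).symm f) =
      (mulEquiv m hm M c hM hc hcm).symm (𝓕 f) :=
  (Lp.fourierTransformₗᵢ ℝ ℂ).apply_symm_apply _

theorem inner_multiplierEquiv (f h : L2) :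
    inner ℂ h (multiplierEquiv m hm M c hM hc hcm f) =
      ∫ ξ, m ξ * ((𝓕 f : L2) ξ * starRingEnd ℂ ((𝓕 h : L2) ξ)) := by
  rw [← Lp.inner_fourier_eq, fourier_multiplierEquiv, L2.inner_def]
  refine integral_congr_ae ?_
  filter_upwards [coeFn_mulEquiv m hm M c hM hc hcm (𝓕 f)] with ξ h1
  rw [h1, RCLike.inner_apply]
  ring

theorem inner_multiplierEquiv_symm (f h : L2) :
    inner ℂ h ((multiplierEquiv m hm M c hM hc hcm).symm f) =
      ∫ ξ, (m ξ)⁻¹ * ((𝓕 f : L2) ξ * starRingEnd ℂ ((𝓕 h : L2) ξ)) := by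
  rw [← Lp.inner_fourier_eq, fourier_multiplierEquiv_symm, L2.inner_def]
  refine integral_congr_ae ?_
  filter_upwards [coeFn_mulEquiv_symm m hm M c hM hc hcm (𝓕 f)] with ξ h1
  rw [h1, RCLike.inner_apply]
  ring

end

/-! ### The frame operator -/

theorem continuous_uncurry_atomHat (α : ℝ) {φ : ℝ → ℂ} (hφ : Continuous φ) :
    Continuous fun p : (ℝ × ℝ) × ℝ => atomHat α φ p.1 p.2 := by
  have := continuous_beta α
  unfold atomHat; fun_prop

namespace DecayJet

variable {r C : ℝ} (D : DecayJet r C) {α : ℝ} {ψ : L2}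

theorem inner_atom (hr1 : 1 < r) (hψ : (𝓕 ψ : L2) =ᵐ[volume] D.f) (z : ℝ × ℝ) (f : L2) :
    inner ℂ (atom α ψ z) f = ∫ ξ, (𝓕 f : L2) ξ * starRingEnd ℂ (atomHat α D.f z ξ) := by
  rw [← Lp.inner_fourier_eq, fourier_atom α hψ D.continuous_f (D.integrable hr1) (D.memLp hr1),
    L2.inner_def]
  refine integral_congr_ae ?_
  filter_upwards [MemLp.coeFn_toLp (memLp_atomHat α D.continuous_f (D.memLp hr1) z)] with ξ h
  rw [h, RCLike.inner_apply]

theorem measurable_inner_atom (hr1 : 1 < r) (hψ : (𝓕 ψ : L2) =ᵐ[volume] D.f) (f : L2) :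
    StronglyMeasurable fun z => inner ℂ (atom α ψ z) f := by
  simp only [D.inner_atom hr1 hψ]
  have h1 : Measurable fun p : (ℝ × ℝ) × ℝ => (𝓕 f : L2) p.2 :=
    (Lp.stronglyMeasurable (𝓕 f : L2)).measurable.comp measurable_snd
  have h2 : Measurable fun p : (ℝ × ℝ) × ℝ => starRingEnd ℂ (atomHat α D.f p.1 p.2) :=
    (Complex.continuous_conj.comp (continuous_uncurry_atomHat α D.continuous_f)).measurable
  exact (h1.mul h2).stronglyMeasurable.integral_prod_right

/-- The frequency slice `ξ ↦ f̂(ξ) conj (√β(ω) φ(β(ω)(ξ - ω)))`. -/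
def slice (α : ℝ) (f : L2) (ω ξ : ℝ) : ℂ :=
  (𝓕 f : L2) ξ * starRingEnd ℂ (Real.sqrt (beta α ω) * D.f (beta α ω * (ξ - ω)))

theorem measurable_slice (f : L2) (ω : ℝ) : Measurable (D.slice α f ω) := by
  have h1 : Measurable fun ξ => (𝓕 f : L2) ξ := (Lp.stronglyMeasurable (𝓕 f : L2)).measurable
  have h2 : Continuous fun ξ =>
      starRingEnd ℂ (Real.sqrt (beta α ω) * D.f (beta α ω * (ξ - ω))) := by
    have := D.continuous_f
    exact Complex.continuous_conj.comp (by fun_prop)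
  exact h1.mul h2.measurable

theorem memLp_slice (hr : 0 ≤ r) (f : L2) (ω : ℝ) : MemLp (D.slice α f ω) 2 volume := by
  refine (Lp.memLp (𝓕 f : L2)).of_le_mul (c := Real.sqrt (beta α ω) * C)
    (D.measurable_slice f ω).aestronglyMeasurable (Eventually.of_forall fun ξ => ?_)
  rw [slice, norm_mul, RCLike.norm_conj, norm_mul, Complex.norm_real,
    Real.norm_of_nonneg (Real.sqrt_nonneg _), mul_comm]
  gcongr
  exact D.norm_le hr _

theorem integrable_slice (hr1 : 1 < r) (f : L2) (ω : ℝ) : Integrable (D.slice α f ω) := by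
  have h := MemLp.integrable_mul (Lp.memLp (𝓕 f : L2))
    (memLp_atomHat α D.continuous_f (D.memLp hr1) (0, ω))
  refine h.mono (D.measurable_slice f ω).aestronglyMeasurable (Eventually.of_forall fun ξ => ?_)
  rw [Pi.mul_apply, slice, norm_mul, norm_mul, RCLike.norm_conj, norm_mul, norm_atomHat,
    Complex.norm_real, Real.norm_of_nonneg (Real.sqrt_nonneg _)]

theorem inner_atom_eq_fourierInv (hr1 : 1 < r) (hψ : (𝓕 ψ : L2) =ᵐ[volume] D.f) (z : ℝ × ℝ)
    (f : L2) : inner ℂ (atom α ψ z) f = 𝓕⁻ (D.slice α f z.2) z.1 := by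
  rw [D.inner_atom hr1 hψ, Real.fourierInv_eq']
  congr 1; ext ξ
  rw [atomHat, slice, map_mul, ← Complex.exp_conj, smul_eq_mul]
  have : (starRingEnd ℂ) (((-2 * Real.pi * z.1 * ξ : ℝ) : ℂ) * Complex.I) =
      ((2 * Real.pi * inner ℝ ξ z.1 : ℝ) : ℂ) * Complex.I := by
    rw [map_mul, Complex.conj_I, Complex.conj_ofReal, RCLike.inner_apply, conj_trivial]
    push_cast; ring
  rw [this]; ring

theorem inner_atom_ae_eq_fourierInv_slice (hr1 : 1 < r) (hψ : (𝓕 ψ : L2) =ᵐ[volume] D.f) (f : L2) (ω : ℝ) :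
    (fun x => inner ℂ (atom α ψ (x, ω)) f) =ᵐ[volume]
      (𝓕⁻ ((D.memLp_slice (α := α) (by linarith) f ω).toLp _ : L2) : L2) := by
  refine EventuallyEq.trans (Eventually.of_forall fun x => ?_)
    (fourierInv_toLp_ae_eq (D.integrable_slice hr1 f ω) (D.memLp_slice (by linarith) f ω)).symm
  exact D.inner_atom_eq_fourierInv hr1 hψ (x, ω) f

/-- Parseval in the time variable: at fixed frequency `ω` the coefficients are inverse Fourier
transforms of the slices. -/
theorem integral_inner_atom_slice (hr1 : 1 < r) (hψ : (𝓕 ψ : L2) =ᵐ[volume] D.f) (f h : L2)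
    (ω : ℝ) :
    Integrable (fun x => inner ℂ (atom α ψ (x, ω)) f * inner ℂ h (atom α ψ (x, ω))) ∧
    ∫ x, inner ℂ (atom α ψ (x, ω)) f * inner ℂ h (atom α ψ (x, ω)) =
      ∫ ξ, D.slice α f ω ξ * starRingEnd ℂ (D.slice α h ω ξ) := by
  set F : L2 := (D.memLp_slice (α := α) (by linarith : 0 ≤ r) f ω).toLp _ with hF
  set H : L2 := (D.memLp_slice (α := α) (by linarith : 0 ≤ r) h ω).toLp _ with hH
  have e1 : (fun x => inner ℂ (atom α ψ (x, ω)) f * inner ℂ h (atom α ψ (x, ω))) =ᵐ[volume]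
      fun x => inner ℂ ((𝓕⁻ H : L2) x) ((𝓕⁻ F : L2) x) := by
    filter_upwards [D.inner_atom_ae_eq_fourierInv_slice (α := α) hr1 hψ f ω,
      D.inner_atom_ae_eq_fourierInv_slice (α := α) hr1 hψ h ω] with x h1 h2
    rw [RCLike.inner_apply, h1, ← inner_conj_symm h, h2]
  have e2 : (inner ℂ (𝓕⁻ H : L2) (𝓕⁻ F : L2) : ℂ) = inner ℂ H F :=
    (Lp.fourierTransformₗᵢ ℝ ℂ).symm.inner_map_map H F
  refine ⟨(L2.integrable_inner (𝕜 := ℂ) (𝓕⁻ H : L2) (𝓕⁻ F : L2)).congr e1.symm, ?_⟩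
  rw [integral_congr_ae e1, ← L2.inner_def, e2, L2.inner_def]
  refine integral_congr_ae ?_
  filter_upwards [MemLp.coeFn_toLp (D.memLp_slice (α := α) (by linarith : 0 ≤ r) f ω),
    MemLp.coeFn_toLp (D.memLp_slice (α := α) (by linarith : 0 ≤ r) h ω)] with ξ h1 h2
  rw [h1, h2, RCLike.inner_apply]

theorem slice_mul_conj (f h : L2) (ω ξ : ℝ) :
    D.slice α f ω ξ * starRingEnd ℂ (D.slice α h ω ξ) =
      ((beta α ω * ‖D.f (beta α ω * (ξ - ω))‖ ^ 2 : ℝ) : ℂ) *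
        ((𝓕 f : L2) ξ * starRingEnd ℂ ((𝓕 h : L2) ξ)) := by
  have h1 : ((Real.sqrt (beta α ω) : ℂ)) * (Real.sqrt (beta α ω) : ℂ) = (beta α ω : ℂ) := by
    norm_cast; exact Real.mul_self_sqrt (beta_pos α ω).le
  have h2 : D.f (beta α ω * (ξ - ω)) * starRingEnd ℂ (D.f (beta α ω * (ξ - ω))) =
      (‖D.f (beta α ω * (ξ - ω))‖ : ℂ) ^ 2 := by
    rw [Complex.mul_conj, Complex.normSq_eq_norm_sq]; push_cast; rfl
  simp only [slice, map_mul, Complex.conj_conj, Complex.conj_ofReal]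
  push_cast
  rw [← h1, ← h2]
  ring

section

variable (hα0 : 0 ≤ α) (hα1 : α < 1) (hr : 1 < (1 - α) * r)

include hα0 hα1 hr in
theorem continuous_symbol : Continuous (D.symbol α) := by
  have h := Complex.continuous_re.comp (D.symbolJet hα0 hα1 hr).continuous_f
  refine h.congr fun ξ => ?_
  simp [D.symbolJet_f hα0 hα1 hr]

theorem symbol_nonneg (ξ : ℝ) : 0 ≤ D.symbol α ξ :=
  integral_nonneg fun ω => by have := beta_pos α ω; positivity

-- The Fubini condition: integrating the modulus over `ω` leaves the bounded symbol times the
-- integrable function `|f̂ ĥ|`.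
include hα0 hα1 hr in
theorem integrable_slice_prod {M : ℝ} (hM : ∀ ξ, D.symbol α ξ ≤ M) (f h : L2) :
    Integrable (fun p : ℝ × ℝ => D.slice α f p.1 p.2 * starRingEnd ℂ (D.slice α h p.1 p.2))
      (volume.prod volume) := by
  simp only [slice_mul_conj]
  have hb := continuous_beta α
  have hφ := D.continuous_f
  have m1 : Measurable fun p : ℝ × ℝ =>
      ((beta α p.1 * ‖D.f (beta α p.1 * (p.2 - p.1))‖ ^ 2 : ℝ) : ℂ) :=
    Continuous.measurable (by fun_prop)
  have m2 : Measurable fun ξ : ℝ => (𝓕 f : L2) ξ * starRingEnd ℂ ((𝓕 h : L2) ξ) :=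
    (Lp.stronglyMeasurable (𝓕 f : L2)).measurable.mul
      (Complex.continuous_conj.measurable.comp (Lp.stronglyMeasurable (𝓕 h : L2)).measurable)
  have i2 : Integrable fun ξ : ℝ => (𝓕 f : L2) ξ * starRingEnd ℂ ((𝓕 h : L2) ξ) := by
    refine (L2.integrable_inner (𝕜 := ℂ) (𝓕 h : L2) (𝓕 f : L2)).congr
      (Eventually.of_forall fun ξ => ?_)
    simp only [RCLike.inner_apply]
  have hms : AEStronglyMeasurable (fun p : ℝ × ℝ =>
      ((beta α p.1 * ‖D.f (beta α p.1 * (p.2 - p.1))‖ ^ 2 : ℝ) : ℂ) *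
        ((𝓕 f : L2) p.2 * starRingEnd ℂ ((𝓕 h : L2) p.2))) (volume.prod volume) :=
    (m1.mul (m2.comp measurable_snd)).aestronglyMeasurable
  rw [integrable_prod_iff' hms]
  refine ⟨Eventually.of_forall fun ξ => ?_, ?_⟩
  · exact ((D.integrable_symbol hα0 hα1 hr ξ).ofReal (𝕜 := ℂ)).mul_const
      ((𝓕 f : L2) ξ * starRingEnd ℂ ((𝓕 h : L2) ξ))
  have e : ∀ ξ, ∫ ω, ‖((beta α ω * ‖D.f (beta α ω * (ξ - ω))‖ ^ 2 : ℝ) : ℂ) *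
        ((𝓕 f : L2) ξ * starRingEnd ℂ ((𝓕 h : L2) ξ))‖ =
      D.symbol α ξ * ‖(𝓕 f : L2) ξ * starRingEnd ℂ ((𝓕 h : L2) ξ)‖ := by
    intro ξ
    rw [symbol, ← integral_mul_const]
    congr 1; ext ω
    rw [norm_mul, Complex.norm_real, Real.norm_of_nonneg (by have := beta_pos α ω; positivity)]
  refine (i2.norm.const_mul M).mono' ?_ (Eventually.of_forall fun ξ => ?_)
  · simp only [e]
    exact ((D.continuous_symbol hα0 hα1 hr).measurable.mul m2.norm).aestronglyMeasurable
  · simp only [e]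
    rw [Real.norm_of_nonneg (mul_nonneg (D.symbol_nonneg ξ) (norm_nonneg _))]
    exact mul_le_mul_of_nonneg_right (hM ξ) (norm_nonneg _)

-- Square integrability of the coefficients over `X` makes the weak integral absolutely convergent
-- for every pair `f`, `h`.
include hα0 hα1 hr in
theorem memLp_inner_atom (hr1 : 1 < r) (hψ : (𝓕 ψ : L2) =ᵐ[volume] D.f) {M : ℝ}
    (hM : ∀ ξ, D.symbol α ξ ≤ M) (f : L2) :
    MemLp (fun z => inner ℂ (atom α ψ z) f) 2 (volume : Measure (ℝ × ℝ)) := by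
  have hm := D.measurable_inner_atom (α := α) hr1 hψ f
  have hms : AEStronglyMeasurable (fun z : ℝ × ℝ => ‖inner ℂ (atom α ψ z) f‖ ^ 2)
      (volume.prod volume) := (hm.norm.pow 2).aestronglyMeasurable
  rw [memLp_two_iff_integrable_sq_norm hm.aestronglyMeasurable, Measure.volume_eq_prod,
    integrable_prod_iff' hms]
  have e0 : ∀ z, ‖inner ℂ (atom α ψ z) f‖ ^ 2 =
      (inner ℂ (atom α ψ z) f * inner ℂ f (atom α ψ z)).re := by
    intro z
    rw [← inner_conj_symm f, Complex.mul_conj, Complex.normSq_eq_norm_sq, Complex.ofReal_re]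
  have e : ∀ ω, ∫ x, ‖‖inner ℂ (atom α ψ (x, ω)) f‖ ^ 2‖ =
      (∫ ξ, D.slice α f ω ξ * starRingEnd ℂ (D.slice α f ω ξ)).re := by
    intro ω
    obtain ⟨h1, h2⟩ := D.integral_inner_atom_slice (α := α) hr1 hψ f f ω
    rw [← h2, ← RCLike.re_eq_complex_re, ← integral_re h1]
    congr 1; ext x
    rw [Real.norm_of_nonneg (by positivity), e0]; rfl
  refine ⟨Eventually.of_forall fun ω => ?_, ?_⟩
  · simp only [e0]
    exact (D.integral_inner_atom_slice (α := α) hr1 hψ f f ω).1.re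
  · simp only [e]
    exact (D.integrable_slice_prod hα0 hα1 hr hM f f).integral_prod_left.re

include hα0 hα1 hr in
theorem isFrameOperator (hr1 : 1 < r) (hψ : (𝓕 ψ : L2) =ᵐ[volume] D.f) {M c : ℝ}
    (hm : Measurable fun ξ => (D.symbol α ξ : ℂ)) (hM : ∀ ξ, ‖(D.symbol α ξ : ℂ)‖ ≤ M)
    (hc : 0 < c) (hcm : ∀ ξ, c ≤ ‖(D.symbol α ξ : ℂ)‖) :
    IsFrameOperator α ψ (multiplierEquiv (fun ξ => (D.symbol α ξ : ℂ)) hm M c hM hc hcm) := by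
  have hM' : ∀ ξ, D.symbol α ξ ≤ M := fun ξ => by
    have := hM ξ
    rw [Complex.norm_real] at this
    exact (le_abs_self _).trans this
  intro f h
  have hint : Integrable (fun z : ℝ × ℝ => inner ℂ (atom α ψ z) f * inner ℂ h (atom α ψ z)) := by
    have h1 := D.memLp_inner_atom hα0 hα1 hr hr1 hψ hM' f
    have h2 := (D.memLp_inner_atom hα0 hα1 hr hr1 hψ hM' h).star
    refine (MemLp.integrable_mul h1 h2).congr (Eventually.of_forall fun z => ?_)
    simp only [Pi.mul_apply, Pi.star_apply, RCLike.star_def, inner_conj_symm]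
  refine ⟨hint, ?_⟩
  rw [inner_multiplierEquiv, Measure.volume_eq_prod, integral_prod_symm _ hint]
  simp only [(D.integral_inner_atom_slice (α := α) hr1 hψ f h _).2]
  rw [integral_integral_swap (D.integrable_slice_prod hα0 hα1 hr hM' f h)]
  congr 1; ext ξ
  simp only [slice_mul_conj]
  rw [integral_mul_const, integral_complex_ofReal]
  rfl

end

end DecayJet

/-! ### The kernel -/

/-- The phase `Γ(y, z) = e^{2πi(y₁ - z₁)y₂}`. -/
def phase (y z : ℝ × ℝ) : ℂ := Complex.exp (((2 * Real.pi * (y.1 - z.1) * y.2 : ℝ) : ℂ) * Complex.I)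

theorem norm_phase (y z : ℝ × ℝ) : ‖phase y z‖ = 1 := Complex.norm_exp_ofReal_mul_I _

theorem continuous_phase : Continuous (Function.uncurry phase) := by
  unfold Function.uncurry phase; fun_prop

namespace DecayJet

variable {r C : ℝ} (D : DecayJet r C) {α : ℝ} {ψ : L2}
  (hα0 : 0 ≤ α) (hα1 : α < 1) (hr : 1 < (1 - α) * r)

/-- The jet whose Fourier transform gives the kernel, with `θ` in place of `φ` in the
second argument. -/
def kernJet (hne : ∀ ξ, (D.symbolJet hα0 hα1 hr).f ξ ≠ 0) (θ : Jet) (ω η : ℝ) : Jet :=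
  ((D.symbolJet hα0 hα1 hr).inv hne).mul
    ((D.toJet.affine (Real.sqrt (beta α ω)) (beta α ω) ω).mul
      (θ.affine (Real.sqrt (beta α η)) (beta α η) η).conj)

/-- The second window `θ` is `φ` for the kernel and `oscJet` for the oscillation; the latter has
only the decay `r - 1`, so `p` may be below `r`. Two products give `16 = 4 · 4`, and the three
scales are bounded by their sum. -/
theorem kernJet_bd (hne : ∀ ξ, (D.symbolJet hα0 hα1 hr).f ξ ≠ 0) {θ : Jet} {p E K : ℝ}
    (hpr : p ≤ r) (hK : ∀ ξ, ((D.symbolJet hα0 hα1 hr).inv hne).Bd (beta α ξ) K ξ)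
    (hθ : ∀ v, θ.Bd 1 (E * (1 + |v|) ^ (-p)) v) (ω η ξ : ℝ) :
    (D.kernJet hα0 hα1 hr hne θ ω η).Bd (beta α ω + beta α η + beta α ξ)
      (16 * K * C * E * (Real.sqrt (beta α ω) * Real.sqrt (beta α η) *
        (scaledDist α ω ξ ^ (-p) * scaledDist α η ξ ^ (-p)))) ξ := by
  have ha := beta_pos α ω
  have hb := beta_pos α η
  have hx := beta_pos α ξ
  have hC := D.const_nonneg
  have hK0 := (hK ξ).nonneg
  have hU := scaledDist_pos α ω ξ
  have hV := scaledDist_pos α η ξ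
  have hE : 0 ≤ E := by
    have := (hθ 0).nonneg; simpa using this
  have n1 : ‖(Real.sqrt (beta α ω) : ℂ)‖ = Real.sqrt (beta α ω) := by
    rw [Complex.norm_real, Real.norm_of_nonneg (Real.sqrt_nonneg _)]
  have n2 : ‖(Real.sqrt (beta α η) : ℂ)‖ = Real.sqrt (beta α η) := by
    rw [Complex.norm_real, Real.norm_of_nonneg (Real.sqrt_nonneg _)]
  have b1 := (D.bd (beta α ω * (ξ - ω))).affine (Real.sqrt (beta α ω) : ℂ) ha.le
  have b2 := ((hθ (beta α η * (ξ - η))).affine (Real.sqrt (beta α η) : ℂ) hb.le).conj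
  rw [n1, ← scaledDist_eq_abs] at b1
  rw [n2, ← scaledDist_eq_abs] at b2
  set L := beta α ω + beta α η + beta α ξ with hL
  have hL0 : 0 ≤ L := by positivity
  have b1' := b1.mono ha.le (by linarith : beta α ω ≤ L) le_rfl
  have b2' := b2.mono hb.le (by linarith : beta α η ≤ L) le_rfl
  have b3' := (hK ξ).mono hx.le (by linarith : beta α ξ ≤ L) le_rfl
  refine (b3'.mul hL0 (b1'.mul hL0 b2')).mono hL0 le_rfl ?_
  have hUr : scaledDist α ω ξ ^ (-r) ≤ scaledDist α ω ξ ^ (-p) :=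
    Real.rpow_le_rpow_of_exponent_le (one_le_scaledDist α ω ξ) (by linarith)
  calc 4 * (K * (4 * (Real.sqrt (beta α ω) * (C * scaledDist α ω ξ ^ (-r)) *
        (Real.sqrt (beta α η) * (E * scaledDist α η ξ ^ (-p))))))
      ≤ 4 * (K * (4 * (Real.sqrt (beta α ω) * (C * scaledDist α ω ξ ^ (-p)) *
        (Real.sqrt (beta α η) * (E * scaledDist α η ξ ^ (-p)))))) := by gcongr
    _ = _ := by ring

include hα0 hα1 hr in
theorem exists_kernel (hr1 : 2 < r) (hr3 : 1 < (1 - α) * (r - 3 * α))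
    (hψ : (𝓕 ψ : L2) =ᵐ[volume] D.f) (hne : ∃ x, D.f x ≠ 0) :
    ∃ A : L2 ≃L[ℂ] L2, IsFrameOperator α ψ A ∧
      Continuous (Function.uncurry (kernelR α ψ A)) ∧ ∃ K : ℝ, 0 ≤ K ∧
      (∀ x y l, 0 < l → ‖kernelR α ψ A x y‖ₑ ≤ ENNReal.ofReal K * majorant α (r - 1) l x y) ∧
      (∀ e, e ≤ 1 / 4 → ∀ x y z : ℝ × ℝ, |beta α z.2 / beta α y.2 - 1| ≤ e →
        |(z.1 - y.1) / beta α y.2| ≤ e → |beta α y.2 * (z.2 - y.2)| ≤ e → ∀ l, 0 < l →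
        ‖kernelR α ψ A x y - phase y z * kernelR α ψ A x z‖ₑ ≤
          ENNReal.ofReal (K * e) * majorant α (r - 1) l x y) := by
  have hr0 : 0 ≤ r := by linarith
  have hr1' : 1 < r := by linarith
  have hC := D.const_nonneg
  obtain ⟨c, hc, hcm⟩ := D.exists_symbol_lower hα0 hα1 hr hne
  have hcm' : ∀ ξ, c ≤ ‖(D.symbol α ξ : ℂ)‖ := fun ξ => by
    rw [Complex.norm_real]; exact (hcm ξ).trans (le_abs_self _)
  set M := 4 * C ^ 2 * (bracketInt ((1 - α) * (r - 3 * α))).toReal with hM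
  have hbd := D.symbolJet_bd hα0 hα1 hr hr3
  have hMM : ∀ ξ, ‖(D.symbol α ξ : ℂ)‖ ≤ M := fun ξ => by
    rw [← D.symbolJet_f hα0 hα1 hr]; exact (hbd ξ).b0
  have hm : Measurable fun ξ => (D.symbol α ξ : ℂ) :=
    (Complex.continuous_ofReal.comp (D.continuous_symbol hα0 hα1 hr)).measurable
  have hne' : ∀ ξ, (D.symbolJet hα0 hα1 hr).f ξ ≠ 0 := fun ξ => by
    rw [D.symbolJet_f]
    exact norm_pos_iff.1 (hc.trans_le (hcm' ξ))
  set K := 1 / c + M / c ^ 2 + 2 * M ^ 2 / c ^ 3 with hK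
  have hKbd : ∀ ξ, ((D.symbolJet hα0 hα1 hr).inv hne').Bd (beta α ξ) K ξ := fun ξ =>
    (hbd ξ).inv hne' (beta_pos α ξ).le hc (by rw [D.symbolJet_f]; exact hcm' ξ)
  have hK0 : 0 ≤ K := (hKbd 0).nonneg
  set A := multiplierEquiv (fun ξ => (D.symbol α ξ : ℂ)) hm M c hMM hc hcm' with hA
  have hat := fourier_atom α hψ D.continuous_f (D.integrable hr1') (D.memLp hr1')
  have hatc : ∀ z, (𝓕 (atom α ψ z) : L2) =ᵐ[volume] atomHat α D.f z := fun z => by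
    rw [hat]; exact MemLp.coeFn_toLp _
  have hR : ∀ x y, kernelR α ψ A x y = ∫ ξ, (D.symbol α ξ : ℂ)⁻¹ *
      (atomHat α D.f x ξ * starRingEnd ℂ (atomHat α D.f y ξ)) := by
    intro x y
    rw [kernelR, hA, inner_multiplierEquiv_symm]
    refine integral_congr_ae ?_
    filter_upwards [hatc x, hatc y] with ξ h1 h2
    rw [h1, h2]
  -- Since the kernel is conjugate linear in the atom at `y`, the phase enters that slot as its
  -- conjugate.
  have hosc : ∀ x y z, kernelR α ψ A x y - phase y z * kernelR α ψ A x z =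
      ∫ ξ, (D.symbol α ξ : ℂ)⁻¹ * (atomHat α D.f x ξ * starRingEnd ℂ (atomHat α D.f y ξ -
        starRingEnd ℂ (phase y z) * atomHat α D.f z ξ)) := by
    intro x y z
    have e1 : kernelR α ψ A x y - phase y z * kernelR α ψ A x z =
        inner ℂ (atom α ψ y - starRingEnd ℂ (phase y z) • atom α ψ z) (A.symm (atom α ψ x)) := by
      rw [inner_sub_left, inner_smul_left, Complex.conj_conj]; rfl
    rw [e1, hA, inner_multiplierEquiv_symm]
    have e2 : 𝓕 (atom α ψ y - starRingEnd ℂ (phase y z) • atom α ψ z) =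
        𝓕 (atom α ψ y) - starRingEnd ℂ (phase y z) • 𝓕 (atom α ψ z) :=
      (map_sub (Lp.fourierTransformₗᵢ ℝ ℂ) _ _).trans
        (congrArg _ (map_smul (Lp.fourierTransformₗᵢ ℝ ℂ) _ _))
    refine integral_congr_ae ?_
    filter_upwards [hatc x, hatc y, hatc z,
      Lp.coeFn_sub (𝓕 (atom α ψ y) : L2) (starRingEnd ℂ (phase y z) • 𝓕 (atom α ψ z) : L2),
      Lp.coeFn_smul (starRingEnd ℂ (phase y z)) (𝓕 (atom α ψ z) : L2)] with ξ h1 h2 h3 h4 h5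
    rw [e2, h4, Pi.sub_apply, h5, Pi.smul_apply, h1, h2, h3, smul_eq_mul]
  refine ⟨A, D.isFrameOperator hα0 hα1 hr hr1' hψ hm hMM hc hcm', ?_,
    16 * K * C * (300 * C * 2 ^ r) + 16 * K * C * C, by positivity, ?_, ?_⟩
  · rw [continuous_iff_continuousAt]
    rintro ⟨x₀, y₀⟩
    have hfun : Function.uncurry (kernelR α ψ A) = fun q : (ℝ × ℝ) × (ℝ × ℝ) =>
        ∫ ξ, (D.symbol α ξ : ℂ)⁻¹ *
          (atomHat α D.f q.1 ξ * starRingEnd ℂ (atomHat α D.f q.2 ξ)) := by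
      ext q; exact hR q.1 q.2
    rw [hfun]
    have hcontA := continuous_uncurry_atomHat α D.continuous_f
    -- Near `y₀` the atom at `q.2` has uniform decay in `ξ`, because `|q.2.2| < 1 + |y₀.2|`; the
    -- other factors are merely bounded.
    refine continuousAt_of_dominated
      (bound := fun ξ => c⁻¹ * (C * (C * ((2 + |y₀.2|) ^ r * (1 + |ξ|) ^ (-r))))) ?_ ?_ ?_ ?_
    · refine Eventually.of_forall fun q => Measurable.aestronglyMeasurable ?_
      exact hm.inv.mul ((continuous_atomHat α D.continuous_f q.1).measurable.mul
        (Complex.continuous_conj.comp (continuous_atomHat α D.continuous_f q.2)).measurable)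
    · have hnear : ∀ᶠ q : (ℝ × ℝ) × (ℝ × ℝ) in 𝓝 (x₀, y₀), |q.2.2| < 1 + |y₀.2| := by
        have : ContinuousAt (fun q : (ℝ × ℝ) × (ℝ × ℝ) => |q.2.2|) (x₀, y₀) := by fun_prop
        exact this.eventually (gt_mem_nhds (by simp))
      filter_upwards [hnear] with q hq
      refine Eventually.of_forall fun ξ => ?_
      have hV := scaledDist_pos α q.2.2 ξ
      have s1 : ∀ ω, Real.sqrt (beta α ω) ≤ 1 := fun ω =>
        Real.sqrt_le_one.2 (beta_le_one hα0 ω)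
      have t1 : ‖(D.symbol α ξ : ℂ)⁻¹‖ ≤ c⁻¹ := by
        rw [norm_inv]; exact inv_anti₀ hc (hcm' ξ)
      have t2 : ‖atomHat α D.f q.1 ξ‖ ≤ C := by
        rw [norm_atomHat]
        exact (mul_le_of_le_one_left (norm_nonneg _) (s1 _)).trans (D.norm_le hr0 _)
      have t3 : ‖atomHat α D.f q.2 ξ‖ ≤ C * ((2 + |y₀.2|) ^ r * (1 + |ξ|) ^ (-r)) := by
        rw [norm_atomHat]
        refine (mul_le_of_le_one_left (norm_nonneg _) (s1 _)).trans ((D.b0 _).trans ?_)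
        rw [← scaledDist_eq_abs]
        gcongr
        have h1 := one_add_abs_le_mul_scaledDist hα1 q.2.2 ξ
        have h2 : (1 + |ξ|) / (2 + |y₀.2|) ≤ scaledDist α q.2.2 ξ := by
          rw [div_le_iff₀ (by positivity)]
          refine h1.trans ?_
          rw [mul_comm]; exact mul_le_mul_of_nonneg_left (by linarith) hV.le
        calc scaledDist α q.2.2 ξ ^ (-r) ≤ ((1 + |ξ|) / (2 + |y₀.2|)) ^ (-r) :=
              Real.rpow_le_rpow_of_nonpos (by positivity) h2 (by linarith)
          _ = _ := by
              rw [Real.div_rpow (by positivity) (by positivity),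
                Real.rpow_neg (by positivity : 0 ≤ 2 + |y₀.2|)]
              field_simp
      rw [norm_mul, norm_mul, RCLike.norm_conj]
      gcongr
    · exact ((((integrable_bracket hr1').const_mul _).const_mul _).const_mul _).const_mul _
    · refine Eventually.of_forall fun ξ => Continuous.continuousAt ?_
      have h1 : Continuous fun q : (ℝ × ℝ) × (ℝ × ℝ) => atomHat α D.f q.1 ξ :=
        hcontA.comp (by fun_prop : Continuous fun q : (ℝ × ℝ) × (ℝ × ℝ) => (q.1, ξ))
      have h2 : Continuous fun q : (ℝ × ℝ) × (ℝ × ℝ) => atomHat α D.f q.2 ξ :=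
        hcontA.comp (by fun_prop : Continuous fun q : (ℝ × ℝ) × (ℝ × ℝ) => (q.2, ξ))
      exact continuous_const.mul (h1.mul (Complex.continuous_conj.comp h2))
  · intro x y l hl
    have hDb : ∀ v, D.toJet.Bd 1 (C * (1 + |v|) ^ (-(r - 1))) v := fun v =>
      (D.bd v).mono zero_le_one le_rfl (mul_le_mul_of_nonneg_left
        (Real.rpow_le_rpow_of_exponent_le (by linarith [abs_nonneg v]) (by linarith)) hC)
    have e : kernelR α ψ A x y =
        𝓕 (D.kernJet hα0 hα1 hr hne' D.toJet x.2 y.2).f (x.1 - y.1) := by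
      rw [hR, Real.fourier_eq']
      congr 1; ext ξ
      have hexp : Complex.exp (((-2 * Real.pi * inner ℝ ξ (x.1 - y.1) : ℝ) : ℂ) * Complex.I) =
          Complex.exp (((-2 * Real.pi * x.1 * ξ : ℝ) : ℂ) * Complex.I) *
          starRingEnd ℂ (Complex.exp (((-2 * Real.pi * y.1 * ξ : ℝ) : ℂ) * Complex.I)) := by
        rw [← Complex.exp_conj, ← Complex.exp_add, map_mul, Complex.conj_I, Complex.conj_ofReal,
          RCLike.inner_apply, conj_trivial]
        congr 1; push_cast; ring
      simp only [kernJet, Jet.mul, Jet.inv, Jet.affine, Jet.conj, atomHat, hexp, smul_eq_mul,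
        map_mul, D.symbolJet_f]
      ring
    rw [e]
    refine (Jet.enorm_fourier_le_majorant hα0 (by linarith) _ x y
      (D.kernJet_bd hα0 hα1 hr hne' (by linarith) hKbd (E := C) hDb x.2 y.2) hl).trans ?_
    gcongr ENNReal.ofReal ?_ * _
    exact le_add_of_nonneg_left (by positivity)
  · intro e he x y z hk hδ hμ l hl
    have he0 : 0 ≤ e := (abs_nonneg _).trans hk
    have hb := beta_pos α y.2
    have hb' := beta_pos α z.2
    -- In the variable `v = β(y₂)(ξ-y₂)`, the atom at `z` is a dilate by `k`, a translate by `μ` and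
    -- a modulation by `δ` of the atom at `y`.
    set k := beta α z.2 / beta α y.2 with hkdef
    set δ := (z.1 - y.1) / beta α y.2 with hδdef
    set μ := beta α y.2 * (z.2 - y.2) with hμdef
    have eq : kernelR α ψ A x y - phase y z * kernelR α ψ A x z =
        𝓕 (D.kernJet hα0 hα1 hr hne' (D.oscJet k δ μ) x.2 y.2).f (x.1 - y.1) := by
      rw [hosc, Real.fourier_eq']
      congr 1; ext ξ
      have hdiff : atomHat α D.f y ξ - starRingEnd ℂ (phase y z) * atomHat α D.f z ξ =
          Complex.exp (((-2 * Real.pi * y.1 * ξ : ℝ) : ℂ) * Complex.I) *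
            (Real.sqrt (beta α y.2) * (D.oscJet k δ μ).f (beta α y.2 * (ξ - y.2))) := by
        have h1 : k * (beta α y.2 * (ξ - y.2) - μ) = beta α z.2 * (ξ - z.2) := by
          rw [hkdef, hμdef]; field_simp; ring
        have h2 : Real.sqrt (beta α z.2) = Real.sqrt (beta α y.2) * Real.sqrt k := by
          rw [← Real.sqrt_mul hb.le]; congr 1; rw [hkdef]; field_simp
        -- The reason for this phase: it turns the factor `e^{-2πi(z₁-y₁)ξ}` into
        -- `e^{-2πi(z₁-y₁)(ξ-y₂)} = e^{-2πiδv}`, close to `1` where `φ(v)` is concentrated, however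
        -- large `y₂` is.
        have h3 : starRingEnd ℂ (phase y z) *
            Complex.exp (((-2 * Real.pi * z.1 * ξ : ℝ) : ℂ) * Complex.I) =
            Complex.exp (((-2 * Real.pi * y.1 * ξ : ℝ) : ℂ) * Complex.I) *
            Complex.exp (((-2 * Real.pi * δ * (beta α y.2 * (ξ - y.2)) : ℝ) : ℂ) * Complex.I) := by
          have h4 : δ * (beta α y.2 * (ξ - y.2)) = (z.1 - y.1) * (ξ - y.2) := by
            rw [hδdef]; field_simp
          rw [phase, ← Complex.exp_conj, ← Complex.exp_add, ← Complex.exp_add, map_mul,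
            Complex.conj_I, Complex.conj_ofReal, mul_assoc (-2 * Real.pi) δ, h4]
          congr 1; push_cast; ring
        rw [oscJet_f, h1]
        simp only [atomHat]
        rw [← mul_assoc (starRingEnd ℂ (phase y z)), h3, h2]
        push_cast; ring
      have hexp : Complex.exp (((-2 * Real.pi * inner ℝ ξ (x.1 - y.1) : ℝ) : ℂ) * Complex.I) =
          Complex.exp (((-2 * Real.pi * x.1 * ξ : ℝ) : ℂ) * Complex.I) *
          starRingEnd ℂ (Complex.exp (((-2 * Real.pi * y.1 * ξ : ℝ) : ℂ) * Complex.I)) := by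
        rw [← Complex.exp_conj, ← Complex.exp_add, map_mul, Complex.conj_I, Complex.conj_ofReal,
          RCLike.inner_apply, conj_trivial]
        congr 1; push_cast; ring
      rw [hdiff]
      simp only [kernJet, Jet.mul, Jet.inv, Jet.affine, Jet.conj, atomHat, hexp, smul_eq_mul,
        map_mul, D.symbolJet_f]
      ring
    rw [eq]
    refine (Jet.enorm_fourier_le_majorant hα0 (by linarith) _ x y
      (D.kernJet_bd hα0 hα1 hr hne' (by linarith) hKbd
        (fun v => D.oscJet_bd hr0 he hk hδ hμ v) x.2 y.2) hl).trans ?_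
    gcongr ENNReal.ofReal ?_ * _
    rw [add_mul]
    calc 16 * K * C * (300 * C * 2 ^ r * e) = 16 * K * C * (300 * C * 2 ^ r) * e := by ring
      _ ≤ _ := le_add_of_nonneg_right (by positivity)

end DecayJet

/-! ### Measurability of the oscillation -/

theorem mem_nbhdQ {X ι : Type*} {U : ι → Set X} {y z : X} :
    z ∈ nbhdQ U y ↔ ∃ i, y ∈ U i ∧ z ∈ U i := by
  simp [nbhdQ]

/-- The supremum is uncountable, so measurability comes from lower semicontinuity: the members being
open, `z ∈ Q_y` persists under small changes of `y`. -/
theorem measurable_osc {X ι : Type*} [TopologicalSpace X] [MeasurableSpace X]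
    [OpensMeasurableSpace (X × X)] {R Γ : X → X → ℂ} (hR : Continuous (Function.uncurry R))
    (hΓ : Continuous (Function.uncurry Γ)) {U : ι → Set X} (hU : ∀ i, IsOpen (U i)) :
    Measurable (Function.uncurry (osc R U Γ)) := by
  have key : LowerSemicontinuous (Function.uncurry (osc R U Γ)) := by
    unfold Function.uncurry osc
    refine lowerSemicontinuous_iSup fun z => ?_
    intro p a ha
    by_cases hz : z ∈ nbhdQ U p.2
    · beta_reduce at ha ⊢
      rw [iSup_pos hz] at ha
      have hcont : Continuous fun q : X × X => ‖R q.1 q.2 - Γ q.2 z * R q.1 z‖ₑ := by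
        have h1 : Continuous fun q : X × X => R q.1 q.2 := hR
        have h2 : Continuous fun q : X × X => Γ q.2 z :=
          hΓ.comp (by fun_prop : Continuous fun q : X × X => (q.2, z))
        have h3 : Continuous fun q : X × X => R q.1 z :=
          hR.comp (by fun_prop : Continuous fun q : X × X => (q.1, z))
        exact (h1.sub (h2.mul h3)).enorm
      obtain ⟨i, hy, hzi⟩ := mem_nbhdQ.1 hz
      have hopen : ∀ᶠ q : X × X in 𝓝 p, q.2 ∈ U i :=
        continuous_snd.continuousAt.eventually ((hU i).mem_nhds hy)
      filter_upwards [hopen, hcont.continuousAt.eventually (lt_mem_nhds ha)] with q hq1 hq2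
      rwa [iSup_pos (mem_nbhdQ.2 ⟨i, hq1, hzi⟩)]
    -- For `z ∉ Q_y` the inner supremum is empty, hence `0`, and exceeds nothing.
    · beta_reduce at ha
      rw [iSup_neg hz] at ha
      exact absurd ha (by simp)
  exact key.measurable

theorem isOpen_coverU (α c ε : ℝ) (i : ℤ × ℤ) : IsOpen (coverU α c ε i) :=
  isOpen_Ioo.prod isOpen_Ioo

/-! ### Members of the covering are small -/

section

variable {α c ε : ℝ} (hα0 : 0 ≤ α) (hα1 : α < 1)

theorem abs_sub_omegaPt_le {i : ℤ × ℤ} {z : ℝ × ℝ} (hz : z ∈ coverU α c ε i) :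
    |z.2 - omegaPt α ε i.1| ≤ 2 * ε * c * (beta α (omegaPt α ε i.1))⁻¹ := by
  have h := hz.2
  rw [abs_le]
  constructor <;> linarith [h.1, h.2]

-- Two points of one member are compared through its centre `ω_j`, whose `β` is within a factor `2`
-- of `β(y₂)`. The three quantities are at most `16cε`, `4ε` and `8cε`; `4 + 16c` covers them all.
include hα0 hα1 in
theorem nbhdQ_bounds (hc : 0 < c) (hε : 0 < ε) (hsmall : ε * (4 + 16 * c) ≤ 1 / 4)
    {y z : ℝ × ℝ} (hz : z ∈ nbhdQ (coverU α c ε) y) :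
    |beta α z.2 / beta α y.2 - 1| ≤ ε * (4 + 16 * c) ∧
    |(z.1 - y.1) / beta α y.2| ≤ ε * (4 + 16 * c) ∧
    |beta α y.2 * (z.2 - y.2)| ≤ ε * (4 + 16 * c) := by
  obtain ⟨i, hyi, hzi⟩ := mem_nbhdQ.1 hz
  have hb := beta_pos α y.2
  have hεc : 0 < ε * c := by positivity
  have hy2 := abs_sub_omegaPt_le hyi
  have hz2 := abs_sub_omegaPt_le hzi
  have hτ : 2 * ε * c ≤ 1 / 2 := by nlinarith
  have by2 := abs_beta_sub_le hα0 hα1 hτ hy2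
  have bz2 := abs_beta_sub_le hα0 hα1 hτ hz2
  have hj := beta_pos α (omegaPt α ε i.1)
  have hy1 := hyi.1
  have hz1 := hzi.1
  set b := beta α y.2
  set b' := beta α z.2
  set B := beta α (omegaPt α ε i.1)
  set w := omegaPt α ε i.1
  have hτ' : 2 * (2 * ε * c) ≤ 1 / 2 := by nlinarith
  have hB1 : B ≤ 2 * b := by nlinarith [(abs_le.1 by2).1]
  have hB2 : b ≤ 2 * B := by nlinarith [(abs_le.1 by2).2]
  have hBinv : B⁻¹ ≤ 2 * b⁻¹ := by
    rw [← div_eq_mul_inv, le_div_iff₀ hb, inv_mul_le_iff₀ hj]; linarith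
  refine ⟨?_, ?_, ?_⟩
  · have e : b' / b - 1 = (b' - b) / b := by field_simp
    rw [e, abs_div, abs_of_pos hb, div_le_iff₀ hb]
    have h1 : |b' - b| ≤ |b' - B| + |b - B| := by
      rw [abs_sub_comm b B]; exact abs_sub_le _ _ _
    nlinarith
  · rw [abs_div, abs_of_pos hb, div_le_iff₀ hb]
    have h1 : |z.1 - y.1| ≤ 2 * (ε * B) := by
      rw [abs_le]
      constructor <;> nlinarith [hy1.1, hy1.2, hz1.1, hz1.2]
    nlinarith
  · rw [abs_mul, abs_of_pos hb]
    have h1 : |z.2 - y.2| ≤ |z.2 - w| + |y.2 - w| := by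
      rw [abs_sub_comm y.2 w]; exact abs_sub_le _ _ _
    have h2 : |z.2 - y.2| ≤ 8 * (ε * c) * b⁻¹ := by
      calc |z.2 - y.2| ≤ 4 * (ε * c) * B⁻¹ := by linarith
        _ ≤ 4 * (ε * c) * (2 * b⁻¹) := by gcongr
        _ = _ := by ring
    calc b * |z.2 - y.2| ≤ b * (8 * (ε * c) * b⁻¹) := by gcongr
      _ = 8 * (ε * c) := by field_simp
      _ ≤ _ := by nlinarith

end

/-! ### Weighted integrals of the kernel and of the oscillation -/

/-- The pointwise bound holds for every `l`, so `l` can be fitted to the variable that is not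
integrated. -/
theorem supIntFst_le_of_majorant {α p s K : ℝ} {Cm : ℝ≥0∞}
    (hCm : ∀ y : ℝ × ℝ,
      ∫⁻ x, majorant α p (beta α y.2) x y * ENNReal.ofReal (weightW s x y) ≤ Cm)
    {k : ℝ × ℝ → ℝ × ℝ → ℝ≥0∞}
    (hk : ∀ x y l, 0 < l → k x y ≤ ENNReal.ofReal K * majorant α p l x y) :
    supIntFst k (weightW s) ≤ ENNReal.ofReal K * Cm := by
  refine iSup_le fun y => ?_
  calc ∫⁻ x, k x y * ENNReal.ofReal (weightW s x y)
      ≤ ∫⁻ x, ENNReal.ofReal K *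
          (majorant α p (beta α y.2) x y * ENNReal.ofReal (weightW s x y)) := by
        refine lintegral_mono fun x => ?_
        rw [← mul_assoc]
        gcongr
        exact hk x y _ (beta_pos α y.2)
    _ = ENNReal.ofReal K * ∫⁻ x,
          majorant α p (beta α y.2) x y * ENNReal.ofReal (weightW s x y) :=
        lintegral_const_mul' _ _ ENNReal.ofReal_ne_top
    _ ≤ _ := by gcongr; exact hCm y

/-- The majorant and the weight are symmetric, although the oscillation is not, so the bound for the
other variable applies. -/
theorem supIntSnd_le_of_majorant {α p s K : ℝ} {Cm : ℝ≥0∞}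
    (hCm : ∀ y : ℝ × ℝ,
      ∫⁻ x, majorant α p (beta α y.2) x y * ENNReal.ofReal (weightW s x y) ≤ Cm)
    {k : ℝ × ℝ → ℝ × ℝ → ℝ≥0∞}
    (hk : ∀ x y l, 0 < l → k x y ≤ ENNReal.ofReal K * majorant α p l x y) :
    supIntSnd k (weightW s) ≤ ENNReal.ofReal K * Cm := by
  have h := supIntFst_le_of_majorant hCm (k := fun x y => k y x)
    fun x y l hl => majorant_comm α p l y x ▸ hk y x l hl
  refine le_trans (le_of_eq ?_) h
  simp only [supIntSnd, supIntFst]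
  refine iSup_congr fun y => lintegral_congr fun x => ?_
  rw [weightW_comm]

/-! ### The covering -/

section

variable {α : ℝ} (hα0 : 0 ≤ α) (hα1 : α < 1)

/-- `(1 + (1 - α)|t|)^{α/(1-α)}`, the derivative of `p_α`. -/
def pDensity (α t : ℝ) : ℝ := (1 + (1 - α) * |t|) ^ (α / (1 - α))

/-- Bernoulli's inequality at `y/x`, multiplied by `x^κ`. -/
theorem rpow_sub_rpow_le {κ x y : ℝ} (hκ : 1 ≤ κ) (hy : 0 < y) (hyx : y ≤ x) :
    x ^ κ - y ^ κ ≤ κ * x ^ (κ - 1) * (x - y) := by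
  have hx : 0 < x := hy.trans_le hyx
  have h := one_add_mul_self_le_rpow_one_add (s := y / x - 1)
    (by have : 0 < y / x := by positivity
        linarith) hκ
  rw [add_sub_cancel, Real.div_rpow hy.le hx.le] at h
  have hxκ : 0 < x ^ κ := by positivity
  have e : x ^ (κ - 1) = x ^ κ / x := by rw [Real.rpow_sub hx, Real.rpow_one]
  rw [le_div_iff₀ hxκ] at h
  rw [e]
  have e2 : κ * (x ^ κ / x) * (x - y) = -(κ * (y / x - 1) * x ^ κ) := by field_simp; ring
  rw [e2]; linarith

theorem le_rpow_sub_rpow {κ x y : ℝ} (hκ : 1 ≤ κ) (hy : 0 < y) (hyx : y ≤ x) :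
    x ^ (κ - 1) * (x - y) ≤ x ^ κ - y ^ κ := by
  have hx : 0 < x := hy.trans_le hyx
  have e1 : x ^ κ = x ^ (κ - 1) * x := by
    conv_rhs => rw [← Real.rpow_one x, ← Real.rpow_mul hx.le, ← Real.rpow_add hx]
    congr 1; ring
  have e2 : y ^ κ = y ^ (κ - 1) * y := by
    conv_rhs => rw [← Real.rpow_one y, ← Real.rpow_mul hy.le, ← Real.rpow_add hy]
    congr 1; ring
  have h : y ^ (κ - 1) * y ≤ x ^ (κ - 1) * y :=
    mul_le_mul_of_nonneg_right (Real.rpow_le_rpow hy.le hyx (by linarith)) hy.le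
  rw [e1, e2]; linarith

theorem pAlpha_neg (t : ℝ) : pAlpha α (-t) = -pAlpha α t := by
  simp only [pAlpha, Real.sign_neg, abs_neg, neg_mul]

theorem pAlpha_of_nonneg {t : ℝ} (ht : 0 ≤ t) :
    pAlpha α t = (1 + (1 - α) * t) ^ (1 / (1 - α)) - 1 := by
  rcases ht.eq_or_lt with rfl | h
  · simp [pAlpha]
  · rw [pAlpha, Real.sign_of_pos h, abs_of_pos h, one_mul]

include hα1 in
theorem pAlpha_nonneg {t : ℝ} (ht : 0 ≤ t) : 0 ≤ pAlpha α t := by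
  have h1α : 0 < 1 - α := by linarith
  rw [pAlpha_of_nonneg ht, sub_nonneg]
  exact Real.one_le_rpow (by nlinarith) (by positivity)

include hα1 in
theorem one_add_abs_pAlpha (t : ℝ) :
    1 + |pAlpha α t| = (1 + (1 - α) * |t|) ^ (1 / (1 - α)) := by
  rcases le_total 0 t with h | h
  · rw [abs_of_nonneg (pAlpha_nonneg hα1 h), pAlpha_of_nonneg h, abs_of_nonneg h]; ring
  · have h' : 0 ≤ -t := by linarith
    rw [← neg_neg t, pAlpha_neg, abs_neg, abs_of_nonneg (pAlpha_nonneg hα1 h'),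
      pAlpha_of_nonneg h', abs_neg, abs_of_nonneg h']; ring

include hα1 in
theorem beta_pAlpha_inv (t : ℝ) : (beta α (pAlpha α t))⁻¹ = pDensity α t := by
  have h1α : 0 < 1 - α := by linarith
  rw [beta_inv, one_add_abs_pAlpha hα1, ← Real.rpow_mul (by positivity), pDensity]
  congr 1; ring

include hα1 in
theorem one_le_pDensity (hα0 : 0 ≤ α) (t : ℝ) : 1 ≤ pDensity α t := by
  have h1α : 0 < 1 - α := by linarith
  exact Real.one_le_rpow (by nlinarith [abs_nonneg t]) (by positivity)

theorem pDensity_neg (t : ℝ) : pDensity α (-t) = pDensity α t := by simp [pDensity]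

-- Power differences with exponent `1/(1-α)`. The lower bound has no factor `1/(1-α)` to cancel the
-- slope `1-α`, hence the loss of `1-α`.
include hα0 hα1 in
theorem pAlpha_sub_bounds_of_nonneg {t t' : ℝ} (ht' : 0 ≤ t') (h : t' ≤ t) :
    (1 - α) * pDensity α t * (t - t') ≤ pAlpha α t - pAlpha α t' ∧
    pAlpha α t - pAlpha α t' ≤ pDensity α t * (t - t') := by
  have h1α : 0 < 1 - α := by linarith
  have ht : 0 ≤ t := ht'.trans h
  have hκ : 1 ≤ 1 / (1 - α) := by rw [le_div_iff₀ h1α]; linarith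
  have hy : 0 < 1 + (1 - α) * t' := by positivity
  have hyx : 1 + (1 - α) * t' ≤ 1 + (1 - α) * t := by gcongr
  have e : 1 / (1 - α) - 1 = α / (1 - α) := by field_simp; ring
  have h1 := rpow_sub_rpow_le hκ hy hyx
  have h2 := le_rpow_sub_rpow hκ hy hyx
  rw [e] at h1 h2
  rw [pAlpha_of_nonneg ht, pAlpha_of_nonneg ht', pDensity, abs_of_nonneg ht]
  constructor
  · calc _ = (1 + (1 - α) * t) ^ (α / (1 - α)) *
        (1 + (1 - α) * t - (1 + (1 - α) * t')) := by ring
      _ ≤ _ := by linarith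
  · calc _ ≤ 1 / (1 - α) * (1 + (1 - α) * t) ^ (α / (1 - α)) *
        (1 + (1 - α) * t - (1 + (1 - α) * t')) := by linarith
      _ = _ := by field_simp; ring

-- `p_α` is odd; an interval containing `0` is split there.
include hα0 hα1 in
theorem pAlpha_sub_bounds_of_le {t t' : ℝ} (h : t' ≤ t) :
    (1 - α) * min (pDensity α t) (pDensity α t') * (t - t') ≤ pAlpha α t - pAlpha α t' ∧
    pAlpha α t - pAlpha α t' ≤ max (pDensity α t) (pDensity α t') * (t - t') := by
  have h1α : 0 < 1 - α := by linarith
  have hd : 0 ≤ t - t' := by linarith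
  have z0 : pAlpha α 0 = 0 := by simp [pAlpha]
  rcases le_total 0 t' with h0 | h0
  · obtain ⟨h1, h2⟩ := pAlpha_sub_bounds_of_nonneg hα0 hα1 h0 h
    constructor
    · refine le_trans ?_ h1
      gcongr; exact min_le_left _ _
    · refine h2.trans ?_
      gcongr; exact le_max_left _ _
  · rcases le_total 0 t with h3 | h3
    · obtain ⟨h1, h2⟩ := pAlpha_sub_bounds_of_nonneg hα0 hα1 le_rfl h3
      obtain ⟨h1', h2'⟩ := pAlpha_sub_bounds_of_nonneg hα0 hα1 le_rfl (neg_nonneg.2 h0)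
      rw [pAlpha_neg, pDensity_neg] at h1' h2'
      rw [z0] at h1 h2 h1' h2'
      have ht' : 0 ≤ -t' := by linarith
      constructor
      · have a1 : (1 - α) * min (pDensity α t) (pDensity α t') * t ≤
            (1 - α) * pDensity α t * t := by gcongr; exact min_le_left _ _
        have a2 : (1 - α) * min (pDensity α t) (pDensity α t') * (-t') ≤
            (1 - α) * pDensity α t' * (-t') := by gcongr; exact min_le_right _ _
        linarith
      · have a1 : pDensity α t * t ≤ max (pDensity α t) (pDensity α t') * t := by
          gcongr; exact le_max_left _ _
        have a2 : pDensity α t' * (-t') ≤ max (pDensity α t) (pDensity α t') * (-t') := by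
          gcongr; exact le_max_right _ _
        linarith
    · obtain ⟨h1, h2⟩ := pAlpha_sub_bounds_of_nonneg hα0 hα1 (neg_nonneg.2 h3) (neg_le_neg h)
      rw [pAlpha_neg, pAlpha_neg, pDensity_neg] at h1 h2
      constructor
      · have : (1 - α) * min (pDensity α t) (pDensity α t') * (t - t') ≤
            (1 - α) * pDensity α t' * (t - t') := by gcongr; exact min_le_right _ _
        linarith
      · have : pDensity α t' * (t - t') ≤ max (pDensity α t) (pDensity α t') * (t - t') := by
          gcongr; exact le_max_right _ _
        linarith

include hα0 hα1 in
theorem abs_pAlpha_sub_bounds (t t' : ℝ) :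
    (1 - α) * min (pDensity α t) (pDensity α t') * |t - t'| ≤ |pAlpha α t - pAlpha α t'| ∧
    |pAlpha α t - pAlpha α t'| ≤ max (pDensity α t) (pDensity α t') * |t - t'| := by
  have h1α : 0 < 1 - α := by linarith
  have key : ∀ {t t' : ℝ}, t' ≤ t →
      (1 - α) * min (pDensity α t) (pDensity α t') * |t - t'| ≤ |pAlpha α t - pAlpha α t'| ∧
      |pAlpha α t - pAlpha α t'| ≤ max (pDensity α t) (pDensity α t') * |t - t'| := by
    intro t t' h
    have hm : 0 ≤ min (pDensity α t) (pDensity α t') :=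
      zero_le_one.trans (le_min (one_le_pDensity hα1 hα0 t) (one_le_pDensity hα1 hα0 t'))
    obtain ⟨h1, h2⟩ := pAlpha_sub_bounds_of_le hα0 hα1 h
    have hd : 0 ≤ t - t' := by linarith
    have : 0 ≤ pAlpha α t - pAlpha α t' := le_trans (by positivity) h1
    rw [abs_of_nonneg hd, abs_of_nonneg this]
    exact ⟨h1, h2⟩
  rcases le_total t' t with h | h
  · exact key h
  · rw [min_comm, max_comm, abs_sub_comm t, abs_sub_comm (pAlpha α t)]
    exact key h

include hα1 in
theorem pAlpha_surjective : Function.Surjective (pAlpha α) := by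
  have h1α : 0 < 1 - α := by linarith
  have key : ∀ w : ℝ, 0 ≤ w → ∃ t, pAlpha α t = w := by
    intro w hw
    have h1 : 1 ≤ (1 + w) ^ (1 - α) := Real.one_le_rpow (by linarith) h1α.le
    refine ⟨((1 + w) ^ (1 - α) - 1) / (1 - α), ?_⟩
    rw [pAlpha_of_nonneg (div_nonneg (by linarith) h1α.le), mul_div_cancel₀ _ h1α.ne',
      add_sub_cancel, ← Real.rpow_mul (by linarith), mul_one_div_cancel h1α.ne', Real.rpow_one]
    ring
  intro w
  rcases le_total 0 w with h | h
  · exact key w h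
  · obtain ⟨t, ht⟩ := key (-w) (by linarith)
    exact ⟨-t, by rw [pAlpha_neg, ht, neg_neg]⟩

include hα0 hα1 in
/-- `p_α'` is slowly varying. -/
theorem pDensity_le_mul {t t' d : ℝ} (h : |t - t'| ≤ d) :
    pDensity α t ≤ (1 + d) ^ (α / (1 - α)) * pDensity α t' := by
  have h1α : 0 < 1 - α := by linarith
  have hd : 0 ≤ d := (abs_nonneg _).trans h
  rw [pDensity, pDensity, ← Real.mul_rpow (by positivity) (by positivity)]
  refine Real.rpow_le_rpow (by positivity) ?_ (by positivity)
  have h2 : |t| ≤ |t'| + d := by linarith [abs_sub_abs_le_abs_sub t t']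
  have h3 := abs_nonneg t'
  nlinarith [mul_nonneg h1α.le h3, mul_nonneg hd (mul_nonneg h1α.le h3)]

end

/-! ### Admissibility of the covering and its weight constant -/

section

variable {α c ε : ℝ} (hα0 : 0 ≤ α) (hα1 : α < 1)

/-- The side lengths `2εβ` and `4εc/β` scale inversely, so all members have the same measure. -/
theorem volume_coverU (hε : 0 < ε) (i : ℤ × ℤ) :
    volume (coverU α c ε i) = ENNReal.ofReal (8 * ε ^ 2 * c) := by
  have hb := beta_pos α (omegaPt α ε i.1)
  rw [coverU, Measure.volume_eq_prod, Measure.prod_prod, Real.volume_Ioo, Real.volume_Ioo,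
    ← ENNReal.ofReal_mul (by nlinarith [mul_pos hε hb])]
  congr 1
  field_simp
  ring

include hα0 hα1 in
theorem beta_omegaPt_le (hε : 0 < ε) (hc : 0 < c) (hsmall : ε * (4 + 16 * c) ≤ 1 / 4)
    {i : ℤ × ℤ} {z : ℝ × ℝ} (hz : z ∈ coverU α c ε i) :
    beta α (omegaPt α ε i.1) ≤ 4 / 3 * beta α z.2 ∧
      beta α z.2 ≤ 3 / 2 * beta α (omegaPt α ε i.1) := by
  have hεc : 0 < ε * c := by positivity
  have hj := beta_pos α (omegaPt α ε i.1)
  have h := abs_le.1 (abs_beta_sub_le hα0 hα1 (by nlinarith : 2 * ε * c ≤ 1 / 2)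
    (abs_sub_omegaPt_le hz))
  constructor <;> nlinarith

-- At a common point `β` is comparable with both centre values, so the centres differ by `O(εc/β)`;
-- as `p_α` has speed `1/β`, this bounds `j' - j` independently of `ε`. The time intervals then
-- confine `k'` to a bounded window about the rescaled `k`.
include hα0 hα1 in
theorem overlap_bounds (hε : 0 < ε) (hc : 0 < c) (hsmall : ε * (4 + 16 * c) ≤ 1 / 4)
    {i i' : ℤ × ℤ} (h : (coverU α c ε i' ∩ coverU α c ε i).Nonempty) :
    |((i'.1 : ℝ) - i.1)| ≤ 6 * c / (1 - α) ∧
    |(i'.2 : ℝ) - beta α (omegaPt α ε i.1) / beta α (omegaPt α ε i'.1) * i.2| < 3 := by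
  obtain ⟨z, hz', hz⟩ := h
  have h1α : 0 < 1 - α := by linarith
  have hεc : 0 < ε * c := by positivity
  have hB := beta_pos α (omegaPt α ε i.1)
  have hB' := beta_pos α (omegaPt α ε i'.1)
  obtain ⟨b1, b2⟩ := beta_omegaPt_le hα0 hα1 hε hc hsmall hz
  obtain ⟨b1', b2'⟩ := beta_omegaPt_le hα0 hα1 hε hc hsmall hz'
  have d := abs_sub_omegaPt_le hz
  have d' := abs_sub_omegaPt_le hz'
  have hz1 := hz.1
  have hz1' := hz'.1
  have hpd : (beta α (omegaPt α ε i.1))⁻¹ = pDensity α (ε * i.1) := beta_pAlpha_inv hα1 _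
  have hpd' : (beta α (omegaPt α ε i'.1))⁻¹ = pDensity α (ε * i'.1) := beta_pAlpha_inv hα1 _
  have hlow := (abs_pAlpha_sub_bounds hα0 hα1 (ε * i'.1) (ε * i.1)).1
  rw [← hpd, ← hpd'] at hlow
  change _ ≤ |omegaPt α ε i'.1 - omegaPt α ε i.1| at hlow
  set B := beta α (omegaPt α ε i.1)
  set B' := beta α (omegaPt α ε i'.1)
  have hBB : B ≤ 2 * B' := by linarith
  have hBB' : B' ≤ 2 * B := by linarith
  have inv1 : B⁻¹ ≤ 2 * B'⁻¹ := by
    rw [← div_eq_mul_inv, le_div_iff₀ hB', inv_mul_le_iff₀ hB]; linarith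
  have inv2 : B'⁻¹ ≤ 2 * B⁻¹ := by
    rw [← div_eq_mul_inv, le_div_iff₀ hB, inv_mul_le_iff₀ hB']; linarith
  constructor
  · have hd : |omegaPt α ε i'.1 - omegaPt α ε i.1| ≤ 2 * ε * c * (B⁻¹ + B'⁻¹) := by
      calc _ ≤ |omegaPt α ε i'.1 - z.2| + |z.2 - omegaPt α ε i.1| := abs_sub_le _ _ _
        _ ≤ _ := by rw [abs_sub_comm _ z.2]; linarith
    have hmin : B⁻¹ + B'⁻¹ ≤ 3 * min B'⁻¹ B⁻¹ := by
      rcases min_choice B'⁻¹ B⁻¹ with h | h <;> rw [h] <;> linarith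
    have hm : 0 < min B'⁻¹ B⁻¹ := lt_min (inv_pos.2 hB') (inv_pos.2 hB)
    have e : |ε * (i'.1 : ℝ) - ε * i.1| = ε * |(i'.1 : ℝ) - i.1| := by
      rw [← mul_sub, abs_mul, abs_of_pos hε]
    rw [e] at hlow
    rw [le_div_iff₀ h1α]
    have hfin : (min B'⁻¹ B⁻¹ * ε) * (|(i'.1 : ℝ) - i.1| * (1 - α)) ≤
        (min B'⁻¹ B⁻¹ * ε) * (6 * c) := by
      calc _ = (1 - α) * min B'⁻¹ B⁻¹ * (ε * |(i'.1 : ℝ) - i.1|) := by ring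
        _ ≤ 2 * ε * c * (B⁻¹ + B'⁻¹) := hlow.trans hd
        _ ≤ 2 * ε * c * (3 * min B'⁻¹ B⁻¹) := by
            refine mul_le_mul_of_nonneg_left hmin (by positivity)
        _ = _ := by ring
    exact le_of_mul_le_mul_left hfin (by positivity)
  · have e : (i'.2 : ℝ) - B / B' * i.2 = (B' * i'.2 - B * i.2) / B' := by field_simp
    rw [e, abs_div, abs_of_pos hB', div_lt_iff₀ hB']
    have h3 : |B' * i'.2 - B * i.2| < B + B' := by
      have k1 := hz1.1
      have k2 := hz1.2
      have k3 := hz1'.1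
      have k4 := hz1'.2
      have hlt1 : ε * (B' * i'.2 - B * i.2) < ε * (B + B') := by linarith
      have hlt2 : ε * (-(B + B')) < ε * (B' * i'.2 - B * i.2) := by linarith
      rw [abs_lt]
      exact ⟨lt_of_mul_lt_mul_left hlt2 hε.le, lt_of_mul_lt_mul_left hlt1 hε.le⟩
    linarith

include hα0 hα1 in
theorem isModerateAdmissibleCovering_coverU (hε : 0 < ε) (hc : 0 < c)
    (hsmall : ε * (4 + 16 * c) ≤ 1 / 4) (hdens : (1 + ε) ^ (α / (1 - α)) < 4 * c) :
    IsModerateAdmissibleCovering volume (coverU α c ε) where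
  countable_index := inferInstance
  relatively_compact i :=
    ((Metric.isBounded_Ioo _ _).prod (Metric.isBounded_Ioo _ _)).isCompact_closure
  interior_nonempty i := by
    rw [(isOpen_coverU α c ε i).interior_eq]
    have hb := beta_pos α (omegaPt α ε i.1)
    refine (nonempty_Ioo.2 ?_).prod (nonempty_Ioo.2 ?_)
    · nlinarith [mul_pos hε hb]
    · have : 0 < 2 * ε * c * (beta α (omegaPt α ε i.1))⁻¹ := by positivity
      linarith
  covers := by
    have h1α : 0 < 1 - α := by linarith
    refine eq_univ_of_forall fun z => mem_iUnion.2 ?_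
    obtain ⟨t, ht⟩ := pAlpha_surjective hα1 z.2
    set j := round (t / ε) with hj
    have hb := beta_pos α (omegaPt α ε j)
    set B := beta α (omegaPt α ε j) with hB
    have hεB : 0 < ε * B := by positivity
    -- `j` is the nearest sample in the parameter of `p_α`; the floor works because the time
    -- interval reaches one step to either side of `k`.
    refine ⟨(j, ⌊z.1 / (ε * B)⌋), ⟨?_, ?_⟩, ?_⟩
    · have := Int.floor_le (z.1 / (ε * B))
      rw [le_div_iff₀ hεB] at this
      simp only [← hB]
      nlinarith
    · have := Int.lt_floor_add_one (z.1 / (ε * B))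
      rw [div_lt_iff₀ hεB] at this
      simp only [← hB]
      nlinarith
    · have hround : |t - ε * j| ≤ ε / 2 := by
        have := abs_sub_round (t / ε)
        have e : t - ε * j = ε * (t / ε - j) := by field_simp
        rw [e, abs_mul, abs_of_pos hε]
        nlinarith
      have hup := (abs_pAlpha_sub_bounds hα0 hα1 t (ε * j)).2
      have hpd : B⁻¹ = pDensity α (ε * j) := beta_pAlpha_inv hα1 _
      have hp1 : 0 < pDensity α (ε * j) := one_pos.trans_le (one_le_pDensity hα1 hα0 _)
      have hmax : max (pDensity α t) (pDensity α (ε * j)) ≤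
          (1 + ε) ^ (α / (1 - α)) * pDensity α (ε * j) := by
        refine max_le (pDensity_le_mul hα0 hα1 (hround.trans (by linarith))) ?_
        exact le_mul_of_one_le_left hp1.le (Real.one_le_rpow (by linarith) (by positivity))
      -- The rounding error `ε/2` times the local speed, at most `(1+ε)^{α/(1-α)}/β(ω_j)`, must stay
      -- below `2εc/β(ω_j)`: this is the condition `(1+ε)^{α/(1-α)} < 4c`.
      have hlt : |z.2 - omegaPt α ε j| < 2 * ε * c * B⁻¹ := by
        rw [hpd, ← ht]
        calc |pAlpha α t - omegaPt α ε j| ≤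
            max (pDensity α t) (pDensity α (ε * j)) * |t - ε * j| := hup
          _ ≤ ((1 + ε) ^ (α / (1 - α)) * pDensity α (ε * j)) * (ε / 2) := by gcongr
          _ < (4 * c * pDensity α (ε * j)) * (ε / 2) := by gcongr
          _ = _ := by ring
      rw [abs_lt] at hlt
      simp only [← hB]
      exact ⟨by linarith [hlt.1], by linarith [hlt.2]⟩
  finite_overlap := by
    set N₁ : ℤ := ⌈6 * c / (1 - α)⌉ with hN
    refine ⟨(Finset.Icc (-N₁) N₁ ×ˢ Finset.Icc (-4 : ℤ) 4).card, fun i => ?_⟩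
    -- Subtracting the predicted position, which depends on `i'` only through `i'.1`, keeps the map
    -- injective and sends all neighbours into a fixed box.
    set f : ℤ × ℤ → ℤ × ℤ := fun i' =>
      (i'.1 - i.1, i'.2 - ⌊beta α (omegaPt α ε i.1) / beta α (omegaPt α ε i'.1) * i.2⌋) with hf
    have hmaps : MapsTo f {i' | (coverU α c ε i' ∩ coverU α c ε i).Nonempty}
        (Finset.Icc (-N₁) N₁ ×ˢ Finset.Icc (-4 : ℤ) 4 : Finset (ℤ × ℤ)) := by
      intro i' hi'
      obtain ⟨h1, h2⟩ := overlap_bounds hα0 hα1 hε hc hsmall hi'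
      have h1' : |((i'.1 : ℝ) - i.1)| ≤ N₁ := h1.trans (Int.le_ceil _)
      have h1'' : |i'.1 - i.1| ≤ N₁ := by exact_mod_cast h1'
      rw [abs_le] at h1''
      rw [abs_lt] at h2
      set q := beta α (omegaPt α ε i.1) / beta α (omegaPt α ε i'.1) * i.2
      have f1 := Int.floor_le q
      have f2 := Int.lt_floor_add_one q
      have g1 : ((-4 : ℤ) : ℝ) < ((i'.2 - ⌊q⌋ : ℤ) : ℝ) := by push_cast; linarith
      have g2 : ((i'.2 - ⌊q⌋ : ℤ) : ℝ) < ((4 : ℤ) : ℝ) := by push_cast; linarith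
      simp only [hf, Finset.coe_product, Finset.coe_Icc, mem_prod, mem_Icc]
      exact ⟨h1'', (Int.cast_lt.1 g1).le, (Int.cast_lt.1 g2).le⟩
    have hinj : InjOn f {i' | (coverU α c ε i' ∩ coverU α c ε i).Nonempty} := by
      rintro ⟨a, b⟩ - ⟨a', b'⟩ - hab
      simp only [hf, Prod.mk.injEq] at hab
      obtain ⟨h1, h2⟩ := hab
      have ha : a = a' := by linarith
      subst ha
      have hb : b = b' := by linarith
      rw [hb]
    refine (encard_le_encard_of_injOn hmaps hinj).trans ?_
    rw [encard_coe_eq_coe_finsetCard]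
  measure_lower := ⟨ENNReal.ofReal (8 * ε ^ 2 * c), by simp; positivity,
    fun i => (volume_coverU hε i).ge⟩
  measure_comparable := ⟨1, ENNReal.one_ne_top, fun i j _ => by
    rw [volume_coverU hε, volume_coverU hε, one_mul]⟩

-- Within a member `1+|ω|` deviates by at most an eighth from its value at the centre, so ratios are
-- at most `(9/8)/(7/8) < 2`.
include hα1 in
theorem weightConst_coverU_le (hε : 0 < ε) (hc : 0 < c) (hsmall : ε * (4 + 16 * c) ≤ 1 / 4)
    {s : ℝ} (hs : 0 ≤ s) :
    weightConst (weightW s) (coverU α c ε) ≤ ENNReal.ofReal (2 ^ s) := by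
  have hεc : 0 < ε * c := by positivity
  have key : ∀ i, ∀ z ∈ coverU α c ε i,
      |(1 + |z.2|) - (1 + |omegaPt α ε i.1|)| ≤ 1 / 8 * (1 + |omegaPt α ε i.1|) := by
    intro i z hz
    have h1 := abs_sub_omegaPt_le hz
    rw [beta_inv] at h1
    have h2 := one_add_abs_rpow_le hα1 (omegaPt α ε i.1)
    rw [add_sub_add_left_eq_sub]
    refine (abs_abs_sub_abs_le_abs_sub _ _).trans (h1.trans ?_)
    refine mul_le_mul (by nlinarith) h2 (by positivity) (by norm_num)
  have key2 : ∀ i, ∀ x ∈ coverU α c ε i, ∀ y ∈ coverU α c ε i,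
      weightV s x / weightV s y ≤ 2 ^ s := by
    intro i x hx y hy
    have h1 := abs_le.1 (key i x hx)
    have h2 := abs_le.1 (key i y hy)
    have hW : 0 < 1 + |omegaPt α ε i.1| := by positivity
    have hy0 : 0 < 1 + |y.2| := by positivity
    rw [weightV, weightV, ← Real.div_rpow (by positivity) (by positivity)]
    refine Real.rpow_le_rpow (by positivity) ?_ hs
    rw [div_le_iff₀ hy0]
    linarith
  refine iSup_le fun i => iSup₂_le fun x hx => iSup₂_le fun y hy => ?_
  exact ENNReal.ofReal_le_ofReal (max_le (key2 i x hx y hy) (key2 i y hy x hx))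

end

/-! ### A compactly supported window -/

theorem exists_compactSupport_hasFourierDecay :
    ∃ ψ : L2, ψ ≠ 0 ∧ (∃ S : Set ℝ, IsCompact S ∧ ∀ᵐ t : ℝ, t ∉ S → ψ t = 0) ∧
      ∀ r : ℝ, HasFourierDecay 3 r ψ := by
  let f : ContDiffBump (0 : ℝ) := ⟨1, 2, one_pos, one_lt_two⟩
  have hf₁ : HasCompactSupport (Complex.ofRealCLM ∘ f) := f.hasCompactSupport.comp_left rfl
  have hf₂ : ContDiff ℝ (⊤ : ℕ∞) (Complex.ofRealCLM ∘ f) :=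
    Complex.ofRealCLM.contDiff.comp f.contDiff
  set G := hf₁.toSchwartzMap hf₂ with hG
  have hGx : ∀ x, G x = (f x : ℂ) := fun x => rfl
  have hae := G.coeFn_toLp 2 (volume : Measure ℝ)
  refine ⟨G.toLp 2, fun h0 => ?_, ⟨tsupport f, f.hasCompactSupport, ?_⟩, fun r => ?_⟩
  · rw [h0] at hae
    have h1 : (G : ℝ → ℂ) =ᵐ[volume] fun _ => 0 := hae.symm.trans (Lp.coeFn_zero _ _ _)
    have h2 := congrFun ((G.continuous.ae_eq_iff_eq volume continuous_const).1 h1) 0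
    rw [hGx, f.one_of_mem_closedBall (by simp [f])] at h2
    simp at h2
  · filter_upwards [hae] with t ht hS
    rw [ht, hGx, image_eq_zero_of_notMem_tsupport hS, Complex.ofReal_zero]
  · set H : SchwartzMap ℝ ℂ := 𝓕 G with hH
    refine ⟨H, ?_, H.smooth 3, ?_⟩
    · rw [SchwartzMap.toLp_fourier_eq]
      exact H.coeFn_toLp 2 volume
    -- Schwartz seminorms control integer powers, so `r` is rounded up; for negative `r` this gives
    -- `k = 0`, which suffices.
    · set k := ⌈r⌉₊ with hk
      refine ⟨2 ^ k * ((Finset.Iic ((k, 3) : ℕ × ℕ)).sup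
        fun m => SchwartzMap.seminorm ℝ m.1 m.2) H, fun l hl ξ => ?_⟩
      have h := SchwartzMap.one_add_le_sup_seminorm_apply (𝕜 := ℝ) (m := (k, 3)) (le_refl k) hl
        H ξ
      rw [norm_iteratedFDeriv_eq_norm_iteratedDeriv, Real.norm_eq_abs] at h
      have hpos : 0 < (1 + |ξ|) ^ k := by positivity
      have hr : (1 + |ξ|) ^ r ≤ (1 + |ξ|) ^ k := by
        rw [← Real.rpow_natCast]
        exact Real.rpow_le_rpow_of_exponent_le (by linarith [abs_nonneg ξ]) (Nat.le_ceil r)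
      rw [Real.rpow_neg (by positivity), ← div_eq_mul_inv, le_div_iff₀ (by positivity), mul_comm]
      exact (mul_le_mul_of_nonneg_right hr (norm_nonneg _)).trans h

/-! ### Discretization -/

/-- The threshold for the majorant already implies what the symbol needs: integrability of its
defining integral and of its derivatives after the loss of `3α` powers. -/
theorem exponent_conditions {α s r : ℝ} (hα0 : 0 ≤ α) (hα1 : α < 1) (hs : 0 ≤ s)
    (hr : (2 + 2 * s + 7 * α - 4 * α ^ 2) / (2 * (1 - α) ^ 2) + 1 < r) :
    2 < r ∧ 1 < (1 - α) * r ∧ 1 < (1 - α) * (r - 3 * α) := by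
  have h1α : 0 < 1 - α := by linarith
  have hd : 0 < 2 * (1 - α) ^ 2 := by positivity
  have hr' : 2 + 2 * s + 7 * α - 4 * α ^ 2 < (r - 1) * (2 * (1 - α) ^ 2) := by
    rw [← div_lt_iff₀ hd]; linarith
  have h3 : 1 < (1 - α) * (r - 3 * α) := by
    rw [← sub_pos]
    refine pos_of_mul_pos_left (b := 1 - α) ?_ h1α.le
    nlinarith [mul_nonneg hα0 h1α.le, mul_nonneg hα0 (mul_nonneg hα0 h1α.le)]
  refine ⟨?_, ?_, h3⟩
  · rw [← sub_pos]
    refine pos_of_mul_pos_left (b := (1 - α) ^ 2) ?_ (by positivity)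
    nlinarith [mul_nonneg hα0 h1α.le]
  · nlinarith [mul_nonneg hα0 h1α.le]

end

end AlphaMod

open AlphaMod in
theorem theorem5p8 (α c : ℝ) (hα0 : 0 ≤ α) (hα1 : α < 1) (hc : 0 < c) :
    (∃ Γ : ℝ × ℝ → ℝ × ℝ → ℂ,
      Measurable (Function.uncurry Γ) ∧ (∀ y z, ‖Γ y z‖ = 1) ∧
      ∀ (s r : ℝ) (ψ : L2), 0 ≤ s → ψ ≠ 0 →
        (2 + 2 * s + 7 * α - 4 * α ^ 2) / (2 * (1 - α) ^ 2) + 1 < r →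
        HasFourierDecay 3 r ψ →
        ∃ A : L2 ≃L[ℂ] L2, IsFrameOperator α ψ A ∧
          (∀ ε : ℝ, 0 < ε → Measurable (Function.uncurry (oscEps α c ψ A Γ ε))) ∧
          Tendsto (gammaMax α c s ψ A Γ) (𝓝[>] 0) (𝓝 0) ∧
          (1 / 4 < c →
            rho α s ψ A < ∞ ∧
            ∃ ε₀ : ℝ, 0 < ε₀ ∧ ∃ K : ℝ≥0∞, K < ∞ ∧ ∀ ε : ℝ, 0 < ε → ε < ε₀ →
              IsModerateAdmissibleCovering volume (coverU α c ε) ∧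
              weightConst (weightW s) (coverU α c ε) ≤ K ∧
              gammaMax α c s ψ A Γ ε *
                (rho α s ψ A + max (rho α s ψ A * weightConst (weightW s) (coverU α c ε))
                  (rho α s ψ A + gammaMax α c s ψ A Γ ε)) < 1)) ∧
    (∃ ψ : L2, ψ ≠ 0 ∧ (∃ S : Set ℝ, IsCompact S ∧ ∀ᵐ t : ℝ, t ∉ S → ψ t = 0) ∧
      ∀ r : ℝ, HasFourierDecay 3 r ψ) := by
  refine ⟨⟨phase, continuous_phase.measurable, norm_phase, ?_⟩,
    exists_compactSupport_hasFourierDecay⟩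
  intro s r ψ hs hψ0 hr hψ
  have h1α : 0 < 1 - α := by linarith
  obtain ⟨hr2, hr1, hr3⟩ := exponent_conditions hα0 hα1 hs hr
  obtain ⟨C, D, hD⟩ := hψ.exists_decayJet
  have hne : ∃ x, D.f x ≠ 0 := by
    by_contra! h
    have h0 : (𝓕 ψ : L2) = 0 := by
      ext1
      filter_upwards [hD, Lp.coeFn_zero ℂ 2 (volume : Measure ℝ)] with x h1 h2
      rw [h1, h2, h x, Pi.zero_apply]
    refine hψ0 (norm_eq_zero.1 ?_)
    rw [← Lp.norm_fourier_eq, h0, norm_zero]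
  obtain ⟨A, hA, hcont, K, hK0, hRbd, hObd⟩ := D.exists_kernel hα0 hα1 hr1 hr2 hr3 hD hne
  -- The `+ 1` in the hypothesis on `r` is the power of decay lost in the oscillation.
  obtain ⟨Cm, hCm, hCmbd⟩ := majorant_integral_lt_top hα0 hα1 hs (p := r - 1) (by linarith)
  have hrho : rho α s ψ A < ∞ := (supIntFst_le_of_majorant hCmbd hRbd).trans_lt
    (ENNReal.mul_lt_top ENNReal.ofReal_lt_top hCm)
  have hγ : ∀ ε, 0 < ε → ε * (4 + 16 * c) ≤ 1 / 4 →
      gammaMax α c s ψ A phase ε ≤ ENNReal.ofReal (K * (ε * (4 + 16 * c))) * Cm := by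
    intro ε hε hsmall
    have hk : ∀ x y l, 0 < l → oscEps α c ψ A phase ε x y ≤
        ENNReal.ofReal (K * (ε * (4 + 16 * c))) * majorant α (r - 1) l x y := by
      intro x y l hl
      refine iSup₂_le fun z hz => ?_
      obtain ⟨h1, h2, h3⟩ := nbhdQ_bounds hα0 hα1 hc hε hsmall hz
      exact hObd _ hsmall x y z h1 h2 h3 l hl
    exact max_le (supIntFst_le_of_majorant hCmbd hk) (supIntSnd_le_of_majorant hCmbd hk)
  have hpos : ∀ᶠ ε : ℝ in 𝓝[>] 0, 0 < ε := self_mem_nhdsWithin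
  have hsm : ∀ᶠ ε : ℝ in 𝓝[>] 0, ε * (4 + 16 * c) ≤ 1 / 4 := by
    have h : ContinuousAt (fun ε : ℝ => ε * (4 + 16 * c)) 0 := by fun_prop
    have h0 : (0 : ℝ) * (4 + 16 * c) < 1 / 4 := by norm_num
    exact ((h.eventually (gt_mem_nhds h0)).filter_mono nhdsWithin_le_nhds).mono
      fun ε hε => le_of_lt hε
  have hγ0 : Tendsto (gammaMax α c s ψ A phase) (𝓝[>] 0) (𝓝 0) := by
    have hlim : Tendsto (fun ε : ℝ => ENNReal.ofReal (K * (ε * (4 + 16 * c))) * Cm) (𝓝[>] 0)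
        (𝓝 0) := by
      have h1 : Tendsto (fun ε : ℝ => ENNReal.ofReal (K * (ε * (4 + 16 * c)))) (𝓝[>] 0)
          (𝓝 0) := by
        have h2 : Continuous fun ε : ℝ => ENNReal.ofReal (K * (ε * (4 + 16 * c))) :=
          ENNReal.continuous_ofReal.comp (by fun_prop)
        have h3 := (h2.tendsto 0).mono_left (nhdsWithin_le_nhds (s := Ioi 0))
        simpa using h3
      simpa using ENNReal.Tendsto.mul_const h1 (Or.inr hCm.ne)
    refine tendsto_of_tendsto_of_tendsto_of_le_of_le' tendsto_const_nhds hlim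
      (Eventually.of_forall fun _ => zero_le) ?_
    filter_upwards [hpos, hsm] with ε h1 h2 using hγ ε h1 h2
  refine ⟨A, hA, fun ε _ => measurable_osc hcont continuous_phase (isOpen_coverU α c ε), hγ0,
    fun hc4 => ⟨hrho, ?_⟩⟩
  set W : ℝ≥0∞ := ENNReal.ofReal (2 ^ s) with hW
  -- The left side tends to `1`; this is the use of `c > 1/4`.
  have hdens : ∀ᶠ ε : ℝ in 𝓝[>] 0, (1 + ε) ^ (α / (1 - α)) < 4 * c := by
    have h : ContinuousAt (fun ε : ℝ => (1 + ε) ^ (α / (1 - α))) 0 :=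
      ContinuousAt.rpow_const (by fun_prop) (Or.inl (by norm_num))
    refine (h.eventually (gt_mem_nhds ?_)).filter_mono nhdsWithin_le_nhds
    simp only [add_zero, Real.one_rpow]
    linarith
  -- The maximum is bounded by a sum and the weight constant by the fixed `W`; the second factor
  -- then has a finite limit while `γ(ε) → 0`.
  have hprod : ∀ᶠ ε : ℝ in 𝓝[>] 0, gammaMax α c s ψ A phase ε *
      (rho α s ψ A + (rho α s ψ A * W + (rho α s ψ A + gammaMax α c s ψ A phase ε))) < 1 := by
    have hsum : Tendsto (fun ε => rho α s ψ A + (rho α s ψ A * W +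
        (rho α s ψ A + gammaMax α c s ψ A phase ε))) (𝓝[>] 0)
        (𝓝 (rho α s ψ A + (rho α s ψ A * W + (rho α s ψ A + 0)))) :=
      tendsto_const_nhds.add (tendsto_const_nhds.add (tendsto_const_nhds.add hγ0))
    have hfin : rho α s ψ A + (rho α s ψ A * W + (rho α s ψ A + 0)) ≠ ∞ := by
      have h2 : rho α s ψ A * W ≠ ∞ := ENNReal.mul_ne_top hrho.ne ENNReal.ofReal_ne_top
      simp [hrho.ne, h2]
    have h := ENNReal.Tendsto.mul hγ0 (Or.inr hfin) hsum (Or.inr ENNReal.zero_ne_top)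
    rw [zero_mul] at h
    exact h.eventually (gt_mem_nhds one_pos)
  obtain ⟨ε₀, hε₀, hall⟩ := mem_nhdsGT_iff_exists_Ioo_subset.1 (hsm.and (hdens.and hprod))
  refine ⟨ε₀, hε₀, W, ENNReal.ofReal_lt_top, fun ε hε hlt => ?_⟩
  obtain ⟨h1, h2, h3⟩ := hall ⟨hε, hlt⟩
  have hw := weightConst_coverU_le hα1 hε hc h1 hs
  refine ⟨isModerateAdmissibleCovering_coverU hα0 hα1 hε hc h1 h2, hw, lt_of_le_of_lt ?_ h3⟩
  gcongr
  refine max_le ?_ ?_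
  · exact (mul_le_mul_right hw _).trans le_self_add
  · exact le_add_self
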